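/- **Programming language.** Let $\mathrm{Fun}$, $\mathrm{Loc}$, $\mathrm{Var}$ be countably infinite sets of function identifiers, locations and variables. Values, expressions (up to renaming of bound variables) and evaluation contexts are $$u,v ::= ()\mid n\mid x\mid l\mid f\mid\langle u,v\rangle\qquad(n\in\mathbb Z,\ x\in\mathrm{Var},\ l\in\mathrm{Loc},\ f\in\mathrm{Fun}),$$ $$e ::= v\mid\lambda x.e\mid e\,e'\mid \mathsf{if}\ e_1\ \mathsf{then}\ e_2\ \mathsf{else}\ e_3\mid\langle e,e'\rangle\mid\pi_i(e)\mid\mathsf{ref}\,e\mid{!}e\mid e\ \mathsf{op}\ e'\mid\mathsf{emit}\,v,$$ $$K ::= [\,]\mid K e\mid vK\mid K\,\mathsf{op}\,e\mid v\,\mathsf{op}\,K\mid\mathsf{if}\ K\ \mathsf{then}\ e\ \mathsf{else}\ e'\mid\langle K,e\rangle\mid\langle v,K\rangle\mid\pi_i(K)\mid\mathsf{ref}\,K\mid{!}K,$$ where $i\in\{1,2\}$ and $\mathsf{op}\in\{=,:=,+,-,\cdot,<\}$. A state is a pair $(h,\gamma)$ of a heap (a finite map $\mathrm{Loc}\rightharpoonup\mathrm{Val}$)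 and a function environment (a finite map from $\mathrm{Fun}$ to $\lambda$-abstractions). Transitions $e,s\xrightarrow{a}e',s'$ with label $a\in\mathrm{Val}\cup\{\varepsilon\}$ are the following, inside any evaluation context $K$; the label is $\varepsilon$ if none is shown. - $\lambda x.e,(h,\gamma)\to f,(h,\gamma[f\mapsto\lambda x.e])$ for $f\notin\mathrm{dom}\,\gamma$; - $f\,v,(h,\gamma)\to e\{v/x\},(h,\gamma)$ if $\gamma(f)=\lambda x.e$; - $\pi_i\langle v_1,v_2\rangle,s\to v_i,s$; - $\mathsf{if}\ n\ \mathsf{then}\ e_1\ \mathsf{else}\ e_2,s\to e_1,s$ if $n>0$, and $\mathsf{if}\ 0\ \mathsf{then}\ e_1\ \mathsf{else}\ e_2,s\to e_2,s$; - $\mathsf{ref}\,v,(h,\gamma)\to l,(h[l\mapsto v],\gamma)$ for $l\notin\mathrm{dom}\,h$; - ${!}l,(h,\gamma)\to h(l),(h,\gamma)$ and $l:=v,(h,\gamma)\to(),(h[l\mapsto v],\gamma)$ for $l\in\mathrm{dom}\,h$; - $u\ \mathsf{op}\ v,s\to r,s$ if $\mathsf{op}$ is not $:=$ and has the value $r$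 at $u,v$ ($=$ is defined on all pairs of values, the other operators on pairs of integers; tests give $1$ or $0$); - $\mathsf{emit}\,v,s\xrightarrow{v}(),s$. Traces are elements of $\mathrm{Val}^*$; $\le_{\mathrm{pref}}$ is the prefix order. **Terms.** Types are $\sigma,\tau::=1\mid\mathsf{Bool}\mid\mathsf{Nat}\mid\tau\to\sigma\mid\tau\times\sigma\mid\mathsf{seq}\,\tau\mid\mathsf{Prop}\mid\mathsf{Spec}\mid\mathsf{Val}\mid\mathsf{Exp}\mid\mathsf{Loc}$, and $\mathsf{Trace}=\mathsf{seq}\,\mathsf{Val}$. The simply typed terms $\Gamma\vdash M:\tau$ are those of the $\lambda$-calculus with unit and pairs; the connectives $\bot,\top,\vee,\wedge,\Rightarrow,\forall x{:}\tau,\exists x{:}\tau,=_\tau$, each at type $\mathsf{Prop}$ and at type $\mathsf{Spec}$; Booleans with conditional; zero and successor; $\mathsf{nil}_\tau$, $\mathsf{cons}(M,N)$ and $\mathsf{fold}(M,N_1,N_2):\sigma$ for $M:\mathsf{seq}\,\tau$, $N_1:\sigma$, $N_2:\sigma\times\tau\to\sigma$ (the left fold); $\mathsf{valid}(P):\mathsf{Spec}$;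 $\mathsf{spec}(S):\mathsf{Prop}$; $\mathsf{emp}$, $P*Q$, $P\mathbin{-\!*}Q$ and $M\mapsto N$ (for $M:\mathsf{Loc}$, $N:\mathsf{Val}$), all of type $\mathsf{Prop}$; triples $\{P\}\,e\,\{Q\}:\mathsf{Spec}$ for $P:\mathsf{Prop}$, $e:\mathsf{Exp}$, $Q:\mathsf{Val}\to\mathsf{Prop}$; $\mathsf{trace}(t),\mathsf{hist}(t):\mathsf{Prop}$ for $t:\mathsf{Trace}$ and $\mathsf{inv}(I):\mathsf{Prop}$ for $I:\mathsf{Trace}\to\mathsf{Bool}$; and program values and expressions (of types $\mathsf{Val}$, $\mathsf{Exp}$) in which terms of type $\mathsf{Val}$ or $\mathsf{Exp}$ over $\Gamma$ may occur, so that variables of $\Gamma$ serve as program variables. There are inclusions of $\mathsf{Loc}$ and $\mathsf{Nat}$ into $\mathsf{Val}$. We write $\{P\}\,e\,\{r.\,Q\}$ for $\{P\}\,e\,\{\lambda r{:}\mathsf{Val}.\,Q\}$ and $\{P\}\,e\,\{Q\}$ for the constant postcondition; for $M:\mathsf{Val}$, $M\mapsto N$ means $\exists l{:}\mathsf{Loc}.\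 M=l\wedge l\mapsto N$, and $M\mapsto\_$ means $\exists v{:}\mathsf{Val}.\ M\mapsto v$. The trace $t\cdot v$ and the assertion $t\le_{\mathrm{pref}}t'$, i.e. $\exists u.\ t'=t\cdot u$, are defined with $\mathsf{fold}$. **Derivability.** The judgements $\Gamma\mid\Theta\vdash S$ and $\Gamma\mid\Theta\mid P\vdash Q$ ($\Theta$ a finite list of terms of type $\mathsf{Spec}$) are defined by simultaneous induction. The rules are: intuitionistic higher-order logic with equality for both judgements; the equational and induction principles of the data types ($\beta$, function extensionality, unit and pairs, conditional, fold, Boolean, natural-number and sequence induction, injectivity and disjointness of zero and successor, injectivity of the two inclusions, and the value of the inclusion at numerals); for $*$, monotonicity, commutativity, associativity, the unit $\mathsf{emp}$ together with $P\vdash\mathsf{emp}$, and the adjoint $-\!*$; from $\Gamma\mid\Theta\vdash S$ and $\Gamma\mid\Theta,S\mid P\vdash Q$ infer $\Gamma\mid\Theta\mid P\vdash Q$; and the following (with arbitrary terms $l,v,t,t_i,I$ of the appropriate types). - Axioms $\Theta,S\vdash S$; $\ \Theta,S\mid P\vdash\mathsf{spec}(S)$; $\ \Theta,\mathsf{valid}(Q)\mid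 P\vdash Q$. - From $\Theta\mid\top\vdash P$ infer $\Theta\vdash\mathsf{valid}(P)$. - $\Theta\vdash\{\top\}\,v\,\{r.\,r=v\}$. - From $\Theta,S\vdash\{P\}e\{R\}$ infer $\Theta\vdash\{P*\mathsf{spec}(S)\}e\{R\}$. - From $\Theta\vdash\{P\}e\{Q\}$ infer $\Theta\vdash\{P*R\}e\{r.\,Q(r)*R\}$. - From $\Gamma\mid\Theta\vdash\{P\}e\{x.Q\}$ and $\Gamma,x{:}\mathsf{Val}\mid\Theta\vdash\{Q\}K[x]\{r.R\}$, with $x\notin FV(\Theta)$ and $x\notin FV(K)$, infer $\Gamma\mid\Theta\vdash\{P\}K[e]\{r.\,\exists x{:}\mathsf{Val}.\,R\}$. - From $\Theta\mid P_1\vdash P_2$, $\Theta\vdash\{P_2\}e\{Q_2\}$ and $\Gamma,x{:}\mathsf{Val}\mid\Theta\mid Q_2(x)\vdash Q_1(x)$ infer $\Theta\vdash\{P_1\}e\{Q_1\}$. - From $\Gamma,x{:}\mathsf{Val}\mid\Theta\vdash\{P\}e\{Q\}$, with $x\notin FV(\Theta)$, infer $\Gamma\mid\Theta\vdash\{\mathsf{emp}\}\,\lambda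 x.e\,\{r.\,\forall x{:}\mathsf{Val}.\,\mathsf{spec}(\{P\}\,r\,x\,\{Q\})\}$. - $\Theta\vdash\{l\mapsto\_\}\,l:=v\,\{r.\,l\mapsto v*r=()\}$; $\ \Theta\vdash\{l\mapsto v\}\,{!}l\,\{r.\,l\mapsto v*r=v\}$; $\ \Theta\vdash\{\mathsf{emp}\}\,\mathsf{ref}\,v\,\{r.\,r\mapsto v\}$. - From $\Theta\vdash I(t\cdot v)=\mathsf{true}$ infer $\Theta\vdash\{\mathsf{trace}(t)*\mathsf{inv}(I)\}\,\mathsf{emit}\,v\,\{\mathsf{trace}(t\cdot v)\}$, and also the triple with the postcondition $r.\,\mathsf{trace}(t\cdot v)*r=()$. - $\mathsf{inv}(I)\vdash\mathsf{inv}(I)*\mathsf{inv}(I)$; $\ \mathsf{hist}(t)\vdash\mathsf{hist}(t)*\mathsf{hist}(t)$; $\ \mathsf{trace}(t)\vdash\mathsf{trace}(t)*\mathsf{hist}(t)$; $\ \mathsf{trace}(t_1)*\mathsf{hist}(t_2)\vdash\mathsf{trace}(t_1)*(t_2\le_{\mathrm{pref}}t_1)$. - From $\Gamma,x{:}\tau\mid\Theta\vdash\{P\}e\{Q\}$,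 with $x$ not free in $\Theta,e,Q$, infer $\Gamma\mid\Theta\vdash\{\exists x{:}\tau.P\}e\{Q\}$; $\ \Theta\vdash\{\top\}\,\pi_i\langle v_1,v_2\rangle\,\{r.\,r=v_i\}$; from $\Theta\vdash\{P\}e_1\{Q\}$ infer $\Theta\vdash\{P\}\,\mathsf{if}\ n\ \mathsf{then}\ e_1\ \mathsf{else}\ e_2\,\{Q\}$ for an integer $n>0$, and from $\Theta\vdash\{P\}e_2\{Q\}$ the same with $0$ for $n$; $\ \Theta\vdash\{\top\}\,i\ \mathsf{op}\ j\,\{r.\,r=k\}$ for integers with $i\ \mathsf{op}\ j$ equal to $k$; $\ \Theta\vdash\{\top\}\,u=v\,\{r.\,(u=v\wedge r=1)\vee(\neg\,u=v\wedge r=0)\}$. **Model.** $\mathsf M=\mathrm{Heap}\times(\{\mathrm{hist},\mathrm{full}\}\times\mathrm{Val}^*)$ is a partial commutative monoid: heaps multiply by disjoint union; $(\mathrm{hist},t_1)\bullet(\mathrm{hist},t_2)$ is $(\mathrm{hist},t)$ with $t$ the longer of $t_1,t_2$ if one is a prefix of the other; $(\mathrm{full},t_1)\bullet(\mathrm{hist},t_2)=(\mathrm{hist},t_2)\bullet(\mathrm{full},t_1)=(\mathrm{full},t_1)$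 if $t_2\le_{\mathrm{pref}}t_1$; other products are undefined. Put $m\le m'$ iff $m\bullet c=m'$ for some $c$ (also in the second factor). Worlds are $\mathsf W=\mathrm{FEnv}\times\mathcal P(\mathrm{Val}^*)$, with $(\gamma_1,I_1)\le(\gamma_2,I_2)$ iff $\gamma_1\subseteq\gamma_2$ and $I_1=I_2$. Let $[\![\mathsf{Prop}]\!]$ be the set of monotone maps from $\mathsf W$ to upward closed subsets of $\mathsf M$, $[\![\mathsf{Spec}]\!]$ the set of monotone maps $\mathsf W\to\{\bot<\top\}$, $[\![\mathsf{seq}\,\tau]\!]=[\![\tau]\!]^*$, and interpret the other types as the evident sets (all functions for $\to$); $[\![\Gamma]\!]$ is the set of environments $\rho$ that assign to each $x{:}\tau$ in $\Gamma$ an element of $[\![\tau]\!]$. Terms are interpreted as usual, and on programs by capture-avoiding substitution $\rho(e)$. On formulas: - for $\mathsf{Prop}$, $\bot,\top,\wedge,\vee,\forall,\exists$ are pointwise set operations; $P\Rightarrow Q$ holds at $(w,m)$ iff for all $m'\ge m$ and $w'\ge w$, $P$ at $(w',m')$ implies $Q$ at $(w',m')$; $M=N$ holds iff the values are equal; $\mathsf{emp}$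 holds everywhere; for $\mathsf{Spec}$ the same without $m$; - $P*Q$ holds at $(w,m)$ iff $m=m_1\bullet m_2$ with $P$ at $(w,m_1)$ and $Q$ at $(w,m_2)$; $P\mathbin{-\!*}Q$ holds at $(w,m)$ iff for all $w'\ge w$, $m'\ge m$ and $m''$ with $m'\bullet m''$ defined, $P$ at $(w',m'')$ implies $Q$ at $(w',m'\bullet m'')$; - $l\mapsto v$ holds at $(h,\theta)$ iff $h(l)=v$; $\mathsf{trace}(t)$ iff $\theta\ge(\mathrm{full},t)$; $\mathsf{hist}(t)$ iff $\theta\ge(\mathrm{hist},t)$; $\mathsf{inv}(I)$ at $w=(\gamma,J)$ iff $J=\{t\mid I(t)=\mathsf{true}\}$; $\mathsf{spec}(S)$ at $(w,m)$ iff $S$ at $w$; $\mathsf{valid}(P)$ at $w$ iff $P$ holds at $(w,m)$ for all $m\in\mathsf M$; - $\{P\}e\{Q\}$ holds at $w$ iff for all $w'\ge w$, $[\![P]\!]_\rho(w')\subseteq\mathsf{wp}([\![Q]\!]_\rho)(\rho(e))(w')$. The erasure relation $t,(h,\gamma)\vDash_{(\gamma',I)}(h',(k,t'))$ means $h=h'$,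 $\gamma=\gamma'$, $t\in I$, and $t=t'$ if $k=\mathrm{full}$, $t'\le_{\mathrm{pref}}t$ if $k=\mathrm{hist}$. The weakest precondition $\mathsf{wp}(Q)$ is the greatest fixed point of the operator that maps $X$ to the function whose value at $(e,w)$ is the set of $m\in\mathsf M$ such that for all $r,t,s$ with $m\bullet r$ defined and $t,s\vDash_w m\bullet r$: (i) if $e,s$ has no transition, then $e\in\mathrm{Val}$ and $m\in Q(e)(w)$; (ii) whenever $e,s\xrightarrow{a}e',s'$, there are $w'\ge w$ and $m'$ with $m'\bullet r$ defined, $(t\cdot a),s'\vDash_{w'}m'\bullet r$ and $m'\in X(e')(w')$. Define $\Gamma\mid\Theta\models S$ to mean: for all $w\in\mathsf W$ and $\rho\in[\![\Gamma]\!]$, if $[\![T]\!]_\rho(w)=\top$ for every $T\in\Theta$, then $[\![S]\!]_\rho(w)=\top$. **Theorem (Soundness).** For every context $\Gamma$, every finite list $\Theta$ of specifications over $\Gamma$ and every $\Gamma\vdash S:\mathsf{Spec}$: if $\Gamma\mid\Theta\vdash S$ is derivable, then $\Gamma\mid\Theta\models S$. -/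

import Mathlib

namespace TraceLogic

/-! ## Programming language

Variables are de Bruijn indices, so expressions are identified up to renaming of bound variables. -/

/-- Function identifiers (a countably infinite set). -/
abbrev Fun := ℕ

/-- Location identifiers (a countably infinite set). -/
abbrev Loc := ℕ

/-- Values `u, v ::= () | n | x | l | f | ⟨u, v⟩`. -/
inductive Val : Type
  | unit : Val
  | int (n : ℤ) : Val
  | var (x : ℕ) : Val
  | loc (l : Loc) : Val
  | fn (f : Fun) : Val
  | pair (u v : Val) : Val
  deriving DecidableEq

/-- Binary operators: equality test, assignment, arithmetic and comparison of integers. -/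
inductive BinOp : Type
  | eq | assign | add | sub | mul | lt

/-- The index of a projection `π₁`, `π₂`. -/
inductive Side : Type
  | one | two

/-- Expressions. The value formers occur among the constructors, so that a pair of two values is
one expression, and not two; `Val.toExpr` is the inclusion of values into expressions.
In `lam e` the index `0` of `e` is bound. -/
inductive Expr : Type
  | unit : Expr
  | int (n : ℤ) : Expr
  | var (x : ℕ) : Expr
  | loc (l : Loc) : Expr
  | fn (f : Fun) : Expr
  | lam (e : Expr) : Expr
  | app (e e' : Expr) : Expr
  | ite (e e₁ e₂ : Expr) : Expr
  | pair (e e' : Expr) : Expr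
  | proj (i : Side) (e : Expr) : Expr
  | ref (e : Expr) : Expr
  | deref (e : Expr) : Expr
  | binop (o : BinOp) (e e' : Expr) : Expr
  | emit (v : Val) : Expr

/-- The inclusion of values into expressions. -/
def Val.toExpr : Val → Expr
  | .unit => .unit
  | .int n => .int n
  | .var x => .var x
  | .loc l => .loc l
  | .fn f => .fn f
  | .pair u v => .pair u.toExpr v.toExpr

/-- Renaming of the variables of a value. -/
def Val.rename (r : ℕ → ℕ) : Val → Val
  | .unit => .unit
  | .int n => .int n
  | .var x => .var (r x)
  | .loc l => .loc l
  | .fn f => .fn f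
  | .pair u v => .pair (u.rename r) (v.rename r)

/-- A renaming under one binder. -/
def liftRen (r : ℕ → ℕ) : ℕ → ℕ
  | 0 => 0
  | x + 1 => r x + 1

/-- Renaming of the free variables of an expression. -/
def Expr.rename : (ℕ → ℕ) → Expr → Expr
  | _, .unit => .unit
  | _, .int n => .int n
  | r, .var x => .var (r x)
  | _, .loc l => .loc l
  | _, .fn f => .fn f
  | r, .lam e => .lam (e.rename (liftRen r))
  | r, .app e e' => .app (e.rename r) (e'.rename r)
  | r, .ite e e₁ e₂ => .ite (e.rename r) (e₁.rename r) (e₂.rename r)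
  | r, .pair e e' => .pair (e.rename r) (e'.rename r)
  | r, .proj i e => .proj i (e.rename r)
  | r, .ref e => .ref (e.rename r)
  | r, .deref e => .deref (e.rename r)
  | r, .binop o e e' => .binop o (e.rename r) (e'.rename r)
  | r, .emit v => .emit (v.rename r)

/-- Simultaneous substitution of values for the variables of a value. -/
def Val.subst (σ : ℕ → Val) : Val → Val
  | .unit => .unit
  | .int n => .int n
  | .var x => σ x
  | .loc l => .loc l
  | .fn f => .fn f
  | .pair u v => .pair (u.subst σ) (v.subst σ)

/-- A substitution under one binder. -/
def liftSubst (σ : ℕ → Val) : ℕ → Val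
  | 0 => .var 0
  | x + 1 => (σ x).rename Nat.succ

/-- Simultaneous capture-avoiding substitution of values for the free variables of an
expression. -/
def Expr.subst : (ℕ → Val) → Expr → Expr
  | _, .unit => .unit
  | _, .int n => .int n
  | σ, .var x => (σ x).toExpr
  | _, .loc l => .loc l
  | _, .fn f => .fn f
  | σ, .lam e => .lam (e.subst (liftSubst σ))
  | σ, .app e e' => .app (e.subst σ) (e'.subst σ)
  | σ, .ite e e₁ e₂ => .ite (e.subst σ) (e₁.subst σ) (e₂.subst σ)
  | σ, .pair e e' => .pair (e.subst σ) (e'.subst σ)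
  | σ, .proj i e => .proj i (e.subst σ)
  | σ, .ref e => .ref (e.subst σ)
  | σ, .deref e => .deref (e.subst σ)
  | σ, .binop o e e' => .binop o (e.subst σ) (e'.subst σ)
  | σ, .emit v => .emit (v.subst σ)

/-- The substitution that replaces the index `0` by `v` and lowers the other indices. -/
def instSubst (v : Val) : ℕ → Val
  | 0 => v
  | x + 1 => .var x

/-- `e{v/x}` for the body `e` of an abstraction `λ x. e`. -/
def Expr.inst (e : Expr) (v : Val) : Expr := e.subst (instSubst v)

/-- Evaluation contexts. -/
inductive ECtx : Type
  | hole : ECtx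
  | appL (K : ECtx) (e : Expr) : ECtx
  | appR (v : Val) (K : ECtx) : ECtx
  | opL (o : BinOp) (K : ECtx) (e : Expr) : ECtx
  | opR (o : BinOp) (v : Val) (K : ECtx) : ECtx
  | ite (K : ECtx) (e e' : Expr) : ECtx
  | pairL (K : ECtx) (e : Expr) : ECtx
  | pairR (v : Val) (K : ECtx) : ECtx
  | proj (i : Side) (K : ECtx) : ECtx
  | ref (K : ECtx) : ECtx
  | deref (K : ECtx) : ECtx

/-- `K[e]`. -/
def ECtx.fill : ECtx → Expr → Expr
  | .hole, e => e
  | .appL K e', e => .app (K.fill e) e'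
  | .appR v K, e => .app v.toExpr (K.fill e)
  | .opL o K e', e => .binop o (K.fill e) e'
  | .opR o v K, e => .binop o v.toExpr (K.fill e)
  | .ite K e₁ e₂, e => .ite (K.fill e) e₁ e₂
  | .pairL K e', e => .pair (K.fill e) e'
  | .pairR v K, e => .pair v.toExpr (K.fill e)
  | .proj i K, e => .proj i (K.fill e)
  | .ref K, e => .ref (K.fill e)
  | .deref K, e => .deref (K.fill e)

/-- A `λ`-abstraction `λ x. body`; the index `0` of `body` is bound. -/
structure Lam : Type where
  body : Expr

/-- Heaps: finite maps from locations to values. -/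
abbrev Heap := Finmap (fun _ : Loc => Val)

/-- Function environments: finite maps from function identifiers to `λ`-abstractions. -/
abbrev FEnv := Finmap (fun _ : Fun => Lam)

/-- Machine states. -/
abbrev State := Heap × FEnv

/-- Traces are finite sequences of values. -/
abbrev Trace := List Val

/-- Evaluation of the operators other than assignment (for which it is undefined).
The result of a test is `1` or `0`. -/
def BinOp.eval : BinOp → Val → Val → Option Val
  | .eq, u, v => some (.int (if u = v then 1 else 0))
  | .add, .int m, .int n => some (.int (m + n))
  | .sub, .int m, .int n => some (.int (m - n))
  | .mul, .int m, .int n => some (.int (m * n))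
  | .lt, .int m, .int n => some (.int (if m < n then 1 else 0))
  | _, _, _ => none

/-- The evaluation rules, with the evaluation context left out.
The label is `none` for a silent step and `some v` for the event `v`. -/
inductive HeadStep : Expr → State → Option Val → Expr → State → Prop
  | lam (e : Expr) (h : Heap) (γ : FEnv) (f : Fun) (hf : f ∉ γ) :
      HeadStep (.lam e) (h, γ) none (.fn f) (h, γ.insert f ⟨e⟩)
  | app (f : Fun) (v : Val) (e : Expr) (h : Heap) (γ : FEnv) (hf : γ.lookup f = some ⟨e⟩) :
      HeadStep (.app (.fn f) v.toExpr) (h, γ) none (e.inst v) (h, γ)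
  | proj₁ (v₁ v₂ : Val) (s : State) :
      HeadStep (.proj .one (.pair v₁.toExpr v₂.toExpr)) s none v₁.toExpr s
  | proj₂ (v₁ v₂ : Val) (s : State) :
      HeadStep (.proj .two (.pair v₁.toExpr v₂.toExpr)) s none v₂.toExpr s
  | iteTrue (n : ℤ) (e₁ e₂ : Expr) (s : State) (hn : 0 < n) :
      HeadStep (.ite (.int n) e₁ e₂) s none e₁ s
  | iteFalse (e₁ e₂ : Expr) (s : State) :
      HeadStep (.ite (.int 0) e₁ e₂) s none e₂ s
  | ref (v : Val) (h : Heap) (γ : FEnv) (l : Loc) (hl : l ∉ h) :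
      HeadStep (.ref v.toExpr) (h, γ) none (.loc l) (h.insert l v, γ)
  | deref (l : Loc) (v : Val) (h : Heap) (γ : FEnv) (hl : h.lookup l = some v) :
      HeadStep (.deref (.loc l)) (h, γ) none v.toExpr (h, γ)
  | assign (l : Loc) (v : Val) (h : Heap) (γ : FEnv) (hl : l ∈ h) :
      HeadStep (.binop .assign (.loc l) v.toExpr) (h, γ) none .unit (h.insert l v, γ)
  | binop (o : BinOp) (u v r : Val) (s : State) (hr : o.eval u v = some r) :
      HeadStep (.binop o u.toExpr v.toExpr) s none r.toExpr s
  | emit (v : Val) (s : State) :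
      HeadStep (.emit v) s (some v) .unit s

/-- The labelled transition relation. -/
inductive Step : Expr → State → Option Val → Expr → State → Prop
  | ctx (K : ECtx) {e e' : Expr} {s s' : State} {a : Option Val} (h : HeadStep e s a e' s') :
      Step (K.fill e) s a (K.fill e') s'

/-- The configuration `e, s` has no transition. -/
def Irreducible (e : Expr) (s : State) : Prop := ¬ ∃ a e' s', Step e s a e' s'

/-! ## The resource monoid and worlds -/

/-- The two kinds of trace resources: a prefix of the current trace (`hist`), or the exact current
trace together with the exclusive right to extend it (`full`). -/
inductive Tag : Type
  | hist | full

/-- The carrier of the trace monoid. -/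
abbrev TraceRes := Tag × Trace

/-- Multiplication of the trace monoid. -/
def TraceRes.mul : TraceRes → TraceRes → Option TraceRes
  | (.hist, t₁), (.hist, t₂) =>
      if t₂ <+: t₁ then some (.hist, t₁) else if t₁ <+: t₂ then some (.hist, t₂) else none
  | (.full, t₁), (.hist, t₂) => if t₂ <+: t₁ then some (.full, t₁) else none
  | (.hist, t₂), (.full, t₁) => if t₂ <+: t₁ then some (.full, t₁) else none
  | (.full, _), (.full, _) => none

open Classical in
/-- Multiplication of the heap monoid: disjoint union. -/
noncomputable def heapMul (h₁ h₂ : Heap) : Option Heap :=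
  if h₁.Disjoint h₂ then some (h₁ ∪ h₂) else none

/-- The carrier of the resource monoid. -/
abbrev Res := Heap × TraceRes

/-- Multiplication of the resource monoid, a partial operation. -/
noncomputable def Res.mul (a b : Res) : Option Res :=
  (heapMul a.1 b.1).bind fun h => (TraceRes.mul a.2 b.2).map fun t => (h, t)

/-- The unit of the resource monoid. -/
def Res.one : Res := (∅, (.hist, []))

/-- The order of the trace monoid. -/
def TraceRes.Le (a b : TraceRes) : Prop := ∃ c, TraceRes.mul a c = some b

/-- The order of the resource monoid. -/
def Res.Le (a b : Res) : Prop := ∃ c, Res.mul a c = some b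

/-- Worlds: a function environment and a trace invariant. -/
structure World : Type where
  env : FEnv
  inv : Set Trace

/-- `w.Le w'`: new functions may have been named, and the trace invariant is the same. -/
def World.Le (w w' : World) : Prop :=
  (∀ f b, w.env.lookup f = some b → w'.env.lookup f = some b) ∧ w.inv = w'.inv

/-! ### Basic facts on the order -/

theorem World.Le.refl (w : World) : w.Le w := ⟨fun _ _ h => h, rfl⟩

theorem World.Le.trans {a b c : World} (h : a.Le b) (h' : b.Le c) : a.Le c :=
  ⟨fun f x hx => h'.1 f x (h.1 f x hx), h.2.trans h'.2⟩

theorem TraceRes.mul_assoc {a b c ab abc : TraceRes} (h₁ : TraceRes.mul a b = some ab)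
    (h₂ : TraceRes.mul ab c = some abc) :
    ∃ bc, TraceRes.mul b c = some bc ∧ TraceRes.mul a bc = some abc := by
  obtain ⟨_ | _, t₁⟩ := a <;> obtain ⟨_ | _, t₂⟩ := b <;> obtain ⟨_ | _, t₃⟩ := c <;>
    simp only [TraceRes.mul, Option.ite_none_right_eq_some, Option.some.injEq, reduceCtorEq] at h₁ <;>
    grind [TraceRes.mul, List.IsPrefix.trans, List.prefix_of_prefix_length_le,
      List.IsPrefix.eq_of_length, List.IsPrefix.length_le]

theorem heapMul_assoc {a b c ab abc : Heap} (h₁ : heapMul a b = some ab)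
    (h₂ : heapMul ab c = some abc) :
    ∃ bc, heapMul b c = some bc ∧ heapMul a bc = some abc := by
  simp only [heapMul, Option.ite_none_right_eq_some, Option.some.injEq] at h₁ h₂ ⊢
  obtain ⟨hab, rfl⟩ := h₁
  obtain ⟨habc, rfl⟩ := h₂
  rw [Finmap.disjoint_union_left] at habc
  refine ⟨b ∪ c, ⟨habc.2, rfl⟩, ?_, Finmap.union_assoc.symm⟩
  rw [Finmap.disjoint_union_right]
  exact ⟨hab, habc.1⟩

theorem Res.mul_eq_some {a b c : Res} :
    Res.mul a b = some c ↔ heapMul a.1 b.1 = some c.1 ∧ TraceRes.mul a.2 b.2 = some c.2 := by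
  obtain ⟨c₁, c₂⟩ := c
  cases h : heapMul a.1 b.1 <;> cases h' : TraceRes.mul a.2 b.2 <;> simp [Res.mul, h, h']

theorem Res.mul_assoc {a b c ab abc : Res} (h₁ : Res.mul a b = some ab)
    (h₂ : Res.mul ab c = some abc) : ∃ bc, Res.mul b c = some bc ∧ Res.mul a bc = some abc := by
  rw [Res.mul_eq_some] at h₁ h₂
  obtain ⟨x, hx, hx'⟩ := heapMul_assoc h₁.1 h₂.1
  obtain ⟨y, hy, hy'⟩ := TraceRes.mul_assoc h₁.2 h₂.2
  exact ⟨(x, y), Res.mul_eq_some.2 ⟨hx, hy⟩, Res.mul_eq_some.2 ⟨hx', hy'⟩⟩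

theorem Res.Le.trans {a b c : Res} (h : a.Le b) (h' : b.Le c) : a.Le c := by
  obtain ⟨x, hx⟩ := h
  obtain ⟨y, hy⟩ := h'
  obtain ⟨z, -, hz⟩ := Res.mul_assoc hx hy
  exact ⟨z, hz⟩

theorem TraceRes.Le.trans {a b c : TraceRes} (h : a.Le b) (h' : b.Le c) : a.Le c := by
  obtain ⟨x, hx⟩ := h
  obtain ⟨y, hy⟩ := h'
  obtain ⟨z, -, hz⟩ := TraceRes.mul_assoc hx hy
  exact ⟨z, hz⟩

theorem Res.Le.trace {a b : Res} (h : a.Le b) : a.2.Le b.2 := by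
  obtain ⟨c, hc⟩ := h
  exact ⟨c.2, (Res.mul_eq_some.1 hc).2⟩

theorem Res.Le.lookup {a b : Res} (h : a.Le b) {l : Loc} {v : Val} (hl : a.1.lookup l = some v) :
    b.1.lookup l = some v := by
  obtain ⟨c, hc⟩ := h
  have h := (Res.mul_eq_some.1 hc).1
  simp only [heapMul, Option.ite_none_right_eq_some, Option.some.injEq] at h
  rw [← h.2, Finmap.lookup_union_left (Finmap.mem_of_lookup_eq_some hl), hl]

/-! ## Semantic assertions and specifications -/

/-- Semantic assertions: monotone maps from worlds to upwards closed sets of resources. -/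
@[ext]
structure AProp : Type where
  sat : World → Set Res
  mono : ∀ {w w' : World}, w.Le w' → sat w ⊆ sat w'
  up : ∀ {w : World} {m m' : Res}, m ∈ sat w → m.Le m' → m' ∈ sat w

/-- Semantic specifications: monotone maps from worlds to the two truth values. -/
@[ext]
structure SProp : Type where
  holds : World → Prop
  mono : ∀ {w w' : World}, w.Le w' → holds w → holds w'

namespace AProp

/-- The assertion that ignores the resource and the world. -/
def pure (p : Prop) : AProp := ⟨fun _ => {_m | p}, fun _ _ h => h, fun h _ => h⟩

def and (P Q : AProp) : AProp :=
  ⟨fun w => P.sat w ∩ Q.sat w, fun h _ hm => ⟨P.mono h hm.1, Q.mono h hm.2⟩,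
    fun hm h => ⟨P.up hm.1 h, Q.up hm.2 h⟩⟩

def or (P Q : AProp) : AProp :=
  ⟨fun w => P.sat w ∪ Q.sat w, fun h _ hm => hm.imp (fun x => P.mono h x) (fun x => Q.mono h x),
    fun hm h => hm.imp (fun x => P.up x h) (fun x => Q.up x h)⟩

def imp (P Q : AProp) : AProp :=
  ⟨fun w => {m | ∀ m', m.Le m' → ∀ w' : World, w.Le w' → m' ∈ P.sat w' → m' ∈ Q.sat w'},
    fun h _ hm m' h' w' hw' => hm m' h' w' (h.trans hw'),
    fun hm h m' h' w' hw' => hm m' (h.trans h') w' hw'⟩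

def all {α : Type} (P : α → AProp) : AProp :=
  ⟨fun w => {m | ∀ v, m ∈ (P v).sat w}, fun h _ hm v => (P v).mono h (hm v),
    fun hm h v => (P v).up (hm v) h⟩

def ex {α : Type} (P : α → AProp) : AProp :=
  ⟨fun w => {m | ∃ v, m ∈ (P v).sat w}, fun h _ hm => hm.imp fun v x => (P v).mono h x,
    fun hm h => hm.imp fun v x => (P v).up x h⟩

def sep (P Q : AProp) : AProp :=
  ⟨fun w => {m | ∃ m₁ m₂, m₁ ∈ P.sat w ∧ m₂ ∈ Q.sat w ∧ Res.mul m₁ m₂ = some m},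
    fun h _ ⟨m₁, m₂, h₁, h₂, hm⟩ => ⟨m₁, m₂, P.mono h h₁, Q.mono h h₂, hm⟩,
    fun ⟨m₁, _, h₁, h₂, hm⟩ ⟨_, hc⟩ =>
      let ⟨x, hx, hx'⟩ := Res.mul_assoc hm hc
      ⟨m₁, x, h₁, Q.up h₂ ⟨_, hx⟩, hx'⟩⟩

def wand (P Q : AProp) : AProp :=
  ⟨fun w => {m | ∀ w' : World, w.Le w' → ∀ m', m.Le m' → ∀ m'' r, Res.mul m' m'' = some r →
      m'' ∈ P.sat w' → r ∈ Q.sat w'},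
    fun h _ hm w' hw' => hm w' (h.trans hw'),
    fun hm h w' hw' m' h' => hm w' hw' m' (h.trans h')⟩

def pointsTo (l : Loc) (v : Val) : AProp :=
  ⟨fun _ => {m | m.1.lookup l = some v}, fun _ _ h => h, fun hm h => h.lookup hm⟩

def trace (t : Trace) : AProp :=
  ⟨fun _ => {m | TraceRes.Le (.full, t) m.2}, fun _ _ h => h, fun hm h => hm.trans h.trace⟩

def hist (t : Trace) : AProp :=
  ⟨fun _ => {m | TraceRes.Le (.hist, t) m.2}, fun _ _ h => h, fun hm h => hm.trans h.trace⟩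

def inv (I : Trace → Bool) : AProp :=
  ⟨fun w => {_m | w.inv = {t | I t = true}}, fun h _ hm => h.2.symm.trans hm, fun h _ => h⟩

def spec (S : SProp) : AProp :=
  ⟨fun w => {_m | S.holds w}, fun h _ hm => S.mono h hm, fun h _ => h⟩

end AProp

/-- The erasure relation `t, s ⊨_w m`: the trace `t` and the state `s` are described by the
resource `m` and the world `w`. -/
def Erases (t : Trace) (s : State) (w : World) (m : Res) : Prop :=
  (match m.2 with
    | (.full, t') => t = t'
    | (.hist, t') => t' <+: t) ∧
  s.1 = m.1 ∧ s.2 = w.env ∧ t ∈ w.inv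

/-- The functional whose greatest fixed point is the weakest precondition. -/
def wpStep (Q : Val → World → Set Res) (X : Expr → World → Set Res) : Expr → World → Set Res :=
  fun e w => {m | ∀ (r mr : Res) (t : Trace) (s : State), Res.mul m r = some mr →
    Erases t s w mr →
      (Irreducible e s → ∃ v : Val, e = v.toExpr ∧ m ∈ Q v w) ∧
      ∀ (a : Option Val) (e' : Expr) (s' : State), Step e s a e' s' →
        ∃ w' : World, w.Le w' ∧ ∃ m' mr' : Res, Res.mul m' r = some mr' ∧
          Erases (t ++ a.toList) s' w' mr' ∧ m' ∈ X e' w'}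

theorem wpStep_mono (Q : Val → World → Set Res) : Monotone (wpStep Q) := by
  intro X Y h e w m hm r mr t s hr hs
  refine ⟨(hm r mr t s hr hs).1, fun a e' s' hst => ?_⟩
  obtain ⟨w', hw', m', mr', h₁, h₂, h₃⟩ := (hm r mr t s hr hs).2 a e' s' hst
  exact ⟨w', hw', m', mr', h₁, h₂, h e' w' h₃⟩

/-- The weakest precondition `wp(Q)`, a greatest fixed point. -/
def wp (Q : Val → World → Set Res) : Expr → World → Set Res :=
  OrderHom.gfp ⟨wpStep Q, wpStep_mono Q⟩

namespace SProp

/-- The specification that ignores the world. -/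
def pure (p : Prop) : SProp := ⟨fun _ => p, fun _ h => h⟩

def and (S T : SProp) : SProp :=
  ⟨fun w => S.holds w ∧ T.holds w, fun h x => ⟨S.mono h x.1, T.mono h x.2⟩⟩

def or (S T : SProp) : SProp :=
  ⟨fun w => S.holds w ∨ T.holds w, fun h x => x.imp (S.mono h) (T.mono h)⟩

def imp (S T : SProp) : SProp :=
  ⟨fun w => ∀ w' : World, w.Le w' → S.holds w' → T.holds w',
    fun h x w' hw' => x w' (h.trans hw')⟩

def all {α : Type} (S : α → SProp) : SProp :=
  ⟨fun w => ∀ v, (S v).holds w, fun h x v => (S v).mono h (x v)⟩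

def ex {α : Type} (S : α → SProp) : SProp :=
  ⟨fun w => ∃ v, (S v).holds w, fun h x => x.imp fun v => (S v).mono h⟩

def valid (P : AProp) : SProp :=
  ⟨fun w => P.sat w = Set.univ, fun h x => Set.eq_univ_of_univ_subset (x ▸ P.mono h)⟩

def hoare (P : AProp) (e : Expr) (Q : Val → AProp) : SProp :=
  ⟨fun w => ∀ w' : World, w.Le w' → P.sat w' ⊆ wp (fun v => (Q v).sat) e w',
    fun h x w' hw' => x w' (h.trans hw')⟩

end SProp

/-! ## Types, terms and their semantics -/

/-- The two logics that share the connectives: assertions and specifications. -/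
inductive Logic : Type
  | asrt | spec

/-- The types of the term language. -/
inductive Ty : Type
  | unit : Ty
  | bool : Ty
  | nat : Ty
  | arrow (τ σ : Ty) : Ty
  | prod (τ σ : Ty) : Ty
  | seq (τ : Ty) : Ty
  | form (k : Logic) : Ty
  | val : Ty
  | exp : Ty
  | loc : Ty

/-- The type `Prop` of resource assertions. -/
abbrev Ty.prop : Ty := .form .asrt

/-- The type `Spec` of specifications. -/
abbrev Ty.spec : Ty := .form .spec

/-- The type of traces. -/
abbrev Ty.trace : Ty := .seq .val

/-- Term contexts; variables are typed de Bruijn indices. -/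
abbrev Ctx := List Ty

/-- `Var Γ τ`: the variables of type `τ` of the context `Γ`. -/
inductive Var : Ctx → Ty → Type
  | zero {Γ : Ctx} {τ : Ty} : Var (τ :: Γ) τ
  | succ {Γ : Ctx} {τ σ : Ty} (x : Var Γ τ) : Var (σ :: Γ) τ

mutual

/-- `Tm Γ τ`: the terms `M` with `Γ ⊢ M : τ`. The connectives take the logic they belong to as their
first argument. -/
inductive Tm : Ctx → Ty → Type
  | var {Γ : Ctx} {τ : Ty} (x : Var Γ τ) : Tm Γ τ
  | lam {Γ : Ctx} {τ σ : Ty} (M : Tm (τ :: Γ) σ) : Tm Γ (.arrow τ σ)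
  | app {Γ : Ctx} {τ σ : Ty} (M : Tm Γ (.arrow τ σ)) (N : Tm Γ τ) : Tm Γ σ
  | unit {Γ : Ctx} : Tm Γ .unit
  | pair {Γ : Ctx} {τ σ : Ty} (M : Tm Γ τ) (N : Tm Γ σ) : Tm Γ (.prod τ σ)
  | fst {Γ : Ctx} {τ σ : Ty} (M : Tm Γ (.prod τ σ)) : Tm Γ τ
  | snd {Γ : Ctx} {τ σ : Ty} (M : Tm Γ (.prod τ σ)) : Tm Γ σ
  | bot {Γ : Ctx} (k : Logic) : Tm Γ (.form k)
  | top {Γ : Ctx} (k : Logic) : Tm Γ (.form k)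
  | or {Γ : Ctx} (k : Logic) (P Q : Tm Γ (.form k)) : Tm Γ (.form k)
  | and {Γ : Ctx} (k : Logic) (P Q : Tm Γ (.form k)) : Tm Γ (.form k)
  | imp {Γ : Ctx} (k : Logic) (P Q : Tm Γ (.form k)) : Tm Γ (.form k)
  | all {Γ : Ctx} (k : Logic) (τ : Ty) (P : Tm (τ :: Γ) (.form k)) : Tm Γ (.form k)
  | ex {Γ : Ctx} (k : Logic) (τ : Ty) (P : Tm (τ :: Γ) (.form k)) : Tm Γ (.form k)
  | eq {Γ : Ctx} (k : Logic) {τ : Ty} (M N : Tm Γ τ) : Tm Γ (.form k)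
  | true {Γ : Ctx} : Tm Γ .bool
  | false {Γ : Ctx} : Tm Γ .bool
  | ite {Γ : Ctx} {τ : Ty} (M : Tm Γ .bool) (N₁ N₂ : Tm Γ τ) : Tm Γ τ
  | zero {Γ : Ctx} : Tm Γ .nat
  | succ {Γ : Ctx} (M : Tm Γ .nat) : Tm Γ .nat
  | valid {Γ : Ctx} (P : Tm Γ .prop) : Tm Γ .spec
  | emp {Γ : Ctx} : Tm Γ .prop
  | sep {Γ : Ctx} (P Q : Tm Γ .prop) : Tm Γ .prop
  | wand {Γ : Ctx} (P Q : Tm Γ .prop) : Tm Γ .prop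
  | pointsTo {Γ : Ctx} (M : Tm Γ .loc) (N : Tm Γ .val) : Tm Γ .prop
  | hoare {Γ : Ctx} (P : Tm Γ .prop) (M : Tm Γ .exp) (Q : Tm Γ (.arrow .val .prop)) : Tm Γ .spec
  | spec {Γ : Ctx} (M : Tm Γ .spec) : Tm Γ .prop
  | nil {Γ : Ctx} (τ : Ty) : Tm Γ (.seq τ)
  | cons {Γ : Ctx} {τ : Ty} (M : Tm Γ τ) (N : Tm Γ (.seq τ)) : Tm Γ (.seq τ)
  | fold {Γ : Ctx} {τ σ : Ty} (M : Tm Γ (.seq τ)) (N₁ : Tm Γ σ)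
      (N₂ : Tm Γ (.arrow (.prod σ τ) σ)) : Tm Γ σ
  | trace {Γ : Ctx} (t : Tm Γ .trace) : Tm Γ .prop
  | hist {Γ : Ctx} (t : Tm Γ .trace) : Tm Γ .prop
  | inv {Γ : Ctx} (I : Tm Γ (.arrow .trace .bool)) : Tm Γ .prop
  /-- A program value, as a term of type `Val`. -/
  | val {Γ : Ctx} (v : PVal Γ 0) : Tm Γ .val
  /-- A program expression, as a term of type `Exp`. -/
  | exp {Γ : Ctx} (e : PExp Γ 0) : Tm Γ .exp
  /-- The inclusion of locations into values. -/
  | locVal {Γ : Ctx} (M : Tm Γ .loc) : Tm Γ .val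
  /-- The inclusion of natural numbers into values. -/
  | natVal {Γ : Ctx} (M : Tm Γ .nat) : Tm Γ .val

/-- `PVal Γ n`: program values in which terms over `Γ` may occur; `n` is the number of
`λ`-abstractions of the program around the value, and `bvar i` is the variable bound by the `i`-th
of them, counted from the inside. -/
inductive PVal : Ctx → ℕ → Type
  | bvar {Γ : Ctx} {n : ℕ} (i : Fin n) : PVal Γ n
  | term {Γ : Ctx} {n : ℕ} (M : Tm Γ .val) : PVal Γ n
  | unit {Γ : Ctx} {n : ℕ} : PVal Γ n
  | int {Γ : Ctx} {n : ℕ} (k : ℤ) : PVal Γ n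
  | loc {Γ : Ctx} {n : ℕ} (l : Loc) : PVal Γ n
  | fn {Γ : Ctx} {n : ℕ} (f : Fun) : PVal Γ n
  | pair {Γ : Ctx} {n : ℕ} (u v : PVal Γ n) : PVal Γ n

/-- `PExp Γ n`: program expressions in which terms over `Γ` of type `Val` or `Exp` may occur (in
particular the variables of `Γ`), with `n` as for program values. -/
inductive PExp : Ctx → ℕ → Type
  | bvar {Γ : Ctx} {n : ℕ} (i : Fin n) : PExp Γ n
  | valTerm {Γ : Ctx} {n : ℕ} (M : Tm Γ .val) : PExp Γ n
  | expTerm {Γ : Ctx} {n : ℕ} (M : Tm Γ .exp) : PExp Γ n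
  | unit {Γ : Ctx} {n : ℕ} : PExp Γ n
  | int {Γ : Ctx} {n : ℕ} (k : ℤ) : PExp Γ n
  | loc {Γ : Ctx} {n : ℕ} (l : Loc) : PExp Γ n
  | fn {Γ : Ctx} {n : ℕ} (f : Fun) : PExp Γ n
  | lam {Γ : Ctx} {n : ℕ} (e : PExp Γ (n + 1)) : PExp Γ n
  | app {Γ : Ctx} {n : ℕ} (e e' : PExp Γ n) : PExp Γ n
  | ite {Γ : Ctx} {n : ℕ} (e e₁ e₂ : PExp Γ n) : PExp Γ n
  | pair {Γ : Ctx} {n : ℕ} (e e' : PExp Γ n) : PExp Γ n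
  | proj {Γ : Ctx} {n : ℕ} (i : Side) (e : PExp Γ n) : PExp Γ n
  | ref {Γ : Ctx} {n : ℕ} (e : PExp Γ n) : PExp Γ n
  | deref {Γ : Ctx} {n : ℕ} (e : PExp Γ n) : PExp Γ n
  | binop {Γ : Ctx} {n : ℕ} (o : BinOp) (e e' : PExp Γ n) : PExp Γ n
  | emit {Γ : Ctx} {n : ℕ} (v : PVal Γ n) : PExp Γ n

end

/-- The semantics of types. -/
@[reducible] def Ty.Den : Ty → Type
  | .unit => Unit
  | .bool => Bool
  | .nat => ℕ
  | .arrow τ σ => τ.Den → σ.Den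
  | .prod τ σ => τ.Den × σ.Den
  | .seq τ => List τ.Den
  | .form .asrt => AProp
  | .form .spec => SProp
  | .val => Val
  | .exp => Expr
  | .loc => Loc

/-- Variable environments `ρ ∈ ⟦Γ⟧`. -/
abbrev Env (Γ : Ctx) : Type := ∀ τ : Ty, Var Γ τ → τ.Den

/-- `ρ[x ↦ v]`. -/
def Env.cons {Γ : Ctx} {σ : Ty} (ρ : Env Γ) (v : σ.Den) : Env (σ :: Γ)
  | _, .zero => v
  | τ, .succ x => ρ τ x

/-- The semantics of the connectives that the two logics share. -/
def denBot : (k : Logic) → (Ty.form k).Den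
  | .asrt => AProp.pure False
  | .spec => SProp.pure False

def denTop : (k : Logic) → (Ty.form k).Den
  | .asrt => AProp.pure True
  | .spec => SProp.pure True

def denOr : (k : Logic) → (Ty.form k).Den → (Ty.form k).Den → (Ty.form k).Den
  | .asrt => AProp.or
  | .spec => SProp.or

def denAnd : (k : Logic) → (Ty.form k).Den → (Ty.form k).Den → (Ty.form k).Den
  | .asrt => AProp.and
  | .spec => SProp.and

def denImp : (k : Logic) → (Ty.form k).Den → (Ty.form k).Den → (Ty.form k).Den
  | .asrt => AProp.imp
  | .spec => SProp.imp

def denAll : (k : Logic) → {α : Type} → (α → (Ty.form k).Den) → (Ty.form k).Den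
  | .asrt, _ => AProp.all
  | .spec, _ => SProp.all

def denEx : (k : Logic) → {α : Type} → (α → (Ty.form k).Den) → (Ty.form k).Den
  | .asrt, _ => AProp.ex
  | .spec, _ => SProp.ex

def denEq : (k : Logic) → {α : Type} → α → α → (Ty.form k).Den
  | .asrt, _, a, b => AProp.pure (a = b)
  | .spec, _, a, b => SProp.pure (a = b)

mutual

/-- The semantics of terms. On program values and expressions it is the simultaneous
capture-avoiding substitution of the values of the terms that occur in them. -/
def Tm.den : {Γ : Ctx} → {τ : Ty} → Tm Γ τ → Env Γ → τ.Den
  | _, _, .var x, ρ => ρ _ x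
  | _, _, .lam M, ρ => fun v => M.den (ρ.cons v)
  | _, _, .app M N, ρ => (M.den ρ) (N.den ρ)
  | _, _, .unit, _ => ()
  | _, _, .pair M N, ρ => (M.den ρ, N.den ρ)
  | _, _, .fst M, ρ => (M.den ρ).1
  | _, _, .snd M, ρ => (M.den ρ).2
  | _, _, .bot k, _ => denBot k
  | _, _, .top k, _ => denTop k
  | _, _, .or k P Q, ρ => denOr k (P.den ρ) (Q.den ρ)
  | _, _, .and k P Q, ρ => denAnd k (P.den ρ) (Q.den ρ)
  | _, _, .imp k P Q, ρ => denImp k (P.den ρ) (Q.den ρ)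
  | _, _, .all k τ P, ρ => denAll k (α := τ.Den) fun v => P.den (ρ.cons v)
  | _, _, .ex k τ P, ρ => denEx k (α := τ.Den) fun v => P.den (ρ.cons v)
  | _, _, .eq k M N, ρ => denEq k (M.den ρ) (N.den ρ)
  | _, _, .true, _ => Bool.true
  | _, _, .false, _ => Bool.false
  | _, _, .ite M N₁ N₂, ρ => bif M.den ρ then N₁.den ρ else N₂.den ρ
  | _, _, .zero, _ => (0 : ℕ)
  | _, _, .succ M, ρ => Nat.succ (M.den ρ)
  | _, _, .valid P, ρ => SProp.valid (P.den ρ)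
  | _, _, .emp, _ => AProp.pure True
  | _, _, .sep P Q, ρ => AProp.sep (P.den ρ) (Q.den ρ)
  | _, _, .wand P Q, ρ => AProp.wand (P.den ρ) (Q.den ρ)
  | _, _, .pointsTo M N, ρ => AProp.pointsTo (M.den ρ) (N.den ρ)
  | _, _, .hoare P M Q, ρ => SProp.hoare (P.den ρ) (M.den ρ) (Q.den ρ)
  | _, _, .spec M, ρ => AProp.spec (M.den ρ)
  | _, _, .nil τ, _ => ([] : List τ.Den)
  | _, _, .cons M N, ρ => List.cons (M.den ρ) (N.den ρ)
  | _, _, .fold M N₁ N₂, ρ => List.foldl (fun acc x => (N₂.den ρ) (acc, x)) (N₁.den ρ) (M.den ρ)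
  | _, _, .trace t, ρ => AProp.trace (t.den ρ)
  | _, _, .hist t, ρ => AProp.hist (t.den ρ)
  | _, _, .inv I, ρ => AProp.inv (I.den ρ)
  | _, _, .val v, ρ => v.den ρ
  | _, _, .exp e, ρ => e.den ρ
  | _, _, .locVal M, ρ => Val.loc (M.den ρ)
  | _, _, .natVal M, ρ => Val.int (Nat.cast (R := ℤ) (M.den ρ))

def PVal.den : {Γ : Ctx} → {n : ℕ} → PVal Γ n → Env Γ → Val
  | _, _, .bvar i, _ => .var i
  | _, n, .term M, ρ => Val.rename (· + n) (M.den ρ)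
  | _, _, .unit, _ => .unit
  | _, _, .int k, _ => .int k
  | _, _, .loc l, _ => .loc l
  | _, _, .fn f, _ => .fn f
  | _, _, .pair u v, ρ => .pair (u.den ρ) (v.den ρ)

def PExp.den : {Γ : Ctx} → {n : ℕ} → PExp Γ n → Env Γ → Expr
  | _, _, .bvar i, _ => .var i
  | _, n, .valTerm M, ρ => (Val.rename (· + n) (M.den ρ)).toExpr
  | _, n, .expTerm M, ρ => Expr.rename (· + n) (M.den ρ)
  | _, _, .unit, _ => .unit
  | _, _, .int k, _ => .int k
  | _, _, .loc l, _ => .loc l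
  | _, _, .fn f, _ => .fn f
  | _, _, .lam e, ρ => .lam (e.den ρ)
  | _, _, .app e e', ρ => .app (e.den ρ) (e'.den ρ)
  | _, _, .ite e e₁ e₂, ρ => .ite (e.den ρ) (e₁.den ρ) (e₂.den ρ)
  | _, _, .pair e e', ρ => .pair (e.den ρ) (e'.den ρ)
  | _, _, .proj i e, ρ => .proj i (e.den ρ)
  | _, _, .ref e, ρ => .ref (e.den ρ)
  | _, _, .deref e, ρ => .deref (e.den ρ)
  | _, _, .binop o e e', ρ => .binop o (e.den ρ) (e'.den ρ)
  | _, _, .emit v, ρ => .emit (v.den ρ)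

end

/-! ## Renaming and substitution of terms -/

/-- Renamings of term variables. -/
abbrev Ren (Γ Δ : Ctx) : Type := ∀ τ : Ty, Var Γ τ → Var Δ τ

def Ren.lift {Γ Δ : Ctx} {σ : Ty} (r : Ren Γ Δ) : Ren (σ :: Γ) (σ :: Δ)
  | _, .zero => .zero
  | τ, .succ x => .succ (r τ x)

/-- Weakening by one variable. -/
def Ren.wk {Γ : Ctx} {σ : Ty} : Ren Γ (σ :: Γ) := fun _ x => .succ x

/-- Exchange of the two innermost variables. -/
def Ren.swap {Γ : Ctx} {σ τ : Ty} : Ren (σ :: τ :: Γ) (τ :: σ :: Γ)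
  | _, .zero => .succ .zero
  | _, .succ .zero => .zero
  | _, .succ (.succ x) => .succ (.succ x)

mutual

def Tm.rename : {Γ Δ : Ctx} → {τ : Ty} → Ren Γ Δ → Tm Γ τ → Tm Δ τ
  | _, _, _, r, .var x => .var (r _ x)
  | _, _, _, r, .lam M => .lam (M.rename r.lift)
  | _, _, _, r, .app M N => .app (M.rename r) (N.rename r)
  | _, _, _, _, .unit => .unit
  | _, _, _, r, .pair M N => .pair (M.rename r) (N.rename r)
  | _, _, _, r, .fst M => .fst (M.rename r)
  | _, _, _, r, .snd M => .snd (M.rename r)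
  | _, _, _, _, .bot k => .bot k
  | _, _, _, _, .top k => .top k
  | _, _, _, r, .or k P Q => .or k (P.rename r) (Q.rename r)
  | _, _, _, r, .and k P Q => .and k (P.rename r) (Q.rename r)
  | _, _, _, r, .imp k P Q => .imp k (P.rename r) (Q.rename r)
  | _, _, _, r, .all k τ P => .all k τ (P.rename r.lift)
  | _, _, _, r, .ex k τ P => .ex k τ (P.rename r.lift)
  | _, _, _, r, .eq k M N => .eq k (M.rename r) (N.rename r)
  | _, _, _, _, .true => .true
  | _, _, _, _, .false => .false
  | _, _, _, r, .ite M N₁ N₂ => .ite (M.rename r) (N₁.rename r) (N₂.rename r)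
  | _, _, _, _, .zero => .zero
  | _, _, _, r, .succ M => .succ (M.rename r)
  | _, _, _, r, .valid P => .valid (P.rename r)
  | _, _, _, _, .emp => .emp
  | _, _, _, r, .sep P Q => .sep (P.rename r) (Q.rename r)
  | _, _, _, r, .wand P Q => .wand (P.rename r) (Q.rename r)
  | _, _, _, r, .pointsTo M N => .pointsTo (M.rename r) (N.rename r)
  | _, _, _, r, .hoare P M Q => .hoare (P.rename r) (M.rename r) (Q.rename r)
  | _, _, _, r, .spec M => .spec (M.rename r)
  | _, _, _, _, .nil τ => .nil τ
  | _, _, _, r, .cons M N => .cons (M.rename r) (N.rename r)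
  | _, _, _, r, .fold M N₁ N₂ => .fold (M.rename r) (N₁.rename r) (N₂.rename r)
  | _, _, _, r, .trace t => .trace (t.rename r)
  | _, _, _, r, .hist t => .hist (t.rename r)
  | _, _, _, r, .inv I => .inv (I.rename r)
  | _, _, _, r, .val v => .val (v.rename r)
  | _, _, _, r, .exp e => .exp (e.rename r)
  | _, _, _, r, .locVal M => .locVal (M.rename r)
  | _, _, _, r, .natVal M => .natVal (M.rename r)

def PVal.rename : {Γ Δ : Ctx} → {n : ℕ} → Ren Γ Δ → PVal Γ n → PVal Δ n
  | _, _, _, _, .bvar i => .bvar i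
  | _, _, _, r, .term M => .term (M.rename r)
  | _, _, _, _, .unit => .unit
  | _, _, _, _, .int k => .int k
  | _, _, _, _, .loc l => .loc l
  | _, _, _, _, .fn f => .fn f
  | _, _, _, r, .pair u v => .pair (u.rename r) (v.rename r)

def PExp.rename : {Γ Δ : Ctx} → {n : ℕ} → Ren Γ Δ → PExp Γ n → PExp Δ n
  | _, _, _, _, .bvar i => .bvar i
  | _, _, _, r, .valTerm M => .valTerm (M.rename r)
  | _, _, _, r, .expTerm M => .expTerm (M.rename r)
  | _, _, _, _, .unit => .unit
  | _, _, _, _, .int k => .int k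
  | _, _, _, _, .loc l => .loc l
  | _, _, _, _, .fn f => .fn f
  | _, _, _, r, .lam e => .lam (e.rename r)
  | _, _, _, r, .app e e' => .app (e.rename r) (e'.rename r)
  | _, _, _, r, .ite e e₁ e₂ => .ite (e.rename r) (e₁.rename r) (e₂.rename r)
  | _, _, _, r, .pair e e' => .pair (e.rename r) (e'.rename r)
  | _, _, _, r, .proj i e => .proj i (e.rename r)
  | _, _, _, r, .ref e => .ref (e.rename r)
  | _, _, _, r, .deref e => .deref (e.rename r)
  | _, _, _, r, .binop o e e' => .binop o (e.rename r) (e'.rename r)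
  | _, _, _, r, .emit v => .emit (v.rename r)

end

/-- Substitution of program values for the variables bound in the program. -/
def PVal.progSubst {Γ : Ctx} {n m : ℕ} (s : Fin n → PVal Γ m) : PVal Γ n → PVal Γ m
  | .bvar i => s i
  | .term M => .term M
  | .unit => .unit
  | .int k => .int k
  | .loc l => .loc l
  | .fn f => .fn f
  | .pair u v => .pair (u.progSubst s) (v.progSubst s)

/-- Such a substitution under one more `λ`-abstraction. -/
def liftProg {Γ : Ctx} {n m : ℕ} (s : Fin n → PVal Γ m) : Fin (n + 1) → PVal Γ (m + 1) :=
  Fin.cases (.bvar 0) fun i => (s i).progSubst fun j => .bvar j.succ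

/-- The inclusion of program values into program expressions. -/
def PVal.toPExp {Γ : Ctx} {n : ℕ} : PVal Γ n → PExp Γ n
  | .bvar i => .bvar i
  | .term M => .valTerm M
  | .unit => .unit
  | .int k => .int k
  | .loc l => .loc l
  | .fn f => .fn f
  | .pair u v => .pair u.toPExp v.toPExp

/-- Substitution of program values for the variables bound in the program. -/
def PExp.progSubst : {Γ : Ctx} → {n m : ℕ} → (Fin n → PVal Γ m) → PExp Γ n → PExp Γ m
  | _, _, _, s, .bvar i => (s i).toPExp
  | _, _, _, _, .valTerm M => .valTerm M
  | _, _, _, _, .expTerm M => .expTerm M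
  | _, _, _, _, .unit => .unit
  | _, _, _, _, .int k => .int k
  | _, _, _, _, .loc l => .loc l
  | _, _, _, _, .fn f => .fn f
  | _, _, _, s, .lam e => .lam (e.progSubst (liftProg s))
  | _, _, _, s, .app e e' => .app (e.progSubst s) (e'.progSubst s)
  | _, _, _, s, .ite e e₁ e₂ => .ite (e.progSubst s) (e₁.progSubst s) (e₂.progSubst s)
  | _, _, _, s, .pair e e' => .pair (e.progSubst s) (e'.progSubst s)
  | _, _, _, s, .proj i e => .proj i (e.progSubst s)
  | _, _, _, s, .ref e => .ref (e.progSubst s)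
  | _, _, _, s, .deref e => .deref (e.progSubst s)
  | _, _, _, s, .binop o e e' => .binop o (e.progSubst s) (e'.progSubst s)
  | _, _, _, s, .emit v => .emit (v.progSubst s)

/-- A term of type `Val` as a program value; a quoted program value is unquoted. -/
def PVal.ofTm {Γ : Ctx} {n : ℕ} : Tm Γ .val → PVal Γ n
  | .val v => v.progSubst Fin.elim0
  | M => .term M

/-- A term of type `Val` as a program expression; a quoted program value is unquoted. -/
def PExp.ofVal {Γ : Ctx} {n : ℕ} : Tm Γ .val → PExp Γ n
  | .val v => (v.progSubst Fin.elim0).toPExp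
  | M => .valTerm M

/-- A term of type `Exp` as a program expression; a quoted program expression is unquoted. -/
def PExp.ofExp {Γ : Ctx} {n : ℕ} : Tm Γ .exp → PExp Γ n
  | .exp e => e.progSubst Fin.elim0
  | M => .expTerm M

/-- A program value as a term; a term that was used as a program value is returned as such. -/
def PVal.toTm {Γ : Ctx} : PVal Γ 0 → Tm Γ .val
  | .term M => M
  | v => .val v

/-- A program expression as a term; a term that was used as a program expression is returned as
such. -/
def PExp.toTm {Γ : Ctx} : PExp Γ 0 → Tm Γ .exp
  | .expTerm M => M
  | e => .exp e

/-- Simultaneous substitutions of terms for term variables. -/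
abbrev Sub (Γ Δ : Ctx) : Type := ∀ τ : Ty, Var Γ τ → Tm Δ τ

def Sub.lift {Γ Δ : Ctx} {σ : Ty} (s : Sub Γ Δ) : Sub (σ :: Γ) (σ :: Δ)
  | _, .zero => .var .zero
  | τ, .succ x => (s τ x).rename Ren.wk

mutual

def Tm.subst : {Γ Δ : Ctx} → {τ : Ty} → Sub Γ Δ → Tm Γ τ → Tm Δ τ
  | _, _, _, s, .var x => s _ x
  | _, _, _, s, .lam M => .lam (M.subst s.lift)
  | _, _, _, s, .app M N => .app (M.subst s) (N.subst s)
  | _, _, _, _, .unit => .unit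
  | _, _, _, s, .pair M N => .pair (M.subst s) (N.subst s)
  | _, _, _, s, .fst M => .fst (M.subst s)
  | _, _, _, s, .snd M => .snd (M.subst s)
  | _, _, _, _, .bot k => .bot k
  | _, _, _, _, .top k => .top k
  | _, _, _, s, .or k P Q => .or k (P.subst s) (Q.subst s)
  | _, _, _, s, .and k P Q => .and k (P.subst s) (Q.subst s)
  | _, _, _, s, .imp k P Q => .imp k (P.subst s) (Q.subst s)
  | _, _, _, s, .all k τ P => .all k τ (P.subst s.lift)
  | _, _, _, s, .ex k τ P => .ex k τ (P.subst s.lift)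
  | _, _, _, s, .eq k M N => .eq k (M.subst s) (N.subst s)
  | _, _, _, _, .true => .true
  | _, _, _, _, .false => .false
  | _, _, _, s, .ite M N₁ N₂ => .ite (M.subst s) (N₁.subst s) (N₂.subst s)
  | _, _, _, _, .zero => .zero
  | _, _, _, s, .succ M => .succ (M.subst s)
  | _, _, _, s, .valid P => .valid (P.subst s)
  | _, _, _, _, .emp => .emp
  | _, _, _, s, .sep P Q => .sep (P.subst s) (Q.subst s)
  | _, _, _, s, .wand P Q => .wand (P.subst s) (Q.subst s)
  | _, _, _, s, .pointsTo M N => .pointsTo (M.subst s) (N.subst s)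
  | _, _, _, s, .hoare P M Q => .hoare (P.subst s) (M.subst s) (Q.subst s)
  | _, _, _, s, .spec M => .spec (M.subst s)
  | _, _, _, _, .nil τ => .nil τ
  | _, _, _, s, .cons M N => .cons (M.subst s) (N.subst s)
  | _, _, _, s, .fold M N₁ N₂ => .fold (M.subst s) (N₁.subst s) (N₂.subst s)
  | _, _, _, s, .trace t => .trace (t.subst s)
  | _, _, _, s, .hist t => .hist (t.subst s)
  | _, _, _, s, .inv I => .inv (I.subst s)
  | _, _, _, s, .val v => (v.subst s).toTm
  | _, _, _, s, .exp e => (e.subst s).toTm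
  | _, _, _, s, .locVal M => .locVal (M.subst s)
  | _, _, _, s, .natVal M => .natVal (M.subst s)

def PVal.subst : {Γ Δ : Ctx} → {n : ℕ} → Sub Γ Δ → PVal Γ n → PVal Δ n
  | _, _, _, _, .bvar i => .bvar i
  | _, _, _, s, .term M => PVal.ofTm (M.subst s)
  | _, _, _, _, .unit => .unit
  | _, _, _, _, .int k => .int k
  | _, _, _, _, .loc l => .loc l
  | _, _, _, _, .fn f => .fn f
  | _, _, _, s, .pair u v => .pair (u.subst s) (v.subst s)

def PExp.subst : {Γ Δ : Ctx} → {n : ℕ} → Sub Γ Δ → PExp Γ n → PExp Δ n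
  | _, _, _, _, .bvar i => .bvar i
  | _, _, _, s, .valTerm M => PExp.ofVal (M.subst s)
  | _, _, _, s, .expTerm M => PExp.ofExp (M.subst s)
  | _, _, _, _, .unit => .unit
  | _, _, _, _, .int k => .int k
  | _, _, _, _, .loc l => .loc l
  | _, _, _, _, .fn f => .fn f
  | _, _, _, s, .lam e => .lam (e.subst s)
  | _, _, _, s, .app e e' => .app (e.subst s) (e'.subst s)
  | _, _, _, s, .ite e e₁ e₂ => .ite (e.subst s) (e₁.subst s) (e₂.subst s)
  | _, _, _, s, .pair e e' => .pair (e.subst s) (e'.subst s)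
  | _, _, _, s, .proj i e => .proj i (e.subst s)
  | _, _, _, s, .ref e => .ref (e.subst s)
  | _, _, _, s, .deref e => .deref (e.subst s)
  | _, _, _, s, .binop o e e' => .binop o (e.subst s) (e'.subst s)
  | _, _, _, s, .emit v => .emit (v.subst s)

end

/-- Weakening of a term by one variable. -/
def Tm.wk {Γ : Ctx} {σ τ : Ty} (M : Tm Γ τ) : Tm (σ :: Γ) τ := M.rename Ren.wk

/-- The substitution of `N` for the innermost variable. -/
def Sub.inst {Γ : Ctx} {σ : Ty} (N : Tm Γ σ) : Sub (σ :: Γ) Γ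
  | _, .zero => N
  | _, .succ x => .var x

/-- `M[N/x]` for the innermost variable `x`. -/
def Tm.inst {Γ : Ctx} {σ τ : Ty} (M : Tm (σ :: Γ) τ) (N : Tm Γ σ) : Tm Γ τ := M.subst (Sub.inst N)

/-- The body of a program abstraction, with its bound variable turned into a term variable. -/
def PExp.openVar {Γ : Ctx} (e : PExp Γ 1) : PExp (.val :: Γ) 0 :=
  (e.rename Ren.wk).progSubst fun _ => .term (.var .zero)

/-- Evaluation contexts in which terms over `Γ` may occur. -/
inductive PCtx (Γ : Ctx) : Type
  | hole : PCtx Γ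
  | appL (K : PCtx Γ) (e : PExp Γ 0) : PCtx Γ
  | appR (v : PVal Γ 0) (K : PCtx Γ) : PCtx Γ
  | opL (o : BinOp) (K : PCtx Γ) (e : PExp Γ 0) : PCtx Γ
  | opR (o : BinOp) (v : PVal Γ 0) (K : PCtx Γ) : PCtx Γ
  | ite (K : PCtx Γ) (e e' : PExp Γ 0) : PCtx Γ
  | pairL (K : PCtx Γ) (e : PExp Γ 0) : PCtx Γ
  | pairR (v : PVal Γ 0) (K : PCtx Γ) : PCtx Γ
  | proj (i : Side) (K : PCtx Γ) : PCtx Γ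
  | ref (K : PCtx Γ) : PCtx Γ
  | deref (K : PCtx Γ) : PCtx Γ

/-- `K[e]`. -/
def PCtx.fill {Γ : Ctx} : PCtx Γ → PExp Γ 0 → PExp Γ 0
  | .hole, e => e
  | .appL K e', e => .app (K.fill e) e'
  | .appR v K, e => .app v.toPExp (K.fill e)
  | .opL o K e', e => .binop o (K.fill e) e'
  | .opR o v K, e => .binop o v.toPExp (K.fill e)
  | .ite K e₁ e₂, e => .ite (K.fill e) e₁ e₂
  | .pairL K e', e => .pair (K.fill e) e'
  | .pairR v K, e => .pair v.toPExp (K.fill e)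
  | .proj i K, e => .proj i (K.fill e)
  | .ref K, e => .ref (K.fill e)
  | .deref K, e => .deref (K.fill e)

def PCtx.rename {Γ Δ : Ctx} (r : Ren Γ Δ) : PCtx Γ → PCtx Δ
  | .hole => .hole
  | .appL K e => .appL (K.rename r) (e.rename r)
  | .appR v K => .appR (v.rename r) (K.rename r)
  | .opL o K e => .opL o (K.rename r) (e.rename r)
  | .opR o v K => .opR o (v.rename r) (K.rename r)
  | .ite K e e' => .ite (K.rename r) (e.rename r) (e'.rename r)
  | .pairL K e => .pairL (K.rename r) (e.rename r)
  | .pairR v K => .pairR (v.rename r) (K.rename r)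
  | .proj i K => .proj i (K.rename r)
  | .ref K => .ref (K.rename r)
  | .deref K => .deref (K.rename r)

/-! ## Abbreviations -/

namespace Tm

/-- The two innermost variables. -/
abbrev v₀ {Γ : Ctx} {τ : Ty} : Tm (τ :: Γ) τ := .var .zero

abbrev v₁ {Γ : Ctx} {τ σ : Ty} : Tm (σ :: τ :: Γ) τ := .var (.succ .zero)

/-- The triple `{P} e {Q}` of a program expression. -/
abbrev triple {Γ : Ctx} (P : Tm Γ .prop) (e : PExp Γ 0) (Q : Tm Γ (.arrow .val .prop)) :
    Tm Γ .spec := .hoare P e.toTm Q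

/-- The postcondition that ignores the result, `_. Q`. -/
abbrev const {Γ : Ctx} (Q : Tm Γ .prop) : Tm Γ (.arrow .val .prop) := .lam Q.wk

/-- `M ↦ N` for a value `M`: it is a location `l`, and `l ↦ N`. -/
abbrev valPointsTo {Γ : Ctx} (M N : Tm Γ .val) : Tm Γ .prop :=
  .ex .asrt .loc (.and .asrt (.eq .asrt M.wk (.locVal v₀)) (.pointsTo v₀ N.wk))

/-- `M ↦ _`. -/
abbrev valPointsToAny {Γ : Ctx} (M : Tm Γ .val) : Tm Γ .prop := .ex .asrt .val (valPointsTo M.wk v₀)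

/-- Reversal of a sequence. -/
abbrev rev {Γ : Ctx} {τ : Ty} (M : Tm Γ (.seq τ)) : Tm Γ (.seq τ) :=
  .fold M (.nil τ) (.lam (.cons (.snd v₀) (.fst v₀)))

/-- Concatenation of sequences. -/
abbrev append {Γ : Ctx} {τ : Ty} (M N : Tm Γ (.seq τ)) : Tm Γ (.seq τ) :=
  .fold (rev M) N (.lam (.cons (.snd v₀) (.fst v₀)))

/-- `t · v`. -/
abbrev snoc {Γ : Ctx} {τ : Ty} (t : Tm Γ (.seq τ)) (v : Tm Γ τ) : Tm Γ (.seq τ) :=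
  append t (.cons v (.nil τ))

/-- `t ≤ t'` for the prefix order, as an assertion. -/
abbrev isPrefix {Γ : Ctx} {τ : Ty} (t t' : Tm Γ (.seq τ)) : Tm Γ .prop :=
  .ex .asrt (.seq τ) (.eq .asrt t'.wk (append t.wk v₀))

/-- The numeral of a natural number. -/
def numeral {Γ : Ctx} : ℕ → Tm Γ .nat
  | 0 => .zero
  | n + 1 => .succ (numeral n)

end Tm

/-- Specification contexts. -/
abbrev SCtx (Γ : Ctx) := List (Tm Γ .spec)

/-- Weakening of a specification context. -/
abbrev SCtx.wk {Γ : Ctx} {σ : Ty} (Θ : SCtx Γ) : SCtx (σ :: Γ) := Θ.map Tm.wk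

/-! ## The logic -/

open Tm

mutual

/-- `SpecEnt Θ S`: the judgement `Γ | Θ ⊢ S` of the specification logic. -/
inductive SpecEnt : {Γ : Ctx} → SCtx Γ → Tm Γ .spec → Prop
  /- Intuitionistic higher-order logic. -/
  | hyp {Γ : Ctx} {Θ : SCtx Γ} {S : Tm Γ .spec} (h : S ∈ Θ) : SpecEnt Θ S
  | topI {Γ : Ctx} {Θ : SCtx Γ} : SpecEnt Θ (.top .spec)
  | botE {Γ : Ctx} {Θ : SCtx Γ} {S : Tm Γ .spec} (h : SpecEnt Θ (.bot .spec)) : SpecEnt Θ S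
  | andI {Γ : Ctx} {Θ : SCtx Γ} {S T : Tm Γ .spec} (h₁ : SpecEnt Θ S) (h₂ : SpecEnt Θ T) :
      SpecEnt Θ (.and .spec S T)
  | andE₁ {Γ : Ctx} {Θ : SCtx Γ} {S T : Tm Γ .spec} (h : SpecEnt Θ (.and .spec S T)) : SpecEnt Θ S
  | andE₂ {Γ : Ctx} {Θ : SCtx Γ} {S T : Tm Γ .spec} (h : SpecEnt Θ (.and .spec S T)) : SpecEnt Θ T
  | orI₁ {Γ : Ctx} {Θ : SCtx Γ} {S T : Tm Γ .spec} (h : SpecEnt Θ S) : SpecEnt Θ (.or .spec S T)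
  | orI₂ {Γ : Ctx} {Θ : SCtx Γ} {S T : Tm Γ .spec} (h : SpecEnt Θ T) : SpecEnt Θ (.or .spec S T)
  | orE {Γ : Ctx} {Θ : SCtx Γ} {S T U : Tm Γ .spec} (h : SpecEnt Θ (.or .spec S T))
      (h₁ : SpecEnt (S :: Θ) U) (h₂ : SpecEnt (T :: Θ) U) : SpecEnt Θ U
  | impI {Γ : Ctx} {Θ : SCtx Γ} {S T : Tm Γ .spec} (h : SpecEnt (S :: Θ) T) :
      SpecEnt Θ (.imp .spec S T)
  | impE {Γ : Ctx} {Θ : SCtx Γ} {S T : Tm Γ .spec} (h : SpecEnt Θ (.imp .spec S T))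
      (h₁ : SpecEnt Θ S) : SpecEnt Θ T
  | allI {Γ : Ctx} {Θ : SCtx Γ} {τ : Ty} {S : Tm (τ :: Γ) .spec} (h : SpecEnt Θ.wk S) :
      SpecEnt Θ (.all .spec τ S)
  | allE {Γ : Ctx} {Θ : SCtx Γ} {τ : Ty} {S : Tm (τ :: Γ) .spec} (h : SpecEnt Θ (.all .spec τ S))
      (M : Tm Γ τ) : SpecEnt Θ (S.inst M)
  | exI {Γ : Ctx} {Θ : SCtx Γ} {τ : Ty} {S : Tm (τ :: Γ) .spec} (M : Tm Γ τ)
      (h : SpecEnt Θ (S.inst M)) : SpecEnt Θ (.ex .spec τ S)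
  | exE {Γ : Ctx} {Θ : SCtx Γ} {τ : Ty} {S : Tm (τ :: Γ) .spec} {T : Tm Γ .spec}
      (h : SpecEnt Θ (.ex .spec τ S)) (h₁ : SpecEnt (S :: Θ.wk) T.wk) : SpecEnt Θ T
  | eqRefl {Γ : Ctx} {Θ : SCtx Γ} {τ : Ty} (M : Tm Γ τ) : SpecEnt Θ (.eq .spec M M)
  | eqSubst {Γ : Ctx} {Θ : SCtx Γ} {τ : Ty} {M N : Tm Γ τ} (S : Tm (τ :: Γ) .spec)
      (h : SpecEnt Θ (.eq .spec M N)) (h₁ : SpecEnt Θ (S.inst M)) : SpecEnt Θ (S.inst N)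
  /- Equality and induction principles of the data types. -/
  | beta {Γ : Ctx} {Θ : SCtx Γ} {τ σ : Ty} (M : Tm (τ :: Γ) σ) (N : Tm Γ τ) :
      SpecEnt Θ (.eq .spec (.app (.lam M) N) (M.inst N))
  | funExt {Γ : Ctx} {Θ : SCtx Γ} {τ σ : Ty} {M N : Tm Γ (.arrow τ σ)}
      (h : SpecEnt Θ.wk (.eq .spec (.app M.wk v₀) (.app N.wk v₀))) : SpecEnt Θ (.eq .spec M N)
  | unitEta {Γ : Ctx} {Θ : SCtx Γ} (M : Tm Γ .unit) : SpecEnt Θ (.eq .spec M .unit)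
  | fstPair {Γ : Ctx} {Θ : SCtx Γ} {τ σ : Ty} (M : Tm Γ τ) (N : Tm Γ σ) :
      SpecEnt Θ (.eq .spec (.fst (.pair M N)) M)
  | sndPair {Γ : Ctx} {Θ : SCtx Γ} {τ σ : Ty} (M : Tm Γ τ) (N : Tm Γ σ) :
      SpecEnt Θ (.eq .spec (.snd (.pair M N)) N)
  | pairEta {Γ : Ctx} {Θ : SCtx Γ} {τ σ : Ty} (M : Tm Γ (.prod τ σ)) :
      SpecEnt Θ (.eq .spec (.pair (.fst M) (.snd M)) M)
  | ifTrue {Γ : Ctx} {Θ : SCtx Γ} {τ : Ty} (M N : Tm Γ τ) :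
      SpecEnt Θ (.eq .spec (.ite .true M N) M)
  | ifFalse {Γ : Ctx} {Θ : SCtx Γ} {τ : Ty} (M N : Tm Γ τ) :
      SpecEnt Θ (.eq .spec (.ite .false M N) N)
  | foldNil {Γ : Ctx} {Θ : SCtx Γ} {τ σ : Ty} (N₁ : Tm Γ σ) (N₂ : Tm Γ (.arrow (.prod σ τ) σ)) :
      SpecEnt Θ (.eq .spec (.fold (.nil τ) N₁ N₂) N₁)
  | foldCons {Γ : Ctx} {Θ : SCtx Γ} {τ σ : Ty} (M : Tm Γ τ) (N : Tm Γ (.seq τ)) (N₁ : Tm Γ σ)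
      (N₂ : Tm Γ (.arrow (.prod σ τ) σ)) :
      SpecEnt Θ (.eq .spec (.fold (.cons M N) N₁ N₂) (.fold N (.app N₂ (.pair N₁ M)) N₂))
  | boolInd {Γ : Ctx} {Θ : SCtx Γ} (S : Tm (.bool :: Γ) .spec) (h₁ : SpecEnt Θ (S.inst .true))
      (h₂ : SpecEnt Θ (S.inst .false)) : SpecEnt Θ (.all .spec .bool S)
  | natInd {Γ : Ctx} {Θ : SCtx Γ} (S : Tm Γ (.arrow .nat .spec)) (h₁ : SpecEnt Θ (.app S .zero))
      (h₂ : SpecEnt Θ (.all .spec .nat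
        (.imp .spec (.app S.wk v₀) (.app S.wk (.succ v₀))))) :
      SpecEnt Θ (.all .spec .nat (.app S.wk v₀))
  | seqInd {Γ : Ctx} {Θ : SCtx Γ} {τ : Ty} (S : Tm Γ (.arrow (.seq τ) .spec))
      (h₁ : SpecEnt Θ (.app S (.nil τ)))
      (h₂ : SpecEnt Θ (.all .spec (.seq τ) (.all .spec τ
        (.imp .spec (.app S.wk.wk v₁) (.app S.wk.wk (.cons v₀ v₁)))))) :
      SpecEnt Θ (.all .spec (.seq τ) (.app S.wk v₀))
  | succInj {Γ : Ctx} {Θ : SCtx Γ} {M N : Tm Γ .nat} (h : SpecEnt Θ (.eq .spec (.succ M) (.succ N))) :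
      SpecEnt Θ (.eq .spec M N)
  | succNeZero {Γ : Ctx} {Θ : SCtx Γ} {M : Tm Γ .nat} (h : SpecEnt Θ (.eq .spec (.succ M) .zero)) :
      SpecEnt Θ (.bot .spec)
  | locValInj {Γ : Ctx} {Θ : SCtx Γ} {M N : Tm Γ .loc}
      (h : SpecEnt Θ (.eq .spec (.locVal M) (.locVal N))) : SpecEnt Θ (.eq .spec M N)
  | natValInj {Γ : Ctx} {Θ : SCtx Γ} {M N : Tm Γ .nat}
      (h : SpecEnt Θ (.eq .spec (.natVal M) (.natVal N))) : SpecEnt Θ (.eq .spec M N)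
  | natValNumeral {Γ : Ctx} {Θ : SCtx Γ} (n : ℕ) :
      SpecEnt Θ (.eq .spec (.natVal (numeral n)) (.val (.int n)))
  /- The rules for triples and for `valid`. -/
  | valid {Γ : Ctx} {Θ : SCtx Γ} {P : Tm Γ .prop} (h : AsrtEnt Θ (.top .asrt) P) :
      SpecEnt Θ (.valid P)
  | ret {Γ : Ctx} {Θ : SCtx Γ} (v : Tm Γ .val) :
      SpecEnt Θ (triple (.top .asrt) (.ofVal v) (.lam (.eq .asrt v₀ v.wk)))
  | specOut {Γ : Ctx} {Θ : SCtx Γ} {S : Tm Γ .spec} {P : Tm Γ .prop} {e : Tm Γ .exp}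
      {R : Tm Γ (.arrow .val .prop)} (h : SpecEnt (S :: Θ) (.hoare P e R)) :
      SpecEnt Θ (.hoare (.sep P (.spec S)) e R)
  | frame {Γ : Ctx} {Θ : SCtx Γ} {P : Tm Γ .prop} {e : Tm Γ .exp} {Q : Tm Γ (.arrow .val .prop)}
      (R : Tm Γ .prop) (h : SpecEnt Θ (.hoare P e Q)) :
      SpecEnt Θ (.hoare (.sep P R) e (.lam (.sep (.app Q.wk v₀) R.wk)))
  /-- In `Q` the innermost variable is `x`; in `R` it is `r`, followed by `x`. -/
  | bind {Γ : Ctx} {Θ : SCtx Γ} {P : Tm Γ .prop} {e : PExp Γ 0} {K : PCtx Γ}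
      {Q : Tm (.val :: Γ) .prop} {R : Tm (.val :: .val :: Γ) .prop}
      (h₁ : SpecEnt Θ (triple P e (.lam Q)))
      (h₂ : SpecEnt Θ.wk (triple Q ((K.rename Ren.wk).fill (.valTerm v₀)) (.lam R))) :
      SpecEnt Θ (triple P (K.fill e) (.lam (.ex .asrt .val (R.rename Ren.swap))))
  | csq {Γ : Ctx} {Θ : SCtx Γ} {P₁ P₂ : Tm Γ .prop} {e : Tm Γ .exp}
      {Q₁ Q₂ : Tm Γ (.arrow .val .prop)} (h₁ : AsrtEnt Θ P₁ P₂) (h₂ : SpecEnt Θ (.hoare P₂ e Q₂))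
      (h₃ : AsrtEnt Θ.wk (.app Q₂.wk v₀) (.app Q₁.wk v₀)) : SpecEnt Θ (.hoare P₁ e Q₁)
  /-- In the conclusion the innermost variable is `x`, followed by `r`. -/
  | abs {Γ : Ctx} {Θ : SCtx Γ} {P : Tm (.val :: Γ) .prop} {e : PExp Γ 1}
      {Q : Tm (.val :: Γ) (.arrow .val .prop)} (h : SpecEnt Θ.wk (triple P e.openVar Q)) :
      SpecEnt Θ (triple .emp (.lam e) (.lam (.all .asrt .val (.spec
        (triple (P.rename Ren.wk.lift) (.app (.valTerm v₁) (.valTerm v₀))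
          (Q.rename Ren.wk.lift))))))
  | write {Γ : Ctx} {Θ : SCtx Γ} (l v : Tm Γ .val) :
      SpecEnt Θ (triple (valPointsToAny l) (.binop .assign (.ofVal l) (.ofVal v))
        (.lam (.sep (valPointsTo l.wk v.wk) (.eq .asrt v₀ (.val .unit)))))
  | read {Γ : Ctx} {Θ : SCtx Γ} (l v : Tm Γ .val) :
      SpecEnt Θ (triple (valPointsTo l v) (.deref (.ofVal l))
        (.lam (.sep (valPointsTo l.wk v.wk) (.eq .asrt v₀ v.wk))))
  | alloc {Γ : Ctx} {Θ : SCtx Γ} (v : Tm Γ .val) :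
      SpecEnt Θ (triple .emp (.ref (.ofVal v)) (.lam (valPointsTo v₀ v.wk)))
  | emit {Γ : Ctx} {Θ : SCtx Γ} (t : Tm Γ .trace) (v : Tm Γ .val)
      (I : Tm Γ (.arrow .trace .bool)) (h : SpecEnt Θ (.eq .spec (.app I (snoc t v)) .true)) :
      SpecEnt Θ (triple (.sep (.trace t) (.inv I)) (.emit (.ofTm v)) (const (.trace (snoc t v))))
  /-- The rule `emit` with a postcondition that also gives the result. -/
  | emitUnit {Γ : Ctx} {Θ : SCtx Γ} (t : Tm Γ .trace) (v : Tm Γ .val)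
      (I : Tm Γ (.arrow .trace .bool)) (h : SpecEnt Θ (.eq .spec (.app I (snoc t v)) .true)) :
      SpecEnt Θ (triple (.sep (.trace t) (.inv I)) (.emit (.ofTm v))
        (.lam (.sep (Tm.wk (.trace (snoc t v))) (.eq .asrt v₀ (.val .unit)))))
  | exPre {Γ : Ctx} {Θ : SCtx Γ} {τ : Ty} {P : Tm (τ :: Γ) .prop} {e : Tm Γ .exp}
      {Q : Tm Γ (.arrow .val .prop)} (h : SpecEnt Θ.wk (.hoare P e.wk Q.wk)) :
      SpecEnt Θ (.hoare (.ex .asrt τ P) e Q)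
  /- The silent steps that do not involve the state. -/
  | projOne {Γ : Ctx} {Θ : SCtx Γ} (u v : Tm Γ .val) :
      SpecEnt Θ (triple (.top .asrt) (.proj .one (.pair (.ofVal u) (.ofVal v)))
        (.lam (.eq .asrt v₀ u.wk)))
  | projTwo {Γ : Ctx} {Θ : SCtx Γ} (u v : Tm Γ .val) :
      SpecEnt Θ (triple (.top .asrt) (.proj .two (.pair (.ofVal u) (.ofVal v)))
        (.lam (.eq .asrt v₀ v.wk)))
  | condTrue {Γ : Ctx} {Θ : SCtx Γ} {P : Tm Γ .prop} {n : ℤ} {e₁ e₂ : PExp Γ 0}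
      {Q : Tm Γ (.arrow .val .prop)} (hn : 0 < n) (h : SpecEnt Θ (triple P e₁ Q)) :
      SpecEnt Θ (triple P (.ite (.int n) e₁ e₂) Q)
  | condFalse {Γ : Ctx} {Θ : SCtx Γ} {P : Tm Γ .prop} {e₁ e₂ : PExp Γ 0}
      {Q : Tm Γ (.arrow .val .prop)} (h : SpecEnt Θ (triple P e₂ Q)) :
      SpecEnt Θ (triple P (.ite (.int 0) e₁ e₂) Q)
  | arith {Γ : Ctx} {Θ : SCtx Γ} (o : BinOp) (i j k : ℤ)
      (h : o.eval (.int i) (.int j) = some (.int k)) :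
      SpecEnt Θ (triple (.top .asrt) (.binop o (.int i) (.int j))
        (.lam (.eq .asrt v₀ (.val (.int k)))))
  | eqTest {Γ : Ctx} {Θ : SCtx Γ} (u v : Tm Γ .val) :
      SpecEnt Θ (triple (.top .asrt) (.binop .eq (.ofVal u) (.ofVal v))
        (.lam (.or .asrt
          (.and .asrt (.eq .asrt u.wk v.wk) (.eq .asrt v₀ (.val (.int 1))))
          (.and .asrt (.imp .asrt (.eq .asrt u.wk v.wk) (.bot .asrt))
            (.eq .asrt v₀ (.val (.int 0)))))))

/-- `AsrtEnt Θ P Q`: the judgement `Γ | Θ | P ⊢ Q` of the assertion logic. -/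
inductive AsrtEnt : {Γ : Ctx} → SCtx Γ → Tm Γ .prop → Tm Γ .prop → Prop
  /- Intuitionistic higher-order logic. -/
  | refl {Γ : Ctx} {Θ : SCtx Γ} (P : Tm Γ .prop) : AsrtEnt Θ P P
  | trans {Γ : Ctx} {Θ : SCtx Γ} {P Q R : Tm Γ .prop} (h₁ : AsrtEnt Θ P Q) (h₂ : AsrtEnt Θ Q R) :
      AsrtEnt Θ P R
  | topI {Γ : Ctx} {Θ : SCtx Γ} (P : Tm Γ .prop) : AsrtEnt Θ P (.top .asrt)
  | botE {Γ : Ctx} {Θ : SCtx Γ} (P : Tm Γ .prop) : AsrtEnt Θ (.bot .asrt) P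
  | andI {Γ : Ctx} {Θ : SCtx Γ} {P Q R : Tm Γ .prop} (h₁ : AsrtEnt Θ P Q) (h₂ : AsrtEnt Θ P R) :
      AsrtEnt Θ P (.and .asrt Q R)
  | andE₁ {Γ : Ctx} {Θ : SCtx Γ} (P Q : Tm Γ .prop) : AsrtEnt Θ (.and .asrt P Q) P
  | andE₂ {Γ : Ctx} {Θ : SCtx Γ} (P Q : Tm Γ .prop) : AsrtEnt Θ (.and .asrt P Q) Q
  | orI₁ {Γ : Ctx} {Θ : SCtx Γ} (P Q : Tm Γ .prop) : AsrtEnt Θ P (.or .asrt P Q)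
  | orI₂ {Γ : Ctx} {Θ : SCtx Γ} (P Q : Tm Γ .prop) : AsrtEnt Θ Q (.or .asrt P Q)
  | orE {Γ : Ctx} {Θ : SCtx Γ} {P Q R : Tm Γ .prop} (h₁ : AsrtEnt Θ P R) (h₂ : AsrtEnt Θ Q R) :
      AsrtEnt Θ (.or .asrt P Q) R
  | impI {Γ : Ctx} {Θ : SCtx Γ} {P Q R : Tm Γ .prop} (h : AsrtEnt Θ (.and .asrt P Q) R) :
      AsrtEnt Θ P (.imp .asrt Q R)
  | impE {Γ : Ctx} {Θ : SCtx Γ} {P Q R : Tm Γ .prop} (h₁ : AsrtEnt Θ P (.imp .asrt Q R))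
      (h₂ : AsrtEnt Θ P Q) : AsrtEnt Θ P R
  | allI {Γ : Ctx} {Θ : SCtx Γ} {τ : Ty} {P : Tm Γ .prop} {Q : Tm (τ :: Γ) .prop}
      (h : AsrtEnt Θ.wk P.wk Q) : AsrtEnt Θ P (.all .asrt τ Q)
  | allE {Γ : Ctx} {Θ : SCtx Γ} {τ : Ty} (Q : Tm (τ :: Γ) .prop) (M : Tm Γ τ) :
      AsrtEnt Θ (.all .asrt τ Q) (Q.inst M)
  | exI {Γ : Ctx} {Θ : SCtx Γ} {τ : Ty} (Q : Tm (τ :: Γ) .prop) (M : Tm Γ τ) :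
      AsrtEnt Θ (Q.inst M) (.ex .asrt τ Q)
  | exE {Γ : Ctx} {Θ : SCtx Γ} {τ : Ty} {P : Tm (τ :: Γ) .prop} {Q : Tm Γ .prop}
      (h : AsrtEnt Θ.wk P Q.wk) : AsrtEnt Θ (.ex .asrt τ P) Q
  | eqRefl {Γ : Ctx} {Θ : SCtx Γ} {τ : Ty} (P : Tm Γ .prop) (M : Tm Γ τ) :
      AsrtEnt Θ P (.eq .asrt M M)
  | eqSubst {Γ : Ctx} {Θ : SCtx Γ} {τ : Ty} {P : Tm Γ .prop} {M N : Tm Γ τ} (Q : Tm (τ :: Γ) .prop)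
      (h₁ : AsrtEnt Θ P (.eq .asrt M N)) (h₂ : AsrtEnt Θ P (Q.inst M)) : AsrtEnt Θ P (Q.inst N)
  /- Separating conjunction and its adjoint. -/
  | sepMono {Γ : Ctx} {Θ : SCtx Γ} {P P' Q Q' : Tm Γ .prop} (h₁ : AsrtEnt Θ P P')
      (h₂ : AsrtEnt Θ Q Q') : AsrtEnt Θ (.sep P Q) (.sep P' Q')
  | sepComm {Γ : Ctx} {Θ : SCtx Γ} (P Q : Tm Γ .prop) : AsrtEnt Θ (.sep P Q) (.sep Q P)
  | sepAssoc {Γ : Ctx} {Θ : SCtx Γ} (P Q R : Tm Γ .prop) :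
      AsrtEnt Θ (.sep (.sep P Q) R) (.sep P (.sep Q R))
  | sepEmpI {Γ : Ctx} {Θ : SCtx Γ} (P : Tm Γ .prop) : AsrtEnt Θ P (.sep P .emp)
  | sepEmpE {Γ : Ctx} {Θ : SCtx Γ} (P : Tm Γ .prop) : AsrtEnt Θ (.sep P .emp) P
  | empI {Γ : Ctx} {Θ : SCtx Γ} (P : Tm Γ .prop) : AsrtEnt Θ P .emp
  | wandI {Γ : Ctx} {Θ : SCtx Γ} {P Q R : Tm Γ .prop} (h : AsrtEnt Θ (.sep P Q) R) :
      AsrtEnt Θ P (.wand Q R)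
  | wandE {Γ : Ctx} {Θ : SCtx Γ} (P Q : Tm Γ .prop) : AsrtEnt Θ (.sep (.wand P Q) P) Q
  /- The use of specifications. -/
  | spec {Γ : Ctx} {Θ : SCtx Γ} (S : Tm Γ .spec) (P : Tm Γ .prop) : AsrtEnt (S :: Θ) P (.spec S)
  | valid {Γ : Ctx} {Θ : SCtx Γ} (P Q : Tm Γ .prop) : AsrtEnt (.valid Q :: Θ) P Q
  | specCut {Γ : Ctx} {Θ : SCtx Γ} {S : Tm Γ .spec} {P Q : Tm Γ .prop} (h₁ : SpecEnt Θ S)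
      (h₂ : AsrtEnt (S :: Θ) P Q) : AsrtEnt Θ P Q
  /- The trace primitives. -/
  | invDupl {Γ : Ctx} {Θ : SCtx Γ} (I : Tm Γ (.arrow .trace .bool)) :
      AsrtEnt Θ (.inv I) (.sep (.inv I) (.inv I))
  | histDupl {Γ : Ctx} {Θ : SCtx Γ} (t : Tm Γ .trace) :
      AsrtEnt Θ (.hist t) (.sep (.hist t) (.hist t))
  | useHist {Γ : Ctx} {Θ : SCtx Γ} (t₁ t₂ : Tm Γ .trace) :
      AsrtEnt Θ (.sep (.trace t₁) (.hist t₂)) (.sep (.trace t₁) (isPrefix t₂ t₁))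
  | allocHist {Γ : Ctx} {Θ : SCtx Γ} (t : Tm Γ .trace) :
      AsrtEnt Θ (.trace t) (.sep (.trace t) (.hist t))

end

/-! ## Semantic entailment -/

/-- `⟦Γ ⊢ Θ⟧_ρ(w)`. -/
def SCtx.Holds {Γ : Ctx} (Θ : SCtx Γ) (ρ : Env Γ) (w : World) : Prop :=
  ∀ T ∈ Θ, SProp.holds (T.den ρ) w

/-- `SpecValid Θ S`: the judgement `Γ | Θ ⊨ S`. -/
def SpecValid {Γ : Ctx} (Θ : SCtx Γ) (S : Tm Γ .spec) : Prop :=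
  ∀ (w : World) (ρ : Env Γ), Θ.Holds ρ w → SProp.holds (S.den ρ) w

/-- `AsrtValid Θ P Q`: the judgement `Γ | Θ | P ⊨ Q`. -/
def AsrtValid {Γ : Ctx} (Θ : SCtx Γ) (P Q : Tm Γ .prop) : Prop :=
  ∀ (w : World) (ρ : Env Γ), Θ.Holds ρ w → AProp.sat (P.den ρ) w ⊆ AProp.sat (Q.den ρ) w

end TraceLogic

namespace TraceLogic

/-! ## Renaming and substitution of programs -/

theorem Val.rename_eq_subst (r : ℕ → ℕ) (v : Val) : v.rename r = v.subst fun x => .var (r x) := by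
  induction v <;> simp_all [Val.rename, Val.subst]

theorem Val.subst_rename (r : ℕ → ℕ) (σ : ℕ → Val) (v : Val) :
    (v.rename r).subst σ = v.subst fun x => σ (r x) := by
  induction v <;> simp_all [Val.rename, Val.subst]

theorem Val.subst_var (v : Val) : v.subst .var = v := by
  induction v <;> simp_all [Val.subst]

theorem Val.rename_id (v : Val) : v.rename (fun x => x) = v := by
  rw [Val.rename_eq_subst, Val.subst_var]

theorem Val.toExpr_subst (σ : ℕ → Val) (v : Val) : (v.subst σ).toExpr = v.toExpr.subst σ := by
  induction v <;> simp_all [Val.subst, Val.toExpr, Expr.subst]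

theorem Val.toExpr_injective : Function.Injective Val.toExpr := by
  intro u
  induction u with
  | pair u₁ u₂ ih₁ ih₂ =>
    intro v h
    cases v <;> simp only [Val.toExpr, Expr.pair.injEq, reduceCtorEq] at h
    rw [ih₁ h.1, ih₂ h.2]
  | _ => intro v h; cases v <;> simp_all [Val.toExpr]

theorem liftSubst_var (r : ℕ → ℕ) :
    liftSubst (fun x => .var (r x)) = fun x => .var (liftRen r x) := by
  funext x
  cases x <;> rfl

theorem liftSubst_liftRen (r : ℕ → ℕ) (σ : ℕ → Val) :
    (fun x => liftSubst σ (liftRen r x)) = liftSubst fun x => σ (r x) := by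
  funext x
  cases x <;> rfl

theorem Expr.rename_eq_subst (r : ℕ → ℕ) (e : Expr) :
    e.rename r = e.subst fun x => .var (r x) := by
  induction e generalizing r <;>
    simp_all [Expr.rename, Expr.subst, liftSubst_var, Val.rename_eq_subst, Val.toExpr]

theorem Expr.subst_rename (r : ℕ → ℕ) (σ : ℕ → Val) (e : Expr) :
    (e.rename r).subst σ = e.subst fun x => σ (r x) := by
  induction e generalizing r σ <;>
    simp_all [Expr.rename, Expr.subst, liftSubst_liftRen, Val.subst_rename]

theorem liftRen_id : liftRen (fun x => x) = fun x => x := by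
  funext x
  cases x <;> rfl

theorem Expr.rename_id (e : Expr) : e.rename (fun x => x) = e := by
  induction e <;> simp_all [Expr.rename, liftRen_id, Val.rename_id]

/-! ## Decomposition of expressions -/

/-- The expression is a value. -/
def Expr.IsVal (e : Expr) : Prop := ∃ v : Val, e = v.toExpr

theorem Val.isVal (v : Val) : v.toExpr.IsVal := ⟨v, rfl⟩

theorem Expr.isVal_pair {e e' : Expr} : (Expr.pair e e').IsVal ↔ e.IsVal ∧ e'.IsVal := by
  constructor
  · rintro ⟨v, h⟩
    cases v <;> simp only [Val.toExpr, Expr.pair.injEq, reduceCtorEq] at h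
    exact ⟨⟨_, h.1⟩, ⟨_, h.2⟩⟩
  · rintro ⟨⟨u, rfl⟩, ⟨v, rfl⟩⟩
    exact ⟨.pair u v, rfl⟩

theorem ECtx.isVal_of_fill {K : ECtx} {e : Expr} (h : (K.fill e).IsVal) : e.IsVal := by
  induction K with
  | hole => exact h
  | pairL K e' ih => exact ih (Expr.isVal_pair.1 h).1
  | pairR v K ih => exact ih (Expr.isVal_pair.1 h).2
  | _ => obtain ⟨v, h⟩ := h; cases v <;> simp [Val.toExpr, ECtx.fill] at h

theorem HeadStep.not_isVal {e e' : Expr} {s s' : State} {a : Option Val}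
    (h : HeadStep e s a e' s') : ¬ e.IsVal := by
  rintro ⟨v, hv⟩
  cases h <;> cases v <;> simp [Val.toExpr] at hv

theorem Step.not_isVal {e e' : Expr} {s s' : State} {a : Option Val} (h : Step e s a e' s') :
    ¬ e.IsVal := by
  obtain ⟨K, h⟩ := h
  exact fun hv => h.not_isVal (ECtx.isVal_of_fill hv)

theorem HeadStep.isVal_of_fill {K : ECtx} {e₁ e e' : Expr} {s s' : State} {a : Option Val}
    (h : HeadStep e₁ s a e' s') (he : e₁ = K.fill e) : K = .hole ∨ e.IsVal := by
  cases K with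
  | hole => exact .inl rfl
  | _ =>
    right
    cases h <;> simp only [ECtx.fill, Expr.app.injEq, Expr.proj.injEq, Expr.ite.injEq,
      Expr.ref.injEq, Expr.deref.injEq, Expr.binop.injEq, reduceCtorEq] at he
    all_goals
      first
      | exact ECtx.isVal_of_fill ⟨_, he.symm⟩
      | exact ECtx.isVal_of_fill ⟨_, he.1.symm⟩
      | exact ECtx.isVal_of_fill ⟨_, he.2.symm⟩
      | exact ECtx.isVal_of_fill ⟨_, he.2.1.symm⟩
      | exact ECtx.isVal_of_fill ⟨_, he.2.2.symm⟩
      | exact ECtx.isVal_of_fill ⟨.fn _, he.1.symm⟩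
      | exact ECtx.isVal_of_fill ⟨.int _, he.1.symm⟩
      | exact ECtx.isVal_of_fill ⟨.loc _, he.symm⟩
      | exact ECtx.isVal_of_fill ⟨.loc _, he.2.1.symm⟩
      | exact ECtx.isVal_of_fill ⟨.pair _ _, he.2.symm⟩

/-- Composition of evaluation contexts. -/
def ECtx.comp : ECtx → ECtx → ECtx
  | .hole, K' => K'
  | .appL K e, K' => .appL (K.comp K') e
  | .appR v K, K' => .appR v (K.comp K')
  | .opL o K e, K' => .opL o (K.comp K') e
  | .opR o v K, K' => .opR o v (K.comp K')
  | .ite K e₁ e₂, K' => .ite (K.comp K') e₁ e₂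
  | .pairL K e, K' => .pairL (K.comp K') e
  | .pairR v K, K' => .pairR v (K.comp K')
  | .proj i K, K' => .proj i (K.comp K')
  | .ref K, K' => .ref (K.comp K')
  | .deref K, K' => .deref (K.comp K')

theorem ECtx.fill_comp (K K' : ECtx) (e : Expr) : (K.comp K').fill e = K.fill (K'.fill e) := by
  induction K <;> simp_all [ECtx.comp, ECtx.fill]

theorem Step.fill {e e' : Expr} {s s' : State} {a : Option Val} (K : ECtx)
    (h : Step e s a e' s') : Step (K.fill e) s a (K.fill e') s' := by
  obtain ⟨K', h⟩ := h
  rw [← ECtx.fill_comp, ← ECtx.fill_comp]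
  exact .ctx _ h

theorem ECtx.fill_eq_fill {K K' : ECtx} {e e₁ e₂ : Expr} {s s' : State} {a : Option Val}
    (he : ¬ e.IsVal) (h : HeadStep e₁ s a e₂ s') (hK : K.fill e = K'.fill e₁) :
    ∃ K'', K' = K.comp K'' ∧ e = K''.fill e₁ := by
  induction K generalizing K' with
  | hole => exact ⟨K', rfl, hK⟩
  | _ =>
    rename_i ih
    by_cases hole : K' = .hole
    · subst hole
      rcases h.isVal_of_fill hK.symm with h | h
      · cases h
      · exact absurd h he
    cases K' <;> simp only [ECtx.fill, Expr.app.injEq, Expr.proj.injEq, Expr.ite.injEq,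
      Expr.ref.injEq, Expr.deref.injEq, Expr.binop.injEq, Expr.pair.injEq, reduceCtorEq,
      not_true_eq_false] at hK hole
    all_goals
      first
      | exact absurd (ECtx.isVal_of_fill ⟨_, hK.1⟩) he
      | exact absurd (ECtx.isVal_of_fill ⟨_, hK.2.1⟩) he
      | exact absurd (ECtx.isVal_of_fill ⟨_, hK.1.symm⟩) h.not_isVal
      | exact absurd (ECtx.isVal_of_fill ⟨_, hK.2.1.symm⟩) h.not_isVal
      | (obtain ⟨K'', rfl, rfl⟩ := ih (by
           first
           | exact hK | exact hK.1 | exact hK.2 | exact hK.2.1 | exact hK.2.2)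
         exact ⟨K'', by simp_all [ECtx.comp, Val.toExpr_injective.eq_iff], rfl⟩)

theorem Step.of_fill {K : ECtx} {e e₁ : Expr} {s s' : State} {a : Option Val}
    (h : Step (K.fill e) s a e₁ s') (he : ¬ e.IsVal) :
    ∃ e', e₁ = K.fill e' ∧ Step e s a e' s' := by
  generalize hx : K.fill e = x at h
  obtain ⟨K', h⟩ := h
  obtain ⟨K'', rfl, rfl⟩ := ECtx.fill_eq_fill he h hx
  exact ⟨_, ECtx.fill_comp _ _ _, .ctx _ h⟩

theorem HeadStep.step {e e' : Expr} {s s' : State} {a : Option Val} (h : HeadStep e s a e' s') :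
    Step e s a e' s' := .ctx .hole h

/-- The immediate subexpressions in evaluation position are values. -/
def Expr.Flat (e : Expr) : Prop := ∀ (K : ECtx) (e' : Expr), e = K.fill e' → K = .hole ∨ e'.IsVal

theorem Step.head_of_flat {e e' : Expr} {s s' : State} {a : Option Val} (h : Step e s a e' s')
    (he : e.Flat) : HeadStep e s a e' s' := by
  obtain ⟨K, h⟩ := h
  rcases he K _ rfl with rfl | hv
  · exact h
  · exact absurd hv h.not_isVal

theorem HeadStep.flat {e e' : Expr} {s s' : State} {a : Option Val} (h : HeadStep e s a e' s') :
    e.Flat := fun _ _ => h.isVal_of_fill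

/-! ## The resource monoid -/

theorem TraceRes.mul_comm {a b c : TraceRes} (h : TraceRes.mul a b = some c) :
    TraceRes.mul b a = some c := by
  obtain ⟨_ | _, t₁⟩ := a <;> obtain ⟨_ | _, t₂⟩ := b <;>
    simp only [TraceRes.mul] at h ⊢ <;>
    grind [List.IsPrefix.eq_of_length, List.IsPrefix.length_le]

theorem heapMul_eq_some {a b c : Heap} :
    heapMul a b = some c ↔ a.Disjoint b ∧ a ∪ b = c := by
  simp [heapMul]

theorem heapMul_comm {a b c : Heap} (h : heapMul a b = some c) : heapMul b a = some c := by
  rw [heapMul_eq_some] at h ⊢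
  exact ⟨h.1.symm, by rw [Finmap.union_comm_of_disjoint h.1.symm, h.2]⟩

theorem Res.mul_comm {a b c : Res} (h : Res.mul a b = some c) : Res.mul b a = some c := by
  rw [Res.mul_eq_some] at h ⊢
  exact ⟨heapMul_comm h.1, TraceRes.mul_comm h.2⟩

theorem Res.mul_assoc' {a b c bc abc : Res} (h₁ : Res.mul b c = some bc)
    (h₂ : Res.mul a bc = some abc) : ∃ ab, Res.mul a b = some ab ∧ Res.mul ab c = some abc := by
  obtain ⟨x, hx, hx'⟩ := Res.mul_assoc (Res.mul_comm h₁) (Res.mul_comm h₂)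
  exact ⟨x, Res.mul_comm hx, Res.mul_comm hx'⟩

theorem TraceRes.mul_hist {k : Tag} {t t' : Trace} (h : t' <+: t) :
    TraceRes.mul (k, t) (.hist, t') = some (k, t) := by
  cases k <;> simp [TraceRes.mul, h]

theorem heapMul_empty (a : Heap) : heapMul a ∅ = some a :=
  heapMul_eq_some.2 ⟨(Finmap.disjoint_empty a).symm, Finmap.union_empty⟩

theorem Res.mul_empty {a : Res} {t : Trace} (h : t <+: a.2.2) :
    Res.mul a (∅, (.hist, t)) = some a :=
  Res.mul_eq_some.2 ⟨heapMul_empty _, TraceRes.mul_hist h⟩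

theorem Res.mul_one (a : Res) : Res.mul a Res.one = some a := Res.mul_empty List.nil_prefix

theorem Res.Le.refl (a : Res) : a.Le a := ⟨_, Res.mul_one a⟩

theorem Res.le_mul_left {a b c : Res} (h : Res.mul a b = some c) : a.Le c := ⟨b, h⟩

theorem Res.le_mul_right {a b c : Res} (h : Res.mul a b = some c) : b.Le c := ⟨a, Res.mul_comm h⟩

theorem TraceRes.full_le {t : Trace} {a : TraceRes} (h : TraceRes.Le (.full, t) a) :
    a = (.full, t) := by
  obtain ⟨⟨_ | _, t'⟩, h⟩ := h <;> simp [TraceRes.mul] at h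
  exact h.2.symm

theorem TraceRes.full_le_refl (t : Trace) : TraceRes.Le (.full, t) (.full, t) :=
  ⟨(.hist, []), TraceRes.mul_hist List.nil_prefix⟩

theorem TraceRes.hist_le {t : Trace} {a : TraceRes} : TraceRes.Le (.hist, t) a ↔ t <+: a.2 := by
  constructor
  · rintro ⟨⟨_ | _, t'⟩, h⟩ <;> simp only [TraceRes.mul] at h <;> grind
  · intro h
    exact ⟨a, TraceRes.mul_comm (TraceRes.mul_hist h)⟩

theorem TraceRes.mul_full {a : TraceRes} {t : Trace} {c : TraceRes}
    (h : TraceRes.mul (.full, t) a = some c) : ∃ t', a = (.hist, t') ∧ t' <+: t ∧ c = (.full, t) := by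
  obtain ⟨_ | _, t'⟩ := a <;> simp [TraceRes.mul] at h
  exact ⟨t', rfl, h.1, h.2.symm⟩

/-! ## Weakest preconditions -/

theorem wp_eq (Q : Val → World → Set Res) : wp Q = wpStep Q (wp Q) :=
  (OrderHom.map_gfp ⟨wpStep Q, wpStep_mono Q⟩).symm

theorem mem_wp {Q : Val → World → Set Res} {e : Expr} {w : World} {m : Res} :
    m ∈ wp Q e w ↔ m ∈ wpStep Q (wp Q) e w := by
  rw [← wp_eq]

/-- Coinduction for the weakest precondition. -/
theorem mem_wp_of_coind {Q : Val → World → Set Res} (X : Expr → World → Set Res)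
    (hX : ∀ e w m, m ∈ X e w → m ∈ wpStep Q (X ⊔ wp Q) e w) {e : Expr} {w : World} {m : Res}
    (hm : m ∈ X e w) : m ∈ wp Q e w := by
  have : X ⊔ wp Q ≤ wp Q := by
    refine OrderHom.le_gfp (f := ⟨wpStep Q, wpStep_mono Q⟩) (sup_le (fun e w m => hX e w m) ?_)
    conv_lhs => rw [wp_eq]
    exact wpStep_mono Q le_sup_right
  exact this e w (Or.inl hm)

theorem Val.irreducible (v : Val) (s : State) : Irreducible v.toExpr s :=
  fun ⟨_, _, _, h⟩ => h.not_isVal v.isVal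

theorem mem_wp_val {Q : Val → World → Set Res} {v : Val} {w : World} {m : Res} (h : m ∈ Q v w) :
    m ∈ wp Q v.toExpr w :=
  mem_wp.2 fun _ _ _ _ _ _ =>
    ⟨fun _ => ⟨v, rfl, h⟩, fun _ _ _ hs => absurd v.isVal hs.not_isVal⟩

theorem wp_mono {Q Q' : Val → World → Set Res} {w₀ : World}
    (h : ∀ v w, w₀.Le w → Q v w ⊆ Q' v w) {e : Expr} {w : World} (hw : w₀.Le w) :
    wp Q e w ⊆ wp Q' e w := by
  intro m hm
  refine mem_wp_of_coind (fun e w => {m | w₀.Le w ∧ m ∈ wp Q e w}) ?_ ⟨hw, hm⟩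
  rintro e w m ⟨hw, hm⟩ r mr t s hr hs
  obtain ⟨h₁, h₂⟩ := mem_wp.1 hm r mr t s hr hs
  refine ⟨fun hi => ?_, fun a e' s' hst => ?_⟩
  · obtain ⟨v, hv, hQ⟩ := h₁ hi
    exact ⟨v, hv, h v w hw hQ⟩
  · obtain ⟨w', hw', m', mr', h₃, h₄, h₅⟩ := h₂ a e' s' hst
    exact ⟨w', hw', m', mr', h₃, h₄, .inl ⟨hw.trans hw', h₅⟩⟩

theorem wp_frame {Q : Val → World → Set Res} {R : AProp} {Q' : Val → World → Set Res}
    (hQ' : ∀ v w m₁ m₂ m, m₁ ∈ Q v w → m₂ ∈ R.sat w → Res.mul m₁ m₂ = some m → m ∈ Q' v w)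
    {e : Expr} {w : World} {m₁ m₂ m : Res} (h₁ : m₁ ∈ wp Q e w) (h₂ : m₂ ∈ R.sat w)
    (hm : Res.mul m₁ m₂ = some m) : m ∈ wp Q' e w := by
  refine mem_wp_of_coind
    (fun e w => {m | ∃ m₁ m₂, m₁ ∈ wp Q e w ∧ m₂ ∈ R.sat w ∧ Res.mul m₁ m₂ = some m}) ?_
    ⟨m₁, m₂, h₁, h₂, hm⟩
  rintro e w m ⟨m₁, m₂, h₁, h₂, hm⟩ r mr t s hr hs
  obtain ⟨r', hr', hmr⟩ := Res.mul_assoc hm hr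
  obtain ⟨h₃, h₄⟩ := mem_wp.1 h₁ r' mr t s hmr hs
  refine ⟨fun hi => ?_, fun a e' s' hst => ?_⟩
  · obtain ⟨v, hv, hQ⟩ := h₃ hi
    exact ⟨v, hv, hQ' v w m₁ m₂ m hQ h₂ hm⟩
  · obtain ⟨w', hw', m', mr', h₅, h₆, h₇⟩ := h₄ a e' s' hst
    obtain ⟨x, hx, hx'⟩ := Res.mul_assoc' hr' h₅
    exact ⟨w', hw', x, mr', hx', h₆, .inl ⟨m', m₂, h₇, R.mono hw' h₂, hx⟩⟩

theorem wp_bind {Q R : Val → World → Set Res} {K : ECtx} {w₀ : World}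
    (h : ∀ v w, w₀.Le w → Q v w ⊆ wp R (K.fill v.toExpr) w) {e : Expr} {w : World} {m : Res}
    (hw : w₀.Le w) (hm : m ∈ wp Q e w) : m ∈ wp R (K.fill e) w := by
  refine mem_wp_of_coind
    (fun e' w => {m | ∃ e, e' = K.fill e ∧ w₀.Le w ∧ m ∈ wp Q e w}) ?_ ⟨e, rfl, hw, hm⟩
  rintro _ w m ⟨e, rfl, hw, hm⟩ r mr t s hr hs
  obtain ⟨h₁, h₂⟩ := mem_wp.1 hm r mr t s hr hs
  by_cases he : Irreducible e s
  · obtain ⟨v, rfl, hQ⟩ := h₁ he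
    exact wpStep_mono R le_sup_right _ _ (mem_wp.1 (h v w hw hQ)) r mr t s hr hs
  · have he' : ¬ e.IsVal := fun ⟨v, hv⟩ => he (hv ▸ v.irreducible s)
    refine ⟨fun hi => (he fun ⟨a, e', s', hst⟩ => hi ⟨a, _, s', hst.fill K⟩).elim,
      fun a e₁ s' hst => ?_⟩
    obtain ⟨e', rfl, hst'⟩ := hst.of_fill he'
    obtain ⟨w', hw', m', mr', h₃, h₄, h₅⟩ := h₂ a e' s' hst'
    exact ⟨w', hw', m', mr', h₃, h₄, .inl ⟨e', rfl, hw.trans hw', h₅⟩⟩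

/-- A head reduction, for each state described by the resource. -/
theorem mem_wp_of_headStep {Q : Val → World → Set Res} {e : Expr} {w : World} {m : Res}
    (h : ∀ (r mr : Res) (t : Trace) (s : State), Res.mul m r = some mr → Erases t s w mr →
      (∃ a e' s', HeadStep e s a e' s') ∧ ∀ a e' s', HeadStep e s a e' s' →
        ∃ w' : World, w.Le w' ∧ ∃ m' mr' : Res, Res.mul m' r = some mr' ∧
          Erases (t ++ a.toList) s' w' mr' ∧ m' ∈ wp Q e' w') :
    m ∈ wp Q e w := by
  refine mem_wp.2 fun r mr t s hr hs => ?_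
  obtain ⟨⟨a, e', s', h₁⟩, h₂⟩ := h r mr t s hr hs
  exact ⟨fun hi => (hi ⟨a, e', s', h₁.step⟩).elim,
    fun a e' s' hst => h₂ a e' s' (hst.head_of_flat h₁.flat)⟩

/-- A head reduction that changes neither the state nor the trace. -/
theorem mem_wp_of_pure {Q : Val → World → Set Res} {e e' : Expr} {w : World} {m : Res}
    (h₁ : ∀ s : State, s.2 = w.env → HeadStep e s none e' s)
    (h₂ : ∀ (s : State) a e'' s', s.2 = w.env → HeadStep e s a e'' s' →
      a = none ∧ e'' = e' ∧ s' = s)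
    (hm : m ∈ wp Q e' w) : m ∈ wp Q e w := by
  refine mem_wp_of_headStep fun r mr t s hr hs => ⟨⟨_, _, _, h₁ s hs.2.2.1⟩, fun a e'' s' hst => ?_⟩
  obtain ⟨rfl, rfl, rfl⟩ := h₂ s a e'' s' hs.2.2.1 hst
  exact ⟨w, .refl w, m, mr, hr, by simpa using hs, hm⟩

theorem wp_app {Q : Val → World → Set Res} {f : Fun} {v : Val} {b : Expr} {w : World} {m : Res}
    (hf : w.env.lookup f = some ⟨b⟩) (hm : m ∈ wp Q (b.inst v) w) :
    m ∈ wp Q (.app (.fn f) v.toExpr) w := by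
  refine mem_wp_of_pure ?_ ?_ hm
  · rintro ⟨h, γ⟩ rfl
    exact .app f v b h _ hf
  · intro s a e'' s' hs hst
    generalize he : Expr.app (.fn f) v.toExpr = e at hst
    cases hst <;> simp only [Expr.app.injEq, Expr.fn.injEq, reduceCtorEq] at he
    rename_i f' v' e' h γ hf'
    obtain ⟨rfl, he⟩ := he
    obtain rfl := Val.toExpr_injective he
    simp only at hs
    subst hs
    rw [hf] at hf'
    cases hf'
    exact ⟨rfl, rfl, rfl⟩

theorem wp_proj {Q : Val → World → Set Res} {i : Side} {v₁ v₂ : Val} {w : World} {m : Res}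
    (hm : m ∈ Q (match i with | .one => v₁ | .two => v₂) w) :
    m ∈ wp Q (.proj i (.pair v₁.toExpr v₂.toExpr)) w := by
  refine mem_wp_of_pure (fun s _ => ?_) (fun s a e'' s' _ hst => ?_) (mem_wp_val hm)
  · cases i
    exacts [.proj₁ v₁ v₂ s, .proj₂ v₁ v₂ s]
  · generalize he : Expr.proj i (.pair v₁.toExpr v₂.toExpr) = e at hst
    cases hst <;> simp only [Expr.proj.injEq, Expr.pair.injEq, Val.toExpr_injective.eq_iff,
      reduceCtorEq] at he <;>
    · obtain ⟨rfl, rfl, rfl⟩ := he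
      exact ⟨rfl, rfl, rfl⟩

theorem wp_iteTrue {Q : Val → World → Set Res} {n : ℤ} {e₁ e₂ : Expr} {w : World} {m : Res}
    (hn : 0 < n) (hm : m ∈ wp Q e₁ w) : m ∈ wp Q (.ite (.int n) e₁ e₂) w := by
  refine mem_wp_of_pure (fun s _ => .iteTrue n e₁ e₂ s hn) (fun s a e'' s' _ hst => ?_) hm
  cases hst
  · exact ⟨rfl, rfl, rfl⟩
  · exact absurd hn (lt_irrefl _)

theorem wp_iteFalse {Q : Val → World → Set Res} {e₁ e₂ : Expr} {w : World} {m : Res}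
    (hm : m ∈ wp Q e₂ w) : m ∈ wp Q (.ite (.int 0) e₁ e₂) w := by
  refine mem_wp_of_pure (fun s _ => .iteFalse e₁ e₂ s) (fun s a e'' s' _ hst => ?_) hm
  cases hst
  · rename_i hn
    exact absurd hn (lt_irrefl _)
  · exact ⟨rfl, rfl, rfl⟩

theorem wp_binop {Q : Val → World → Set Res} {o : BinOp} {u v r : Val} {w : World} {m : Res}
    (hr : o.eval u v = some r) (hm : m ∈ Q r w) : m ∈ wp Q (.binop o u.toExpr v.toExpr) w := by
  refine mem_wp_of_pure (fun s _ => .binop o u v r s hr) (fun s a e'' s' _ hst => ?_)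
    (mem_wp_val hm)
  generalize he : Expr.binop o u.toExpr v.toExpr = e at hst
  cases hst <;> simp only [Expr.binop.injEq, Val.toExpr_injective.eq_iff, reduceCtorEq] at he
  · obtain ⟨rfl, -⟩ := he
    simp [BinOp.eval] at hr
  · obtain ⟨rfl, rfl, rfl⟩ := he
    rename_i h
    rw [hr] at h
    cases h
    exact ⟨rfl, rfl, rfl⟩

theorem exists_notMem_finmap {β : ℕ → Type} (h : Finmap β) : ∃ l, l ∉ h := by
  obtain ⟨l, hl⟩ := Infinite.exists_notMem_finset h.keys
  exact ⟨l, fun h' => hl (Finmap.mem_keys.2 h')⟩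

theorem wp_lam {Q : Val → World → Set Res} {e : Expr} {w : World} {m : Res}
    (hm : ∀ (f : Fun) (w' : World), w.Le w' → w'.env.lookup f = some ⟨e⟩ → m ∈ Q (.fn f) w') :
    m ∈ wp Q (.lam e) w := by
  refine mem_wp_of_headStep fun r mr t s hr hs => ⟨?_, fun a e' s' hst => ?_⟩
  · obtain ⟨f, hf⟩ := exists_notMem_finmap s.2
    exact ⟨_, _, _, .lam e s.1 s.2 f hf⟩
  · obtain ⟨ht, hs₁, hs₂, hI⟩ := hs
    cases hst
    rename_i h γ f hf
    simp only at hs₁ hs₂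
    subst hs₂
    have hw : w.Le ⟨w.env.insert f ⟨e⟩, w.inv⟩ := by
      refine ⟨fun f' b hb => ?_, rfl⟩
      have : f' ≠ f := by
        rintro rfl
        exact hf (Finmap.mem_of_lookup_eq_some hb)
      simpa [Finmap.lookup_insert_of_ne _ this] using hb
    refine ⟨_, hw, m, mr, hr, ⟨?_, hs₁, rfl, by simpa using hI⟩,
      mem_wp_val (v := .fn f) (hm f _ hw (Finmap.lookup_insert _))⟩
    simpa using ht

theorem heapMul_insert {h r hr : Heap} {l : Loc} (v : Val) (h₁ : heapMul h r = some hr)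
    (hl : l ∉ r) : heapMul (h.insert l v) r = some (hr.insert l v) := by
  rw [heapMul_eq_some] at h₁ ⊢
  refine ⟨fun x hx hx' => ?_, by rw [← Finmap.insert_union, h₁.2]⟩
  rw [Finmap.mem_insert] at hx
  rcases hx with rfl | hx
  · exact hl hx'
  · exact h₁.1 x hx hx'

theorem wp_ref {Q : Val → World → Set Res} {v : Val} {w : World} {m : Res}
    (hm : ∀ l, (m.1.insert l v, m.2) ∈ Q (.loc l) w) : m ∈ wp Q (.ref v.toExpr) w := by
  refine mem_wp_of_headStep fun r mr t s hr hs => ⟨?_, fun a e' s' hst => ?_⟩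
  · obtain ⟨l, hl⟩ := exists_notMem_finmap s.1
    exact ⟨_, _, _, .ref v s.1 s.2 l hl⟩
  · obtain ⟨ht, hs₁, hs₂, hI⟩ := hs
    generalize he : Expr.ref v.toExpr = e at hst
    cases hst <;> simp only [Expr.ref.injEq, Val.toExpr_injective.eq_iff, reduceCtorEq] at he
    subst he
    rename_i h γ l hl
    simp only at hs₁ hs₂
    subst hs₁
    obtain ⟨h₁, h₂⟩ := Res.mul_eq_some.1 hr
    have hlr : l ∉ r.1 := by
      rw [heapMul_eq_some] at h₁
      rw [← h₁.2] at hl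
      exact fun h => hl (Finmap.mem_union.2 (.inr h))
    exact ⟨w, .refl w, (m.1.insert l v, m.2), (mr.1.insert l v, mr.2),
      Res.mul_eq_some.2 ⟨heapMul_insert v h₁ hlr, h₂⟩, ⟨by simpa using ht, rfl, hs₂, by simpa using hI⟩,
      mem_wp_val (v := .loc l) (hm l)⟩

theorem wp_deref {Q : Val → World → Set Res} {l : Loc} {v : Val} {w : World} {m : Res}
    (hl : m.1.lookup l = some v) (hm : m ∈ Q v w) : m ∈ wp Q (.deref (.loc l)) w := by
  refine mem_wp_of_headStep fun r mr t s hr hs => ?_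
  have hl' : s.1.lookup l = some v := by
    rw [hs.2.1]
    exact (Res.le_mul_left hr).lookup hl
  refine ⟨⟨_, _, _, .deref l v s.1 s.2 hl'⟩, fun a e' s' hst => ?_⟩
  cases hst
  rename_i v' h γ hv
  simp only at hl'
  rw [hl'] at hv
  cases hv
  exact ⟨w, .refl w, m, mr, hr, by simpa using hs, mem_wp_val hm⟩

theorem wp_assign {Q : Val → World → Set Res} {l : Loc} {u v : Val} {w : World} {m : Res}
    (hl : m.1.lookup l = some u) (hm : (m.1.insert l v, m.2) ∈ Q .unit w) :
    m ∈ wp Q (.binop .assign (.loc l) v.toExpr) w := by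
  refine mem_wp_of_headStep fun r mr t s hr hs => ?_
  have hl' : l ∈ s.1 := by
    rw [hs.2.1]
    exact Finmap.mem_of_lookup_eq_some ((Res.le_mul_left hr).lookup hl)
  refine ⟨⟨_, _, _, .assign l v s.1 s.2 hl'⟩, fun a e' s' hst => ?_⟩
  obtain ⟨ht, hs₁, hs₂, hI⟩ := hs
  generalize he : Expr.binop .assign (.loc l) v.toExpr = e at hst
  cases hst <;> simp only [Expr.binop.injEq, Expr.loc.injEq, Val.toExpr_injective.eq_iff,
    reduceCtorEq] at he
  · obtain ⟨-, rfl, rfl⟩ := he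
    rename_i h γ hl
    simp only at hs₁ hs₂
    subst hs₁
    obtain ⟨h₁, h₂⟩ := Res.mul_eq_some.1 hr
    have hlr : l ∉ r.1 :=
      (heapMul_eq_some.1 h₁).1 l (Finmap.mem_of_lookup_eq_some ‹m.1.lookup l = some u›)
    exact ⟨w, .refl w, (m.1.insert l v, m.2), (mr.1.insert l v, mr.2),
      Res.mul_eq_some.2 ⟨heapMul_insert v h₁ hlr, h₂⟩, ⟨by simpa using ht, rfl, hs₂, by simpa using hI⟩,
      mem_wp_val (v := .unit) hm⟩
  · rename_i h
    obtain ⟨rfl, -⟩ := he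
    simp [BinOp.eval] at h

theorem wp_emit {Q : Val → World → Set Res} {t : Trace} {v : Val} {w : World} {m : Res}
    (ht : m.2 = (.full, t)) (hI : t ++ [v] ∈ w.inv)
    (hm : (m.1, (Tag.full, t ++ [v])) ∈ Q .unit w) : m ∈ wp Q (.emit v) w := by
  refine mem_wp_of_headStep fun r mr t' s hr hs => ⟨⟨_, _, _, .emit v s⟩, fun a e' s' hst => ?_⟩
  cases hst
  obtain ⟨h₁, h₂⟩ := Res.mul_eq_some.1 hr
  rw [ht] at h₂
  obtain ⟨t₁, hr₂, ht₁, hmr⟩ := TraceRes.mul_full h₂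
  obtain ⟨ht', hs₁, hs₂, -⟩ := hs
  rw [hmr] at ht'
  simp only at ht'
  subst ht'
  refine ⟨w, .refl w, (m.1, (.full, t' ++ [v])), (mr.1, (.full, t' ++ [v])),
    Res.mul_eq_some.2 ⟨h₁, ?_⟩, ⟨rfl, hs₁, hs₂, hI⟩, mem_wp_val (v := .unit) hm⟩
  rw [hr₂]
  exact TraceRes.mul_hist (ht₁.trans (List.prefix_append _ _))

/-! ## Renaming and substitution of terms -/

theorem Env.cons_lift {Γ Δ : Ctx} {σ : Ty} (r : Ren Γ Δ) (ρ : Env Δ) (v : σ.Den) :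
    (fun τ x => ρ.cons v τ (r.lift τ x)) = Env.cons (fun τ x => ρ τ (r τ x)) v := by
  funext τ x
  cases x <;> rfl

mutual

theorem Tm.den_rename : {Γ Δ : Ctx} → {τ : Ty} → (r : Ren Γ Δ) → (M : Tm Γ τ) → (ρ : Env Δ) →
    (M.rename r).den ρ = M.den fun τ x => ρ τ (r τ x)
  | _, _, _, r, .var x, ρ => by simp only [Tm.rename, Tm.den]
  | _, _, _, r, .lam M, ρ => by
    simp only [Tm.rename, Tm.den, Tm.den_rename r.lift M, Env.cons_lift]
  | _, _, _, r, .app M N, ρ => by simp only [Tm.rename, Tm.den, Tm.den_rename r M, Tm.den_rename r N]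
  | _, _, _, r, .unit, ρ => by simp only [Tm.rename, Tm.den]
  | _, _, _, r, .pair M N, ρ => by
    simp only [Tm.rename, Tm.den, Tm.den_rename r M, Tm.den_rename r N]
  | _, _, _, r, .fst M, ρ => by simp only [Tm.rename, Tm.den, Tm.den_rename r M]
  | _, _, _, r, .snd M, ρ => by simp only [Tm.rename, Tm.den, Tm.den_rename r M]
  | _, _, _, r, .bot k, ρ => by simp only [Tm.rename, Tm.den]
  | _, _, _, r, .top k, ρ => by simp only [Tm.rename, Tm.den]
  | _, _, _, r, .or k P Q, ρ => by
    simp only [Tm.rename, Tm.den, Tm.den_rename r P, Tm.den_rename r Q]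
  | _, _, _, r, .and k P Q, ρ => by
    simp only [Tm.rename, Tm.den, Tm.den_rename r P, Tm.den_rename r Q]
  | _, _, _, r, .imp k P Q, ρ => by
    simp only [Tm.rename, Tm.den, Tm.den_rename r P, Tm.den_rename r Q]
  | _, _, _, r, .all k τ P, ρ => by
    simp only [Tm.rename, Tm.den, Tm.den_rename r.lift P, Env.cons_lift]
  | _, _, _, r, .ex k τ P, ρ => by
    simp only [Tm.rename, Tm.den, Tm.den_rename r.lift P, Env.cons_lift]
  | _, _, _, r, .eq k M N, ρ => by
    simp only [Tm.rename, Tm.den, Tm.den_rename r M, Tm.den_rename r N]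
  | _, _, _, r, .true, ρ => by simp only [Tm.rename, Tm.den]
  | _, _, _, r, .false, ρ => by simp only [Tm.rename, Tm.den]
  | _, _, _, r, .ite M N₁ N₂, ρ => by
    simp only [Tm.rename, Tm.den, Tm.den_rename r M, Tm.den_rename r N₁, Tm.den_rename r N₂]
  | _, _, _, r, .zero, ρ => by simp only [Tm.rename, Tm.den]
  | _, _, _, r, .succ M, ρ => by simp only [Tm.rename, Tm.den, Tm.den_rename r M]
  | _, _, _, r, .valid P, ρ => by simp only [Tm.rename, Tm.den, Tm.den_rename r P]
  | _, _, _, r, .emp, ρ => by simp only [Tm.rename, Tm.den]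
  | _, _, _, r, .sep P Q, ρ => by simp only [Tm.rename, Tm.den, Tm.den_rename r P, Tm.den_rename r Q]
  | _, _, _, r, .wand P Q, ρ => by
    simp only [Tm.rename, Tm.den, Tm.den_rename r P, Tm.den_rename r Q]
  | _, _, _, r, .pointsTo M N, ρ => by
    simp only [Tm.rename, Tm.den, Tm.den_rename r M, Tm.den_rename r N]
  | _, _, _, r, .hoare P M Q, ρ => by
    simp only [Tm.rename, Tm.den, Tm.den_rename r P, Tm.den_rename r M, Tm.den_rename r Q]
  | _, _, _, r, .spec M, ρ => by simp only [Tm.rename, Tm.den, Tm.den_rename r M]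
  | _, _, _, r, .nil τ, ρ => by simp only [Tm.rename, Tm.den]
  | _, _, _, r, .cons M N, ρ => by
    simp only [Tm.rename, Tm.den, Tm.den_rename r M, Tm.den_rename r N]
  | _, _, _, r, .fold M N₁ N₂, ρ => by
    simp only [Tm.rename, Tm.den, Tm.den_rename r M, Tm.den_rename r N₁, Tm.den_rename r N₂]
  | _, _, _, r, .trace t, ρ => by simp only [Tm.rename, Tm.den, Tm.den_rename r t]
  | _, _, _, r, .hist t, ρ => by simp only [Tm.rename, Tm.den, Tm.den_rename r t]
  | _, _, _, r, .inv I, ρ => by simp only [Tm.rename, Tm.den, Tm.den_rename r I]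
  | _, _, _, r, .val v, ρ => by simp only [Tm.rename, Tm.den, PVal.den_rename r v]
  | _, _, _, r, .exp e, ρ => by simp only [Tm.rename, Tm.den, PExp.den_rename r e]
  | _, _, _, r, .locVal M, ρ => by simp only [Tm.rename, Tm.den, Tm.den_rename r M]
  | _, _, _, r, .natVal M, ρ => by simp only [Tm.rename, Tm.den, Tm.den_rename r M]

theorem PVal.den_rename : {Γ Δ : Ctx} → {n : ℕ} → (r : Ren Γ Δ) → (v : PVal Γ n) → (ρ : Env Δ) →
    (v.rename r).den ρ = v.den fun τ x => ρ τ (r τ x)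
  | _, _, _, r, .bvar i, ρ => by simp only [PVal.rename, PVal.den]
  | _, _, _, r, .term M, ρ => by simp only [PVal.rename, PVal.den, Tm.den_rename r M]
  | _, _, _, r, .unit, ρ => by simp only [PVal.rename, PVal.den]
  | _, _, _, r, .int k, ρ => by simp only [PVal.rename, PVal.den]
  | _, _, _, r, .loc l, ρ => by simp only [PVal.rename, PVal.den]
  | _, _, _, r, .fn f, ρ => by simp only [PVal.rename, PVal.den]
  | _, _, _, r, .pair u v, ρ => by
    simp only [PVal.rename, PVal.den, PVal.den_rename r u, PVal.den_rename r v]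

theorem PExp.den_rename : {Γ Δ : Ctx} → {n : ℕ} → (r : Ren Γ Δ) → (e : PExp Γ n) → (ρ : Env Δ) →
    (e.rename r).den ρ = e.den fun τ x => ρ τ (r τ x)
  | _, _, _, r, .bvar i, ρ => by simp only [PExp.rename, PExp.den]
  | _, _, _, r, .valTerm M, ρ => by simp only [PExp.rename, PExp.den, Tm.den_rename r M]
  | _, _, _, r, .expTerm M, ρ => by simp only [PExp.rename, PExp.den, Tm.den_rename r M]
  | _, _, _, r, .unit, ρ => by simp only [PExp.rename, PExp.den]
  | _, _, _, r, .int k, ρ => by simp only [PExp.rename, PExp.den]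
  | _, _, _, r, .loc l, ρ => by simp only [PExp.rename, PExp.den]
  | _, _, _, r, .fn f, ρ => by simp only [PExp.rename, PExp.den]
  | _, _, _, r, .lam e, ρ => by simp only [PExp.rename, PExp.den, PExp.den_rename r e]
  | _, _, _, r, .app e e', ρ => by
    simp only [PExp.rename, PExp.den, PExp.den_rename r e, PExp.den_rename r e']
  | _, _, _, r, .ite e e₁ e₂, ρ => by
    simp only [PExp.rename, PExp.den, PExp.den_rename r e, PExp.den_rename r e₁,
      PExp.den_rename r e₂]
  | _, _, _, r, .pair e e', ρ => by
    simp only [PExp.rename, PExp.den, PExp.den_rename r e, PExp.den_rename r e']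
  | _, _, _, r, .proj i e, ρ => by simp only [PExp.rename, PExp.den, PExp.den_rename r e]
  | _, _, _, r, .ref e, ρ => by simp only [PExp.rename, PExp.den, PExp.den_rename r e]
  | _, _, _, r, .deref e, ρ => by simp only [PExp.rename, PExp.den, PExp.den_rename r e]
  | _, _, _, r, .binop o e e', ρ => by
    simp only [PExp.rename, PExp.den, PExp.den_rename r e, PExp.den_rename r e']
  | _, _, _, r, .emit v, ρ => by simp only [PExp.rename, PExp.den, PVal.den_rename r v]

end

/-- `σ` is the interpretation of the substitution `s` of program values. -/
structure ProgSubstDen {Γ : Ctx} {n m : ℕ} (s : Fin n → PVal Γ m) (ρ : Env Γ) (σ : ℕ → Val) :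
    Prop where
  bound : ∀ i : Fin n, σ i = (s i).den ρ
  free : ∀ x : ℕ, σ (x + n) = .var (x + m)

theorem PVal.den_progSubst {Γ : Ctx} {n m : ℕ} {s : Fin n → PVal Γ m} {ρ : Env Γ} {σ : ℕ → Val}
    (h : ProgSubstDen s ρ σ) : (v : PVal Γ n) → (v.progSubst s).den ρ = (v.den ρ).subst σ
  | .bvar i => by simp only [PVal.progSubst, PVal.den, Val.subst, h.bound]
  | .term M => by
    simp only [PVal.progSubst, PVal.den, Val.subst_rename, h.free, Val.rename_eq_subst (· + m)]
  | .unit | .int k | .loc l | .fn f => by simp only [PVal.progSubst, PVal.den, Val.subst]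
  | .pair u v => by
    simp only [PVal.progSubst, PVal.den, Val.subst, PVal.den_progSubst h u, PVal.den_progSubst h v]

theorem PVal.den_toPExp {Γ : Ctx} {n : ℕ} (ρ : Env Γ) :
    (v : PVal Γ n) → v.toPExp.den ρ = (v.den ρ).toExpr
  | .bvar _ | .term _ | .unit | .int _ | .loc _ | .fn _ => by
    simp only [PVal.toPExp, PExp.den, PVal.den, Val.toExpr]
  | .pair u v => by
    simp only [PVal.toPExp, PExp.den, PVal.den, Val.toExpr, PVal.den_toPExp ρ u,
      PVal.den_toPExp ρ v]

theorem ProgSubstDen.lift {Γ : Ctx} {n m : ℕ} {s : Fin n → PVal Γ m} {ρ : Env Γ} {σ : ℕ → Val}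
    (h : ProgSubstDen s ρ σ) : ProgSubstDen (liftProg s) ρ (liftSubst σ) where
  bound i := by
    refine Fin.cases ?_ (fun i => ?_) i
    · simp [liftProg, liftSubst, PVal.den]
    · have h' : ProgSubstDen (fun j : Fin m => (.bvar j.succ : PVal Γ (m + 1))) ρ
          (fun x => .var (x + 1)) := ⟨fun i => by simp [PVal.den], fun x => by simp [add_assoc]⟩
      simp [liftProg, liftSubst, PVal.den_progSubst h', h.bound, Val.rename_eq_subst]
  free x := by
    change (σ (x + n)).rename Nat.succ = _
    rw [h.free]
    rfl

theorem PExp.den_progSubst : {Γ : Ctx} → {n m : ℕ} → {s : Fin n → PVal Γ m} → {ρ : Env Γ} →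
    {σ : ℕ → Val} → ProgSubstDen s ρ σ → (e : PExp Γ n) →
    (e.progSubst s).den ρ = (e.den ρ).subst σ
  | _, _, _, _, _, _, h, .bvar i => by
    simp only [PExp.progSubst, PExp.den, Expr.subst, h.bound, PVal.den_toPExp]
  | _, _, m, _, _, _, h, .valTerm M => by
    simp only [PExp.progSubst, PExp.den, ← Val.toExpr_subst, Val.subst_rename, h.free,
      Val.rename_eq_subst (· + m)]
  | _, _, m, _, _, _, h, .expTerm M => by
    simp only [PExp.progSubst, PExp.den, Expr.subst_rename, h.free, Expr.rename_eq_subst (· + m)]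
  | _, _, _, _, _, _, _, .unit => by simp only [PExp.progSubst, PExp.den, Expr.subst]
  | _, _, _, _, _, _, _, .int _ => by simp only [PExp.progSubst, PExp.den, Expr.subst]
  | _, _, _, _, _, _, _, .loc _ => by simp only [PExp.progSubst, PExp.den, Expr.subst]
  | _, _, _, _, _, _, _, .fn _ => by simp only [PExp.progSubst, PExp.den, Expr.subst]
  | _, _, _, _, _, _, h, .lam e => by
    simp only [PExp.progSubst, PExp.den, Expr.subst, PExp.den_progSubst h.lift e]
  | _, _, _, _, _, _, h, .app e e' => by
    simp only [PExp.progSubst, PExp.den, Expr.subst, PExp.den_progSubst h e,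
      PExp.den_progSubst h e']
  | _, _, _, _, _, _, h, .ite e e₁ e₂ => by
    simp only [PExp.progSubst, PExp.den, Expr.subst, PExp.den_progSubst h e,
      PExp.den_progSubst h e₁, PExp.den_progSubst h e₂]
  | _, _, _, _, _, _, h, .pair e e' => by
    simp only [PExp.progSubst, PExp.den, Expr.subst, PExp.den_progSubst h e,
      PExp.den_progSubst h e']
  | _, _, _, _, _, _, h, .proj i e => by
    simp only [PExp.progSubst, PExp.den, Expr.subst, PExp.den_progSubst h e]
  | _, _, _, _, _, _, h, .ref e => by
    simp only [PExp.progSubst, PExp.den, Expr.subst, PExp.den_progSubst h e]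
  | _, _, _, _, _, _, h, .deref e => by
    simp only [PExp.progSubst, PExp.den, Expr.subst, PExp.den_progSubst h e]
  | _, _, _, _, _, _, h, .binop o e e' => by
    simp only [PExp.progSubst, PExp.den, Expr.subst, PExp.den_progSubst h e,
      PExp.den_progSubst h e']
  | _, _, _, _, _, _, h, .emit v => by
    simp only [PExp.progSubst, PExp.den, Expr.subst, PVal.den_progSubst h v]

theorem progSubstDen_elim0 {Γ : Ctx} (n : ℕ) (ρ : Env Γ) :
    ProgSubstDen (Fin.elim0 : Fin 0 → PVal Γ n) ρ fun x => .var (x + n) :=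
  ⟨fun i => i.elim0, fun _ => rfl⟩

theorem PVal.den_ofTm {Γ : Ctx} {n : ℕ} (M : Tm Γ .val) (ρ : Env Γ) :
    (PVal.ofTm M : PVal Γ n).den ρ = (M.den ρ).rename (· + n) := by
  unfold PVal.ofTm
  split
  · rw [PVal.den_progSubst (progSubstDen_elim0 n ρ), Val.rename_eq_subst, Tm.den]
  · rw [PVal.den]

theorem PExp.den_ofVal {Γ : Ctx} {n : ℕ} (M : Tm Γ .val) (ρ : Env Γ) :
    (PExp.ofVal M : PExp Γ n).den ρ = ((M.den ρ).rename (· + n)).toExpr := by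
  unfold PExp.ofVal
  split
  · rw [PVal.den_toPExp, PVal.den_progSubst (progSubstDen_elim0 n ρ), Val.rename_eq_subst, Tm.den]
  · rw [PExp.den]

theorem PExp.den_ofExp {Γ : Ctx} {n : ℕ} (M : Tm Γ .exp) (ρ : Env Γ) :
    (PExp.ofExp M : PExp Γ n).den ρ = (M.den ρ).rename (· + n) := by
  unfold PExp.ofExp
  split
  · rw [PExp.den_progSubst (progSubstDen_elim0 n ρ), Expr.rename_eq_subst, Tm.den]
  · rw [PExp.den]

theorem PVal.den_toTm {Γ : Ctx} (v : PVal Γ 0) (ρ : Env Γ) : v.toTm.den ρ = v.den ρ := by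
  unfold PVal.toTm
  split
  · rw [PVal.den]
    exact (Val.rename_id _).symm
  · rw [Tm.den]

theorem PExp.den_toTm {Γ : Ctx} (e : PExp Γ 0) (ρ : Env Γ) : e.toTm.den ρ = e.den ρ := by
  unfold PExp.toTm
  split
  · rw [PExp.den]
    exact (Expr.rename_id _).symm
  · rw [Tm.den]

theorem Env.cons_substLift {Γ Δ : Ctx} {σ : Ty} (s : Sub Γ Δ) (ρ : Env Δ) (v : σ.Den) :
    (fun τ x => (s.lift τ x).den (ρ.cons v)) = Env.cons (fun τ x => (s τ x).den ρ) v := by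
  funext τ x
  cases x with
  | zero => simp only [Sub.lift, Tm.den, Env.cons]
  | succ x => simp only [Sub.lift, Tm.den_rename, Ren.wk, Env.cons]

mutual

theorem Tm.den_subst : {Γ Δ : Ctx} → {τ : Ty} → (s : Sub Γ Δ) → (M : Tm Γ τ) → (ρ : Env Δ) →
    (M.subst s).den ρ = M.den fun τ x => (s τ x).den ρ
  | _, _, _, s, .var x, ρ => by simp only [Tm.subst, Tm.den]
  | _, _, _, s, .lam M, ρ => by
    simp only [Tm.subst, Tm.den, Tm.den_subst s.lift M, Env.cons_substLift]
  | _, _, _, s, .app M N, ρ => by simp only [Tm.subst, Tm.den, Tm.den_subst s M, Tm.den_subst s N]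
  | _, _, _, s, .unit, ρ => by simp only [Tm.subst, Tm.den]
  | _, _, _, s, .pair M N, ρ => by
    simp only [Tm.subst, Tm.den, Tm.den_subst s M, Tm.den_subst s N]
  | _, _, _, s, .fst M, ρ => by simp only [Tm.subst, Tm.den, Tm.den_subst s M]
  | _, _, _, s, .snd M, ρ => by simp only [Tm.subst, Tm.den, Tm.den_subst s M]
  | _, _, _, s, .bot k, ρ => by simp only [Tm.subst, Tm.den]
  | _, _, _, s, .top k, ρ => by simp only [Tm.subst, Tm.den]
  | _, _, _, s, .or k P Q, ρ => by
    simp only [Tm.subst, Tm.den, Tm.den_subst s P, Tm.den_subst s Q]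
  | _, _, _, s, .and k P Q, ρ => by
    simp only [Tm.subst, Tm.den, Tm.den_subst s P, Tm.den_subst s Q]
  | _, _, _, s, .imp k P Q, ρ => by
    simp only [Tm.subst, Tm.den, Tm.den_subst s P, Tm.den_subst s Q]
  | _, _, _, s, .all k τ P, ρ => by
    simp only [Tm.subst, Tm.den, Tm.den_subst s.lift P, Env.cons_substLift]
  | _, _, _, s, .ex k τ P, ρ => by
    simp only [Tm.subst, Tm.den, Tm.den_subst s.lift P, Env.cons_substLift]
  | _, _, _, s, .eq k M N, ρ => by
    simp only [Tm.subst, Tm.den, Tm.den_subst s M, Tm.den_subst s N]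
  | _, _, _, s, .true, ρ => by simp only [Tm.subst, Tm.den]
  | _, _, _, s, .false, ρ => by simp only [Tm.subst, Tm.den]
  | _, _, _, s, .ite M N₁ N₂, ρ => by
    simp only [Tm.subst, Tm.den, Tm.den_subst s M, Tm.den_subst s N₁, Tm.den_subst s N₂]
  | _, _, _, s, .zero, ρ => by simp only [Tm.subst, Tm.den]
  | _, _, _, s, .succ M, ρ => by simp only [Tm.subst, Tm.den, Tm.den_subst s M]
  | _, _, _, s, .valid P, ρ => by simp only [Tm.subst, Tm.den, Tm.den_subst s P]
  | _, _, _, s, .emp, ρ => by simp only [Tm.subst, Tm.den]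
  | _, _, _, s, .sep P Q, ρ => by simp only [Tm.subst, Tm.den, Tm.den_subst s P, Tm.den_subst s Q]
  | _, _, _, s, .wand P Q, ρ => by
    simp only [Tm.subst, Tm.den, Tm.den_subst s P, Tm.den_subst s Q]
  | _, _, _, s, .pointsTo M N, ρ => by
    simp only [Tm.subst, Tm.den, Tm.den_subst s M, Tm.den_subst s N]
  | _, _, _, s, .hoare P M Q, ρ => by
    simp only [Tm.subst, Tm.den, Tm.den_subst s P, Tm.den_subst s M, Tm.den_subst s Q]
  | _, _, _, s, .spec M, ρ => by simp only [Tm.subst, Tm.den, Tm.den_subst s M]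
  | _, _, _, s, .nil τ, ρ => by simp only [Tm.subst, Tm.den]
  | _, _, _, s, .cons M N, ρ => by
    simp only [Tm.subst, Tm.den, Tm.den_subst s M, Tm.den_subst s N]
  | _, _, _, s, .fold M N₁ N₂, ρ => by
    simp only [Tm.subst, Tm.den, Tm.den_subst s M, Tm.den_subst s N₁, Tm.den_subst s N₂]
  | _, _, _, s, .trace t, ρ => by simp only [Tm.subst, Tm.den, Tm.den_subst s t]
  | _, _, _, s, .hist t, ρ => by simp only [Tm.subst, Tm.den, Tm.den_subst s t]
  | _, _, _, s, .inv I, ρ => by simp only [Tm.subst, Tm.den, Tm.den_subst s I]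
  | _, _, _, s, .val v, ρ => by simp only [Tm.subst, Tm.den, PVal.den_toTm, PVal.den_subst s v]
  | _, _, _, s, .exp e, ρ => by simp only [Tm.subst, Tm.den, PExp.den_toTm, PExp.den_subst s e]
  | _, _, _, s, .locVal M, ρ => by simp only [Tm.subst, Tm.den, Tm.den_subst s M]
  | _, _, _, s, .natVal M, ρ => by simp only [Tm.subst, Tm.den, Tm.den_subst s M]

theorem PVal.den_subst : {Γ Δ : Ctx} → {n : ℕ} → (s : Sub Γ Δ) → (v : PVal Γ n) → (ρ : Env Δ) →
    (v.subst s).den ρ = v.den fun τ x => (s τ x).den ρ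
  | _, _, _, s, .bvar i, ρ => by simp only [PVal.subst, PVal.den]
  | _, _, _, s, .term M, ρ => by simp only [PVal.subst, PVal.den, PVal.den_ofTm, Tm.den_subst s M]
  | _, _, _, s, .unit, ρ => by simp only [PVal.subst, PVal.den]
  | _, _, _, s, .int k, ρ => by simp only [PVal.subst, PVal.den]
  | _, _, _, s, .loc l, ρ => by simp only [PVal.subst, PVal.den]
  | _, _, _, s, .fn f, ρ => by simp only [PVal.subst, PVal.den]
  | _, _, _, s, .pair u v, ρ => by
    simp only [PVal.subst, PVal.den, PVal.den_subst s u, PVal.den_subst s v]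

theorem PExp.den_subst : {Γ Δ : Ctx} → {n : ℕ} → (s : Sub Γ Δ) → (e : PExp Γ n) → (ρ : Env Δ) →
    (e.subst s).den ρ = e.den fun τ x => (s τ x).den ρ
  | _, _, _, s, .bvar i, ρ => by simp only [PExp.subst, PExp.den]
  | _, _, _, s, .valTerm M, ρ => by
    simp only [PExp.subst, PExp.den, PExp.den_ofVal, Tm.den_subst s M]
  | _, _, _, s, .expTerm M, ρ => by
    simp only [PExp.subst, PExp.den, PExp.den_ofExp, Tm.den_subst s M]
  | _, _, _, s, .unit, ρ => by simp only [PExp.subst, PExp.den]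
  | _, _, _, s, .int k, ρ => by simp only [PExp.subst, PExp.den]
  | _, _, _, s, .loc l, ρ => by simp only [PExp.subst, PExp.den]
  | _, _, _, s, .fn f, ρ => by simp only [PExp.subst, PExp.den]
  | _, _, _, s, .lam e, ρ => by simp only [PExp.subst, PExp.den, PExp.den_subst s e]
  | _, _, _, s, .app e e', ρ => by
    simp only [PExp.subst, PExp.den, PExp.den_subst s e, PExp.den_subst s e']
  | _, _, _, s, .ite e e₁ e₂, ρ => by
    simp only [PExp.subst, PExp.den, PExp.den_subst s e, PExp.den_subst s e₁,
      PExp.den_subst s e₂]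
  | _, _, _, s, .pair e e', ρ => by
    simp only [PExp.subst, PExp.den, PExp.den_subst s e, PExp.den_subst s e']
  | _, _, _, s, .proj i e, ρ => by simp only [PExp.subst, PExp.den, PExp.den_subst s e]
  | _, _, _, s, .ref e, ρ => by simp only [PExp.subst, PExp.den, PExp.den_subst s e]
  | _, _, _, s, .deref e, ρ => by simp only [PExp.subst, PExp.den, PExp.den_subst s e]
  | _, _, _, s, .binop o e e', ρ => by
    simp only [PExp.subst, PExp.den, PExp.den_subst s e, PExp.den_subst s e']
  | _, _, _, s, .emit v, ρ => by simp only [PExp.subst, PExp.den, PVal.den_subst s v]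

end

theorem Tm.den_wk {Γ : Ctx} {σ τ : Ty} (M : Tm Γ τ) (ρ : Env Γ) (v : σ.Den) :
    M.wk.den (ρ.cons v) = M.den ρ :=
  Tm.den_rename Ren.wk M _

theorem Tm.den_inst {Γ : Ctx} {σ τ : Ty} (M : Tm (σ :: Γ) τ) (N : Tm Γ σ) (ρ : Env Γ) :
    (M.inst N).den ρ = M.den (ρ.cons (N.den ρ)) := by
  rw [Tm.inst, Tm.den_subst]
  congr 1
  funext τ x
  cases x <;> simp only [Sub.inst, Tm.den, Env.cons]

theorem Tm.den_rename_wk_lift {Γ : Ctx} {σ τ υ : Ty} (M : Tm (σ :: Γ) υ) (ρ : Env Γ) (u : τ.Den)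
    (v : σ.Den) : (M.rename Ren.wk.lift).den ((ρ.cons u).cons v) = M.den (ρ.cons v) := by
  rw [Tm.den_rename, Env.cons_lift]
  rfl

theorem Tm.den_rename_swap {Γ : Ctx} {σ τ υ : Ty} (M : Tm (σ :: τ :: Γ) υ) (ρ : Env Γ) (u : τ.Den)
    (v : σ.Den) : (M.rename Ren.swap).den ((ρ.cons v).cons u) = M.den ((ρ.cons u).cons v) := by
  rw [Tm.den_rename]
  congr 1
  funext τ x
  rcases x with _ | _ | x <;> rfl

theorem SCtx.holds_wk {Γ : Ctx} {σ : Ty} {Θ : SCtx Γ} {ρ : Env Γ} {v : σ.Den} {w : World} :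
    Θ.wk.Holds (ρ.cons v) w ↔ Θ.Holds ρ w := by
  simp only [SCtx.Holds, SCtx.wk, List.forall_mem_map, Tm.den_wk]

theorem SCtx.Holds.mono {Γ : Ctx} {Θ : SCtx Γ} {ρ : Env Γ} {w w' : World} (h : Θ.Holds ρ w)
    (hw : w.Le w') : Θ.Holds ρ w' :=
  fun T hT => SProp.mono _ hw (h T hT)

theorem SCtx.Holds.cons {Γ : Ctx} {Θ : SCtx Γ} {S : Tm Γ .spec} {ρ : Env Γ} {w : World}
    (hS : SProp.holds (S.den ρ) w) (h : Θ.Holds ρ w) : SCtx.Holds (S :: Θ) ρ w :=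
  List.forall_mem_cons.2 ⟨hS, h⟩

theorem PExp.den_openVar {Γ : Ctx} (e : PExp Γ 1) (ρ : Env Γ) (v : Val) :
    e.openVar.den (Env.cons (σ := .val) ρ v) = (e.den ρ).inst v := by
  have h : ProgSubstDen (fun _ : Fin 1 => (.term (.var .zero) : PVal (.val :: Γ) 0))
      (Env.cons (σ := .val) ρ v) (instSubst v) := by
    refine ⟨fun i => ?_, fun x => rfl⟩
    rw [Fin.fin_one_eq_zero i]
    simp only [PVal.den, Tm.den, Env.cons]
    exact (Val.rename_id v).symm
  rw [PExp.openVar, PExp.den_progSubst h, PExp.den_rename]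
  rfl

/-- The semantics of evaluation contexts. -/
def PCtx.den {Γ : Ctx} (ρ : Env Γ) : PCtx Γ → ECtx
  | .hole => .hole
  | .appL K e => .appL (K.den ρ) (e.den ρ)
  | .appR v K => .appR (v.den ρ) (K.den ρ)
  | .opL o K e => .opL o (K.den ρ) (e.den ρ)
  | .opR o v K => .opR o (v.den ρ) (K.den ρ)
  | .ite K e e' => .ite (K.den ρ) (e.den ρ) (e'.den ρ)
  | .pairL K e => .pairL (K.den ρ) (e.den ρ)
  | .pairR v K => .pairR (v.den ρ) (K.den ρ)
  | .proj i K => .proj i (K.den ρ)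
  | .ref K => .ref (K.den ρ)
  | .deref K => .deref (K.den ρ)

theorem PCtx.den_fill {Γ : Ctx} (K : PCtx Γ) (e : PExp Γ 0) (ρ : Env Γ) :
    (K.fill e).den ρ = (K.den ρ).fill (e.den ρ) := by
  induction K <;> simp_all only [PCtx.fill, PExp.den, PCtx.den, ECtx.fill, PVal.den_toPExp]

theorem PCtx.den_rename {Γ Δ : Ctx} (r : Ren Γ Δ) (K : PCtx Γ) (ρ : Env Δ) :
    (K.rename r).den ρ = K.den fun τ x => ρ τ (r τ x) := by
  induction K <;> simp_all only [PCtx.rename, PCtx.den, PVal.den_rename, PExp.den_rename]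

theorem PCtx.den_wk {Γ : Ctx} {σ : Ty} (K : PCtx Γ) (ρ : Env Γ) (v : σ.Den) :
    (K.rename Ren.wk).den (ρ.cons v) = K.den ρ :=
  PCtx.den_rename _ _ _

theorem PExp.den_ofVal_zero {Γ : Ctx} (M : Tm Γ .val) (ρ : Env Γ) :
    (PExp.ofVal M : PExp Γ 0).den ρ = Val.toExpr (M.den ρ) := by
  rw [PExp.den_ofVal]
  exact congrArg _ (Val.rename_id _)

theorem PVal.den_ofTm_zero {Γ : Ctx} (M : Tm Γ .val) (ρ : Env Γ) :
    (PVal.ofTm M : PVal Γ 0).den ρ = M.den ρ := by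
  rw [PVal.den_ofTm]
  exact Val.rename_id _

theorem PExp.den_valTerm_zero {Γ : Ctx} (M : Tm Γ .val) (ρ : Env Γ) :
    (PExp.valTerm M : PExp Γ 0).den ρ = Val.toExpr (M.den ρ) := by
  rw [PExp.den]
  exact congrArg _ (Val.rename_id _)

theorem Tm.den_append {Γ : Ctx} {τ : Ty} (M N : Tm Γ (.seq τ)) (ρ : Env Γ) :
    (Tm.append M N).den ρ = (List.append (M.den ρ) (N.den ρ) : List τ.Den) := by
  have h (l l' : List τ.Den) : l.foldl (fun acc x => x :: acc) l' = l.reverse ++ l' := by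
    induction l generalizing l' <;> simp_all
  simp only [Tm.den, Env.cons]
  rw [h, h]
  simp

theorem Tm.den_snoc {Γ : Ctx} {τ : Ty} (M : Tm Γ (.seq τ)) (N : Tm Γ τ) (ρ : Env Γ) :
    (Tm.snoc M N).den ρ = (List.append (M.den ρ) [N.den ρ] : List τ.Den) := by
  rw [Tm.snoc, Tm.den_append]
  simp only [Tm.den]

theorem Tm.den_numeral {Γ : Ctx} (ρ : Env Γ) (n : ℕ) : (Tm.numeral n : Tm Γ .nat).den ρ = n := by
  induction n with
  | zero => simp only [Tm.numeral, Tm.den]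
  | succ n ih => simp only [Tm.numeral, Tm.den, ih]

open Tm

/-! ## Soundness of the rules -/

theorem specValid_hoare {Γ : Ctx} {Θ : SCtx Γ} {P : Tm Γ .prop} {e : Tm Γ .exp}
    {Q : Tm Γ (.arrow .val .prop)}
    (h : ∀ (w : World) (ρ : Env Γ) (m : Res), Θ.Holds ρ w → m ∈ AProp.sat (P.den ρ) w →
      m ∈ wp (fun v => AProp.sat (Q.den ρ v)) (e.den ρ) w) :
    SpecValid Θ (.hoare P e Q) := by
  intro w ρ hΘ
  rw [Tm.den]
  exact fun w' hw' m hm => h w' ρ m (hΘ.mono hw') hm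

theorem SpecValid.wp {Γ : Ctx} {Θ : SCtx Γ} {P : Tm Γ .prop} {e : Tm Γ .exp}
    {Q : Tm Γ (.arrow .val .prop)} (h : SpecValid Θ (.hoare P e Q)) {w : World} {ρ : Env Γ}
    {m : Res} (hΘ : Θ.Holds ρ w) (hm : m ∈ AProp.sat (P.den ρ) w) :
    m ∈ TraceLogic.wp (fun v => AProp.sat (Q.den ρ v)) (e.den ρ) w := by
  have h' := h w ρ hΘ
  rw [Tm.den] at h'
  exact h' w (.refl w) hm

theorem specValid_eq {Γ : Ctx} {Θ : SCtx Γ} {τ : Ty} {M N : Tm Γ τ} :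
    SpecValid Θ (.eq .spec M N) ↔ ∀ (w : World) (ρ : Env Γ), Θ.Holds ρ w → M.den ρ = N.den ρ := by
  simp only [SpecValid, Tm.den, denEq, SProp.pure]

theorem mem_valPointsTo {Γ : Ctx} {M N : Tm Γ .val} {ρ : Env Γ} {w : World} {m : Res} :
    m ∈ AProp.sat ((valPointsTo M N).den ρ) w ↔
      ∃ l : Loc, M.den ρ = Val.loc l ∧ m.1.lookup l = some (N.den ρ) := by
  simp only [Tm.den, Tm.den_wk, denEx, denAnd, denEq, AProp.ex, AProp.and, AProp.pure,
    AProp.pointsTo, Env.cons]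
  rfl

theorem mem_valPointsToAny {Γ : Ctx} {M : Tm Γ .val} {ρ : Env Γ} {w : World} {m : Res} :
    m ∈ AProp.sat ((valPointsToAny M).den ρ) w ↔
      ∃ (v : Val) (l : Loc), M.den ρ = Val.loc l ∧ m.1.lookup l = some v := by
  rw [valPointsToAny, Tm.den]
  change (∃ v : Val, _) ↔ _
  refine exists_congr fun v => ?_
  rw [mem_valPointsTo, Tm.den_wk]
  simp only [Tm.den, Env.cons]

theorem AProp.mem_sep_of_pure {P : AProp} {p : Prop} {w : World} {m : Res} (h : m ∈ P.sat w)
    (hp : p) : m ∈ (AProp.sep P (.pure p)).sat w :=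
  ⟨m, Res.one, h, hp, Res.mul_one m⟩

theorem specValid_ret {Γ : Ctx} {Θ : SCtx Γ} (v : Tm Γ .val) :
    SpecValid Θ (triple (.top .asrt) (.ofVal v) (.lam (.eq .asrt v₀ v.wk))) := by
  refine specValid_hoare fun w ρ m hΘ hm => ?_
  rw [PExp.den_toTm, PExp.den_ofVal_zero]
  refine mem_wp_val ?_
  simp only [Tm.den, Tm.den_wk, Env.cons]
  exact rfl

theorem specValid_specOut {Γ : Ctx} {Θ : SCtx Γ} {S : Tm Γ .spec} {P : Tm Γ .prop} {e : Tm Γ .exp}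
    {R : Tm Γ (.arrow .val .prop)} (h : SpecValid (S :: Θ) (.hoare P e R)) :
    SpecValid Θ (.hoare (.sep P (.spec S)) e R) := by
  refine specValid_hoare fun w ρ m hΘ hm => ?_
  simp only [Tm.den] at hm
  obtain ⟨m₁, m₂, h₁, h₂, hm⟩ := hm
  exact h.wp (hΘ.cons h₂) (AProp.up _ h₁ (Res.le_mul_left hm))

theorem specValid_frame {Γ : Ctx} {Θ : SCtx Γ} {P : Tm Γ .prop} {e : Tm Γ .exp}
    {Q : Tm Γ (.arrow .val .prop)} (R : Tm Γ .prop) (h : SpecValid Θ (.hoare P e Q)) :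
    SpecValid Θ (.hoare (.sep P R) e (.lam (.sep (.app Q.wk v₀) R.wk))) := by
  refine specValid_hoare fun w ρ m hΘ hm => ?_
  simp only [Tm.den] at hm
  obtain ⟨m₁, m₂, h₁, h₂, hm⟩ := hm
  refine wp_frame (R := R.den ρ) (fun v w m₁ m₂ m h₁ h₂ hm => ?_) (h.wp hΘ h₁) h₂ hm
  simp only [Tm.den, Tm.den_wk, Env.cons]
  exact ⟨m₁, m₂, h₁, h₂, hm⟩

theorem specValid_bind {Γ : Ctx} {Θ : SCtx Γ} {P : Tm Γ .prop} {e : PExp Γ 0} {K : PCtx Γ}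
    {Q : Tm (.val :: Γ) .prop} {R : Tm (.val :: .val :: Γ) .prop}
    (h₁ : SpecValid Θ (triple P e (.lam Q)))
    (h₂ : SpecValid Θ.wk (triple Q ((K.rename Ren.wk).fill (.valTerm v₀)) (.lam R))) :
    SpecValid Θ (triple P (K.fill e) (.lam (.ex .asrt .val (R.rename Ren.swap)))) := by
  refine specValid_hoare fun w ρ m hΘ hm => ?_
  have h₁ := h₁.wp hΘ hm
  rw [PExp.den_toTm] at h₁ ⊢
  rw [PCtx.den_fill]
  refine wp_bind (w₀ := w) (fun v w' hw' m' hm' => ?_) (.refl w) h₁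
  rw [Tm.den] at hm'
  have h₂ := h₂.wp (ρ := Env.cons (σ := .val) ρ v) (SCtx.holds_wk.2 (hΘ.mono hw')) hm'
  rw [PExp.den_toTm, PCtx.den_fill, PExp.den_valTerm_zero, PCtx.den_wk] at h₂
  refine wp_mono (w₀ := w') (fun u w'' _ m'' hm'' => ?_) (.refl w') h₂
  simp only [Tm.den, Tm.den_rename_swap] at hm'' ⊢
  exact ⟨v, hm''⟩

theorem specValid_csq {Γ : Ctx} {Θ : SCtx Γ} {P₁ P₂ : Tm Γ .prop} {e : Tm Γ .exp}
    {Q₁ Q₂ : Tm Γ (.arrow .val .prop)} (h₁ : AsrtValid Θ P₁ P₂) (h₂ : SpecValid Θ (.hoare P₂ e Q₂))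
    (h₃ : AsrtValid Θ.wk (.app Q₂.wk v₀) (.app Q₁.wk v₀)) : SpecValid Θ (.hoare P₁ e Q₁) := by
  refine specValid_hoare fun w ρ m hΘ hm => ?_
  refine wp_mono (w₀ := w) (fun v w' hw' => ?_) (.refl w) (h₂.wp hΘ (h₁ w ρ hΘ hm))
  have h₃ := h₃ w' (Env.cons (σ := .val) ρ v) (SCtx.holds_wk.2 (hΘ.mono hw'))
  simpa only [Tm.den, Tm.den_wk, Env.cons] using h₃

theorem specValid_abs {Γ : Ctx} {Θ : SCtx Γ} {P : Tm (.val :: Γ) .prop} {e : PExp Γ 1}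
    {Q : Tm (.val :: Γ) (.arrow .val .prop)} (h : SpecValid Θ.wk (triple P e.openVar Q)) :
    SpecValid Θ (triple .emp (.lam e) (.lam (.all .asrt .val (.spec
      (triple (P.rename Ren.wk.lift) (.app (.valTerm v₁) (.valTerm v₀))
        (Q.rename Ren.wk.lift)))))) := by
  refine specValid_hoare fun w ρ m hΘ _ => ?_
  rw [PExp.den_toTm, PExp.den]
  refine wp_lam fun f w' hw' hf => ?_
  simp only [Tm.den]
  intro v w'' hw'' m' hm'
  rw [Tm.den_rename_wk_lift] at hm'
  rw [PExp.den_toTm, PExp.den, PExp.den_valTerm_zero, PExp.den_valTerm_zero, Tm.den_rename_wk_lift]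
  simp only [Tm.den, Env.cons]
  refine wp_app (hw''.1 f _ hf) ?_
  have h := h.wp (ρ := Env.cons (σ := .val) ρ v)
    (SCtx.holds_wk.2 (hΘ.mono (hw'.trans hw''))) hm'
  rwa [PExp.den_toTm, PExp.den_openVar] at h

theorem specValid_write {Γ : Ctx} {Θ : SCtx Γ} (l v : Tm Γ .val) :
    SpecValid Θ (triple (valPointsToAny l) (.binop .assign (.ofVal l) (.ofVal v))
      (.lam (.sep (valPointsTo l.wk v.wk) (.eq .asrt v₀ (.val .unit))))) := by
  refine specValid_hoare fun w ρ m _ hm => ?_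
  obtain ⟨u, l', hl, hu⟩ := mem_valPointsToAny.1 hm
  rw [PExp.den_toTm, PExp.den, PExp.den_ofVal_zero, PExp.den_ofVal_zero, hl]
  refine wp_assign hu ?_
  rw [Tm.den]
  beta_reduce
  rw [Tm.den]
  refine AProp.mem_sep_of_pure (mem_valPointsTo.2 ?_) ?_
  · rw [Tm.den_wk, Tm.den_wk]
    exact ⟨l', hl, Finmap.lookup_insert _⟩
  · simp only [Tm.den, PVal.den, Env.cons]

theorem specValid_read {Γ : Ctx} {Θ : SCtx Γ} (l v : Tm Γ .val) :
    SpecValid Θ (triple (valPointsTo l v) (.deref (.ofVal l))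
      (.lam (.sep (valPointsTo l.wk v.wk) (.eq .asrt v₀ v.wk)))) := by
  refine specValid_hoare fun w ρ m _ hm => ?_
  obtain ⟨l', hl, hv⟩ := mem_valPointsTo.1 hm
  rw [PExp.den_toTm, PExp.den, PExp.den_ofVal_zero, hl]
  refine wp_deref hv ?_
  rw [Tm.den]
  beta_reduce
  rw [Tm.den]
  refine AProp.mem_sep_of_pure (mem_valPointsTo.2 ?_) ?_
  · rw [Tm.den_wk, Tm.den_wk]
    exact ⟨l', hl, hv⟩
  · simp only [Tm.den, Tm.den_wk, Env.cons]

theorem specValid_alloc {Γ : Ctx} {Θ : SCtx Γ} (v : Tm Γ .val) :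
    SpecValid Θ (triple .emp (.ref (.ofVal v)) (.lam (valPointsTo v₀ v.wk))) := by
  refine specValid_hoare fun w ρ m _ hm => ?_
  rw [PExp.den_toTm, PExp.den, PExp.den_ofVal_zero]
  refine wp_ref fun l => ?_
  rw [Tm.den]
  refine mem_valPointsTo.2 ⟨l, by simp only [Tm.den, Env.cons], ?_⟩
  rw [Tm.den_wk]
  exact Finmap.lookup_insert _

theorem wp_emit_of_inv {Γ : Ctx} {Θ : SCtx Γ} {t : Tm Γ .trace} {v : Tm Γ .val}
    {I : Tm Γ (.arrow .trace .bool)} {Q : Tm Γ (.arrow .val .prop)}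
    (h : SpecValid Θ (.eq .spec (.app I (snoc t v)) .true))
    (hQ : ∀ (w : World) (ρ : Env Γ) (m : Res), m ∈ AProp.sat ((Tm.trace (snoc t v)).den ρ) w →
      m ∈ AProp.sat (Q.den ρ Val.unit) w) :
    SpecValid Θ (triple (.sep (.trace t) (.inv I)) (.emit (.ofTm v)) Q) := by
  refine specValid_hoare fun w ρ m hΘ hm => ?_
  have hI := specValid_eq.1 h w ρ hΘ
  rw [Tm.den, Tm.den_snoc, Tm.den] at hI
  rw [Tm.den, Tm.den, Tm.den] at hm
  obtain ⟨m₁, m₂, h₁, h₂, hm⟩ := hm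
  rw [PExp.den_toTm, PExp.den, PVal.den_ofTm_zero]
  have ht := TraceRes.full_le (TraceRes.Le.trans h₁ (Res.le_mul_left hm).trace)
  have hw : w.inv = {t' | I.den ρ t' = Bool.true} := h₂
  refine wp_emit ht (by rw [hw]; exact hI) (hQ w ρ _ ?_)
  rw [Tm.den, Tm.den_snoc]
  exact TraceRes.full_le_refl _

theorem specValid_emit {Γ : Ctx} {Θ : SCtx Γ} {t : Tm Γ .trace} {v : Tm Γ .val}
    {I : Tm Γ (.arrow .trace .bool)}
    (h : SpecValid Θ (.eq .spec (.app I (snoc t v)) .true)) :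
    SpecValid Θ (triple (.sep (.trace t) (.inv I)) (.emit (.ofTm v))
      (const (.trace (snoc t v)))) := by
  refine wp_emit_of_inv h fun w ρ m hm => ?_
  rw [Tm.den]
  beta_reduce
  rwa [Tm.den_wk]

theorem specValid_emitUnit {Γ : Ctx} {Θ : SCtx Γ} {t : Tm Γ .trace} {v : Tm Γ .val}
    {I : Tm Γ (.arrow .trace .bool)}
    (h : SpecValid Θ (.eq .spec (.app I (snoc t v)) .true)) :
    SpecValid Θ (triple (.sep (.trace t) (.inv I)) (.emit (.ofTm v))
      (.lam (.sep (Tm.wk (.trace (snoc t v))) (.eq .asrt v₀ (.val .unit))))) := by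
  refine wp_emit_of_inv h fun w ρ m hm => ?_
  rw [Tm.den]
  beta_reduce
  rw [Tm.den, Tm.den_wk]
  refine AProp.mem_sep_of_pure hm ?_
  simp only [Tm.den, PVal.den, Env.cons]

theorem specValid_exPre {Γ : Ctx} {Θ : SCtx Γ} {τ : Ty} {P : Tm (τ :: Γ) .prop} {e : Tm Γ .exp}
    {Q : Tm Γ (.arrow .val .prop)} (h : SpecValid Θ.wk (.hoare P e.wk Q.wk)) :
    SpecValid Θ (.hoare (.ex .asrt τ P) e Q) := by
  refine specValid_hoare fun w ρ m hΘ hm => ?_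
  rw [Tm.den] at hm
  obtain ⟨x, hm⟩ := hm
  have h := h.wp (SCtx.holds_wk.2 hΘ) hm
  rwa [Tm.den_wk, Tm.den_wk] at h

theorem specValid_proj {Γ : Ctx} {Θ : SCtx Γ} (i : Side) (u v : Tm Γ .val) :
    SpecValid Θ (triple (.top .asrt) (.proj i (.pair (.ofVal u) (.ofVal v)))
      (.lam (.eq .asrt v₀ (match i with | .one => u.wk | .two => v.wk)))) := by
  refine specValid_hoare fun w ρ m _ _ => ?_
  rw [PExp.den_toTm, PExp.den, PExp.den, PExp.den_ofVal_zero, PExp.den_ofVal_zero]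
  refine wp_proj ?_
  cases i
  all_goals
    simp only [Tm.den, Tm.den_wk, Env.cons]
    exact rfl

theorem specValid_condTrue {Γ : Ctx} {Θ : SCtx Γ} {P : Tm Γ .prop} {n : ℤ} {e₁ e₂ : PExp Γ 0}
    {Q : Tm Γ (.arrow .val .prop)} (hn : 0 < n) (h : SpecValid Θ (triple P e₁ Q)) :
    SpecValid Θ (triple P (.ite (.int n) e₁ e₂) Q) := by
  refine specValid_hoare fun w ρ m hΘ hm => ?_
  have h := h.wp hΘ hm
  rw [PExp.den_toTm] at h ⊢
  rw [PExp.den, PExp.den]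
  exact wp_iteTrue hn h

theorem specValid_condFalse {Γ : Ctx} {Θ : SCtx Γ} {P : Tm Γ .prop} {e₁ e₂ : PExp Γ 0}
    {Q : Tm Γ (.arrow .val .prop)} (h : SpecValid Θ (triple P e₂ Q)) :
    SpecValid Θ (triple P (.ite (.int 0) e₁ e₂) Q) := by
  refine specValid_hoare fun w ρ m hΘ hm => ?_
  have h := h.wp hΘ hm
  rw [PExp.den_toTm] at h ⊢
  rw [PExp.den, PExp.den]
  exact wp_iteFalse h

theorem specValid_arith {Γ : Ctx} {Θ : SCtx Γ} (o : BinOp) (i j k : ℤ)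
    (h : o.eval (.int i) (.int j) = some (.int k)) :
    SpecValid Θ (triple (.top .asrt) (.binop o (.int i) (.int j))
      (.lam (.eq .asrt v₀ (.val (.int k))))) := by
  refine specValid_hoare fun w ρ m _ _ => ?_
  rw [PExp.den_toTm, PExp.den, PExp.den, PExp.den]
  refine wp_binop (u := .int i) (v := .int j) h ?_
  simp only [Tm.den, PVal.den, Env.cons]
  exact rfl

theorem specValid_eqTest {Γ : Ctx} {Θ : SCtx Γ} (u v : Tm Γ .val) :
    SpecValid Θ (triple (.top .asrt) (.binop .eq (.ofVal u) (.ofVal v))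
      (.lam (.or .asrt
        (.and .asrt (.eq .asrt u.wk v.wk) (.eq .asrt v₀ (.val (.int 1))))
        (.and .asrt (.imp .asrt (.eq .asrt u.wk v.wk) (.bot .asrt))
          (.eq .asrt v₀ (.val (.int 0))))))) := by
  refine specValid_hoare fun w ρ m _ _ => ?_
  rw [PExp.den_toTm, PExp.den, PExp.den_ofVal_zero, PExp.den_ofVal_zero]
  refine wp_binop rfl ?_
  simp only [Tm.den, Tm.den_wk, PVal.den, Env.cons]
  by_cases huv : u.den ρ = v.den ρ
  · exact .inl ⟨huv, by simp [huv]; rfl⟩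
  · exact .inr ⟨fun _ _ _ _ h => huv h, by simp [huv]; rfl⟩

theorem specValid_natInd {Γ : Ctx} {Θ : SCtx Γ} (S : Tm Γ (.arrow .nat .spec))
    (h₁ : SpecValid Θ (.app S .zero))
    (h₂ : SpecValid Θ (.all .spec .nat (.imp .spec (.app S.wk v₀) (.app S.wk (.succ v₀))))) :
    SpecValid Θ (.all .spec .nat (.app S.wk v₀)) := by
  intro w ρ hΘ
  have h₁ := h₁ w ρ hΘ
  have h₂ := h₂ w ρ hΘ
  simp only [Tm.den, Tm.den_wk, Env.cons] at h₁ h₂ ⊢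
  intro (n : ℕ)
  induction n with
  | zero => exact h₁
  | succ n ih => exact h₂ n w (.refl w) ih

theorem specValid_seqInd {Γ : Ctx} {Θ : SCtx Γ} {τ : Ty} (S : Tm Γ (.arrow (.seq τ) .spec))
    (h₁ : SpecValid Θ (.app S (.nil τ)))
    (h₂ : SpecValid Θ (.all .spec (.seq τ) (.all .spec τ
      (.imp .spec (.app S.wk.wk v₁) (.app S.wk.wk (.cons v₀ v₁)))))) :
    SpecValid Θ (.all .spec (.seq τ) (.app S.wk v₀)) := by
  intro w ρ hΘ
  have h₁ := h₁ w ρ hΘ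
  have h₂ := h₂ w ρ hΘ
  simp only [Tm.den, Tm.den_wk, Env.cons] at h₁ h₂ ⊢
  intro (l : List τ.Den)
  induction l with
  | nil => exact h₁
  | cons x l ih => exact h₂ l x w (.refl w) ih

theorem asrtValid_useHist {Γ : Ctx} {Θ : SCtx Γ} (t₁ t₂ : Tm Γ .trace) :
    AsrtValid Θ (.sep (.trace t₁) (.hist t₂)) (.sep (.trace t₁) (isPrefix t₂ t₁)) := by
  intro w ρ _ m hm
  rw [Tm.den, Tm.den, Tm.den] at hm
  obtain ⟨m₁, m₂, h₁, h₂, hm⟩ := hm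
  have ht := TraceRes.full_le (TraceRes.Le.trans h₁ (Res.le_mul_left hm).trace)
  have ht' := TraceRes.hist_le.1 (TraceRes.Le.trans h₂ (Res.le_mul_right hm).trace)
  rw [ht] at ht'
  obtain ⟨u, hu⟩ := ht'
  rw [Tm.den, Tm.den, Tm.den]
  refine ⟨m₁, m₂, h₁, ⟨u, ?_⟩, hm⟩
  beta_reduce
  rw [Tm.den, Tm.den_append, Tm.den_wk, Tm.den_wk]
  exact hu.symm

theorem asrtValid_histDupl {Γ : Ctx} {Θ : SCtx Γ} (t : Tm Γ .trace) :
    AsrtValid Θ (.hist t) (.sep (.hist t) (.hist t)) := by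
  intro w ρ _ m hm
  simp only [Tm.den] at hm ⊢
  exact ⟨m, (∅, (.hist, t.den ρ)), hm, TraceRes.hist_le.2 List.prefix_rfl,
    Res.mul_empty (TraceRes.hist_le.1 hm)⟩

theorem asrtValid_allocHist {Γ : Ctx} {Θ : SCtx Γ} (t : Tm Γ .trace) :
    AsrtValid Θ (.trace t) (.sep (.trace t) (.hist t)) := by
  intro w ρ _ m hm
  simp only [Tm.den] at hm ⊢
  refine ⟨m, (∅, (.hist, t.den ρ)), hm, TraceRes.hist_le.2 List.prefix_rfl, Res.mul_empty ?_⟩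
  rw [TraceRes.full_le hm]

theorem AProp.mem_sep_true {P Q : AProp} {w : World} {m : Res} (h : m ∈ P.sat w)
    (hQ : Res.one ∈ Q.sat w) : m ∈ (AProp.sep P Q).sat w :=
  ⟨m, Res.one, h, hQ, Res.mul_one m⟩

mutual

/-- Soundness of the specification logic. -/
theorem SpecEnt.sound : {Γ : Ctx} → {Θ : SCtx Γ} → {S : Tm Γ .spec} → SpecEnt Θ S → SpecValid Θ S
  | _, _, _, .hyp h => fun _ _ hΘ => hΘ _ h
  | _, _, _, .topI => fun _ _ _ => by rw [Tm.den]; trivial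
  | _, _, _, .botE h => fun w ρ hΘ => by
    have h := h.sound w ρ hΘ
    rw [Tm.den] at h
    exact h.elim
  | _, _, _, .andI h₁ h₂ => fun w ρ hΘ => by
    rw [Tm.den]
    exact ⟨h₁.sound w ρ hΘ, h₂.sound w ρ hΘ⟩
  | _, _, _, .andE₁ h => fun w ρ hΘ => by
    have h := h.sound w ρ hΘ
    rw [Tm.den] at h
    exact h.1
  | _, _, _, .andE₂ h => fun w ρ hΘ => by
    have h := h.sound w ρ hΘ
    rw [Tm.den] at h
    exact h.2
  | _, _, _, .orI₁ h => fun w ρ hΘ => by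
    rw [Tm.den]
    exact .inl (h.sound w ρ hΘ)
  | _, _, _, .orI₂ h => fun w ρ hΘ => by
    rw [Tm.den]
    exact .inr (h.sound w ρ hΘ)
  | _, _, _, .orE h h₁ h₂ => fun w ρ hΘ => by
    have h := h.sound w ρ hΘ
    rw [Tm.den] at h
    exact h.elim (fun h => h₁.sound w ρ (hΘ.cons h)) fun h => h₂.sound w ρ (hΘ.cons h)
  | _, _, _, .impI h => fun w ρ hΘ => by
    rw [Tm.den]
    exact fun w' hw' hS => h.sound w' ρ ((hΘ.mono hw').cons hS)
  | _, _, _, .impE h h₁ => fun w ρ hΘ => by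
    have h := h.sound w ρ hΘ
    rw [Tm.den] at h
    exact h w (.refl w) (h₁.sound w ρ hΘ)
  | _, _, _, .allI h => fun w ρ hΘ => by
    rw [Tm.den]
    exact fun v => h.sound w (ρ.cons v) (SCtx.holds_wk.2 hΘ)
  | _, _, _, .allE h M => fun w ρ hΘ => by
    have h := h.sound w ρ hΘ
    rw [Tm.den] at h
    rw [Tm.den_inst]
    exact h (M.den ρ)
  | _, _, _, .exI M h => fun w ρ hΘ => by
    have h := h.sound w ρ hΘ
    rw [Tm.den_inst] at h
    rw [Tm.den]
    exact ⟨M.den ρ, h⟩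
  | _, _, _, .exE h h₁ => fun w ρ hΘ => by
    have h := h.sound w ρ hΘ
    rw [Tm.den] at h
    obtain ⟨v, h⟩ := h
    have h₁ := h₁.sound w (ρ.cons v) (SCtx.Holds.cons h (SCtx.holds_wk.2 hΘ))
    rwa [Tm.den_wk] at h₁
  | _, _, _, .eqRefl M => specValid_eq.2 fun _ _ _ => rfl
  | _, _, _, .eqSubst S h h₁ => fun w ρ hΘ => by
    have h₁ := h₁.sound w ρ hΘ
    rw [Tm.den_inst] at h₁ ⊢
    rwa [← specValid_eq.1 h.sound w ρ hΘ]
  | _, _, _, .beta M N => specValid_eq.2 fun _ _ _ => by simp only [Tm.den, Tm.den_inst]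
  | _, _, _, .funExt h => specValid_eq.2 fun w ρ hΘ => by
    funext v
    have h := specValid_eq.1 h.sound w (ρ.cons v) (SCtx.holds_wk.2 hΘ)
    simpa only [Tm.den, Tm.den_wk, Env.cons] using h
  | _, _, _, .unitEta M => specValid_eq.2 fun _ _ _ => rfl
  | _, _, _, .fstPair M N => specValid_eq.2 fun _ _ _ => by simp only [Tm.den]
  | _, _, _, .sndPair M N => specValid_eq.2 fun _ _ _ => by simp only [Tm.den]
  | _, _, _, .pairEta M => specValid_eq.2 fun _ _ _ => by simp only [Tm.den]
  | _, _, _, .ifTrue M N => specValid_eq.2 fun _ _ _ => by simp only [Tm.den, cond_true]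
  | _, _, _, .ifFalse M N => specValid_eq.2 fun _ _ _ => by simp only [Tm.den, cond_false]
  | _, _, _, .foldNil N₁ N₂ => specValid_eq.2 fun _ _ _ => by simp only [Tm.den, List.foldl_nil]
  | _, _, _, .foldCons M N N₁ N₂ => specValid_eq.2 fun _ _ _ => by
    simp only [Tm.den, List.foldl_cons]
  | _, _, _, .boolInd S h₁ h₂ => fun w ρ hΘ => by
    have h₁ := h₁.sound w ρ hΘ
    have h₂ := h₂.sound w ρ hΘ
    simp only [Tm.den_inst, Tm.den] at h₁ h₂ ⊢
    rintro (_ | _)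
    exacts [h₂, h₁]
  | _, _, _, .natInd S h₁ h₂ => specValid_natInd S h₁.sound h₂.sound
  | _, _, _, .seqInd S h₁ h₂ => specValid_seqInd S h₁.sound h₂.sound
  | _, _, _, .succInj h => specValid_eq.2 fun w ρ hΘ => by
    have h := specValid_eq.1 h.sound w ρ hΘ
    simpa only [Tm.den, Nat.succ.injEq] using h
  | _, _, _, .succNeZero h => fun w ρ hΘ => by
    have h := specValid_eq.1 h.sound w ρ hΘ
    simp only [Tm.den] at h
    exact absurd h (Nat.succ_ne_zero _)
  | _, _, _, .locValInj h => specValid_eq.2 fun w ρ hΘ => by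
    have h := specValid_eq.1 h.sound w ρ hΘ
    simpa only [Tm.den, Val.loc.injEq] using h
  | _, _, _, .natValInj h => specValid_eq.2 fun w ρ hΘ => by
    have h := specValid_eq.1 h.sound w ρ hΘ
    simpa only [Tm.den, Val.int.injEq, Nat.cast_inj] using h
  | _, _, _, .natValNumeral n => specValid_eq.2 fun w ρ hΘ => by
    simp only [Tm.den, Tm.den_numeral, PVal.den]
  | _, _, _, .valid h => fun w ρ hΘ => by
    have h := h.sound w ρ hΘ
    rw [Tm.den] at h
    rw [Tm.den]
    exact Set.eq_univ_of_univ_subset fun m _ => h trivial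
  | _, _, _, .ret v => specValid_ret v
  | _, _, _, .specOut h => specValid_specOut h.sound
  | _, _, _, .frame R h => specValid_frame R h.sound
  | _, _, _, .bind h₁ h₂ => specValid_bind h₁.sound h₂.sound
  | _, _, _, .csq h₁ h₂ h₃ => specValid_csq h₁.sound h₂.sound h₃.sound
  | _, _, _, .abs h => specValid_abs h.sound
  | _, _, _, .write l v => specValid_write l v
  | _, _, _, .read l v => specValid_read l v
  | _, _, _, .alloc v => specValid_alloc v
  | _, _, _, .emit _ _ _ h => specValid_emit h.sound
  | _, _, _, .emitUnit _ _ _ h => specValid_emitUnit h.sound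
  | _, _, _, .exPre h => specValid_exPre h.sound
  | _, _, _, .projOne u v => specValid_proj .one u v
  | _, _, _, .projTwo u v => specValid_proj .two u v
  | _, _, _, .condTrue hn h => specValid_condTrue hn h.sound
  | _, _, _, .condFalse h => specValid_condFalse h.sound
  | _, _, _, .arith o i j k h => specValid_arith o i j k h
  | _, _, _, .eqTest u v => specValid_eqTest u v

/-- Soundness of the assertion logic. -/
theorem AsrtEnt.sound : {Γ : Ctx} → {Θ : SCtx Γ} → {P Q : Tm Γ .prop} → AsrtEnt Θ P Q →
    AsrtValid Θ P Q
  | _, _, _, _, .refl _ => fun _ _ _ => subset_rfl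
  | _, _, _, _, .trans h₁ h₂ => fun w ρ hΘ => (h₁.sound w ρ hΘ).trans (h₂.sound w ρ hΘ)
  | _, _, _, _, .topI _ => fun _ _ _ _ _ => by rw [Tm.den]; trivial
  | _, _, _, _, .botE _ => fun _ _ _ _ hm => by
    rw [Tm.den] at hm
    exact hm.elim
  | _, _, _, _, .andI h₁ h₂ => fun w ρ hΘ m hm => by
    rw [Tm.den]
    exact ⟨h₁.sound w ρ hΘ hm, h₂.sound w ρ hΘ hm⟩
  | _, _, _, _, .andE₁ _ _ => fun _ _ _ _ hm => by
    rw [Tm.den] at hm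
    exact hm.1
  | _, _, _, _, .andE₂ _ _ => fun _ _ _ _ hm => by
    rw [Tm.den] at hm
    exact hm.2
  | _, _, _, _, .orI₁ _ _ => fun _ _ _ _ hm => by
    rw [Tm.den]
    exact .inl hm
  | _, _, _, _, .orI₂ _ _ => fun _ _ _ _ hm => by
    rw [Tm.den]
    exact .inr hm
  | _, _, _, _, .orE h₁ h₂ => fun w ρ hΘ _ hm => by
    rw [Tm.den] at hm
    exact hm.elim (fun h => h₁.sound w ρ hΘ h) fun h => h₂.sound w ρ hΘ h
  | _, _, _, _, .impI (P := P) (Q := Q) h => fun w ρ hΘ m hm => by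
    rw [Tm.den]
    intro m' hm' w' hw' hQ
    refine h.sound w' ρ (hΘ.mono hw') ?_
    rw [Tm.den]
    exact ⟨AProp.up _ (AProp.mono _ hw' hm) hm', hQ⟩
  | _, _, _, _, .impE h₁ h₂ => fun w ρ hΘ m hm => by
    have h₁ := h₁.sound w ρ hΘ hm
    rw [Tm.den] at h₁
    exact h₁ m (.refl m) w (.refl w) (h₂.sound w ρ hΘ hm)
  | _, _, _, _, .allI (P := P) h => fun w ρ hΘ m hm => by
    rw [Tm.den]
    intro v
    refine h.sound w (ρ.cons v) (SCtx.holds_wk.2 hΘ) ?_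
    rwa [Tm.den_wk]
  | _, _, _, _, .allE Q M => fun w ρ hΘ m hm => by
    rw [Tm.den] at hm
    rw [Tm.den_inst]
    exact hm _
  | _, _, _, _, .exI Q M => fun w ρ hΘ m hm => by
    rw [Tm.den_inst] at hm
    rw [Tm.den]
    exact ⟨_, hm⟩
  | _, _, _, _, .exE h => fun w ρ hΘ m hm => by
    rw [Tm.den] at hm
    obtain ⟨v, hm⟩ := hm
    have h := h.sound w (ρ.cons v) (SCtx.holds_wk.2 hΘ) hm
    rwa [Tm.den_wk] at h
  | _, _, _, _, .eqRefl _ _ => fun _ _ _ _ _ => by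
    rw [Tm.den]
    exact rfl
  | _, _, _, _, .eqSubst (M := M) (N := N) Q h₁ h₂ => fun w ρ hΘ m hm => by
    have h₁ := h₁.sound w ρ hΘ hm
    have h₂ := h₂.sound w ρ hΘ hm
    rw [Tm.den] at h₁
    have h₁ : M.den ρ = N.den ρ := h₁
    rw [Tm.den_inst] at h₂ ⊢
    rwa [← h₁]
  | _, _, _, _, .sepMono h₁ h₂ => fun w ρ hΘ m hm => by
    rw [Tm.den] at hm ⊢
    obtain ⟨m₁, m₂, hm₁, hm₂, hm⟩ := hm
    exact ⟨m₁, m₂, h₁.sound w ρ hΘ hm₁, h₂.sound w ρ hΘ hm₂, hm⟩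
  | _, _, _, _, .sepComm _ _ => fun w ρ hΘ m hm => by
    rw [Tm.den] at hm ⊢
    obtain ⟨m₁, m₂, hm₁, hm₂, hm⟩ := hm
    exact ⟨m₂, m₁, hm₂, hm₁, Res.mul_comm hm⟩
  | _, _, _, _, .sepAssoc _ _ _ => fun w ρ hΘ m hm => by
    simp only [Tm.den] at hm ⊢
    obtain ⟨m₁₂, m₃, ⟨m₁, m₂, hm₁, hm₂, hm₁₂⟩, hm₃, hm⟩ := hm
    obtain ⟨m₂₃, h, h'⟩ := Res.mul_assoc hm₁₂ hm
    exact ⟨m₁, m₂₃, hm₁, ⟨m₂, m₃, hm₂, hm₃, h⟩, h'⟩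
  | _, _, _, _, .sepEmpI _ => fun w ρ hΘ m hm => by
    rw [Tm.den, Tm.den]
    exact AProp.mem_sep_of_pure hm trivial
  | _, _, _, _, .sepEmpE _ => fun w ρ hΘ m hm => by
    rw [Tm.den] at hm
    obtain ⟨m₁, m₂, hm₁, -, hm⟩ := hm
    exact AProp.up _ hm₁ (Res.le_mul_left hm)
  | _, _, _, _, .empI _ => fun _ _ _ _ _ => by rw [Tm.den]; trivial
  | _, _, _, _, .wandI h => fun w ρ hΘ m hm => by
    rw [Tm.den]
    intro w' hw' m' hm' m'' r hr hQ
    refine h.sound w' ρ (hΘ.mono hw') ?_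
    rw [Tm.den]
    exact ⟨m', m'', AProp.up _ (AProp.mono _ hw' hm) hm', hQ, hr⟩
  | _, _, _, _, .wandE _ _ => fun w ρ hΘ m hm => by
    rw [Tm.den, Tm.den] at hm
    obtain ⟨m₁, m₂, hm₁, hm₂, hm⟩ := hm
    exact hm₁ w (.refl w) m₁ (.refl m₁) m₂ m hm hm₂
  | _, _, _, _, .spec _ _ => fun w ρ hΘ m hm => by
    rw [Tm.den]
    exact (List.forall_mem_cons.1 hΘ).1
  | _, _, _, _, .valid _ _ => fun w ρ hΘ m hm => by
    have h := (List.forall_mem_cons.1 hΘ).1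
    rw [Tm.den] at h
    have h : AProp.sat _ w = Set.univ := h
    rw [h]
    trivial
  | _, _, _, _, .specCut h₁ h₂ => fun w ρ hΘ => h₂.sound w ρ (hΘ.cons (h₁.sound w ρ hΘ))
  | _, _, _, _, .invDupl _ => fun w ρ hΘ m hm => by
    rw [Tm.den]
    refine AProp.mem_sep_true hm ?_
    rw [Tm.den] at hm ⊢
    exact hm
  | _, _, _, _, .histDupl t => asrtValid_histDupl t
  | _, _, _, _, .useHist t₁ t₂ => asrtValid_useHist t₁ t₂
  | _, _, _, _, .allocHist t => asrtValid_allocHist t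

end

end TraceLogic

theorem mainTheorem2 (Γ : TraceLogic.Ctx) (Θ : TraceLogic.SCtx Γ)
    (S : TraceLogic.Tm Γ TraceLogic.Ty.spec) (h : TraceLogic.SpecEnt Θ S) :
    TraceLogic.SpecValid Θ S :=
  h.sound
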